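/- **Setting.** Let $d\in\{2,3\}$ and let $\Omega\subset\mathbb R^d$ be a bounded Lipschitz domain that a smooth embedded interface $\Gamma\subset\Omega$ divides into two nonempty open subdomains, $\Omega=\Omega_1\sqcup\Gamma\sqcup\Omega_2$: near every $z\in\overline\Gamma$ there is a $C^\infty$ function $\phi$ with $\nabla\phi(z)\ne0$ such that, in $\Omega$ near $z$, $\Omega_1=\{\phi>0\}$ and $\Omega_2=\{\phi<0\}$. If $\Gamma$ reaches $\partial\Omega$, it does so transversally: for every $z\in\overline\Gamma\cap\partial\Omega$ there is a unit vector $e$ with $\nabla\phi(z)\cdot e=0$ such that near $z$ the set $\Omega$ lies above the graph, in direction $e$, of a Lipschitz function with constant at most $L$. (If $\overline\Gamma\subset\Omega$, this condition is empty and $L$ is irrelevant.) Let $\mathcal T_h$ be a finite conforming triangulation of $\overline\Omega$ into nondegenerate $d$-simplices which is shape regular (each $K\in\mathcal T_h$ contains a ball of radius $\rho_K>0$ with $\operatorname{diam}K\le\sigma\rho_K$) and quasi-uniform ($\operatorname{diam}K\le h\le\tau\operatorname{diam}K$ for all $K\in\mathcal T_h$). Let $0\le\delta\le\kappa h$ and,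 for $k=1,2$, $$\mathcal T_{h,k}=\{K\in\mathcal T_h:\ \exists\,x\in K,\ \operatorname{dist}(x,\Omega_k)\le\delta\},\qquad \Omega_{h,k}=\operatorname{int}\bigcup_{K\in\mathcal T_{h,k}}K .$$ For a node $x_j$ (a vertex of a simplex of $\mathcal T_{h,k}$) let $\varphi_j$ be the continuous piecewise affine function on $\bigcup_{K\in\mathcal T_{h,k}}K$ that equals $1$ at $x_j$ and $0$ at all other nodes. The lumped-mass projection is $$\mathcal P_kv=\sum_j\frac{\int_{\Omega_{h,k}}v\,\varphi_j\,dx}{\int_{\Omega_{h,k}}\varphi_j\,dx}\,\varphi_j .$$ Let $\mathcal P_k$ denote this operator with the sum over all nodes, and $\mathcal P_k^0$ the operator with the sum over the nodes not on $D_k:=\partial\Omega\cap\partial\Omega_{h,k}$ only, i.e. over the nodal basis of the finite element space with zero values on $D_k$. (They coincide if $D_k=\emptyset$. On vector fields they act componentwise.) **Lemma 4.3.** There is a constant $C>0$ that depends only on $d$, the mesh regularity parameters $\sigma,\tau$, the number $\kappa$, and (only if $\Gamma$ reaches $\partial\Omega$) on $L$, such that for all $\Omega,\Omega_1,\Omega_2,\Gamma$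 as above there is $h_0>0$ such that for all $\mathcal T_h$, $h$, $\delta$ as above and $k=1,2$: 1. for all $v\in L^2(\Omega_{h,k})$ (without any restriction on $h$), $$\|\mathcal P_kv\|_{L^2(\Omega_{h,k})}\le C\|v\|_{L^2(\Omega_{h,k})},\qquad \|\mathcal P^0_kv\|_{L^2(\Omega_{h,k})}\le C\|v\|_{L^2(\Omega_{h,k})};$$ 2. if $h\le h_0$, then for all $v\in H^1(\Omega_{h,k})$ we have $\mathcal P_kv\in H^1(\Omega_{h,k})$ and $$\|\nabla\mathcal P_kv\|_{L^2(\Omega_{h,k})}\le C\|\nabla v\|_{L^2(\Omega_{h,k})},\qquad \|v-\mathcal P_kv\|_{L^2(\Omega_{h,k})}\le C\,h\,\|\nabla v\|_{L^2(\Omega_{h,k})};$$ 3. if $h\le h_0$, then the same holds for $\mathcal P^0_k$ in place of $\mathcal P_k$, for all $v\in H^1(\Omega_{h,k})$ that vanish on $D_k$ (i.e. that lie in the $H^1(\Omega_{h,k})$-closure of the functions vanishing in a neighbourhood of $D_k$). -/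

import Mathlib

open MeasureTheory Set
open scoped NNReal ENNReal ContDiff

/-- Points of `ℝ^d` with the Euclidean norm. -/
abbrev Pt (d : ℕ) : Type := EuclideanSpace ℝ (Fin d)

/-! ### Geometry: a Lipschitz domain divided by a smooth interface -/

/-- Near `z`, the set `Ω` lies above the graph (in the unit direction `e`) of a Lipschitz
function with constant `L` on the hyperplane orthogonal to `e`. -/
def IsLipschitzGraphNear {d : ℕ} (Ω : Set (Pt d)) (z e : Pt d) (L : ℝ≥0) : Prop :=
  ‖e‖ = 1 ∧ ∃ r : ℝ, 0 < r ∧ ∃ g : Pt d → ℝ, LipschitzWith L g ∧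
    ∀ x ∈ Metric.ball z r, x ∈ Ω ↔ g (x - (inner ℝ e x : ℝ) • e) < (inner ℝ e x : ℝ)

/-- Bounded Lipschitz domain. -/
structure IsBoundedLipschitzDomain {d : ℕ} (Ω : Set (Pt d)) : Prop where
  isOpen : IsOpen Ω
  isConnected : IsConnected Ω
  isBounded : Bornology.IsBounded Ω
  lipschitz : ∀ z ∈ frontier Ω, ∃ (e : Pt d) (L : ℝ≥0), IsLipschitzGraphNear Ω z e L

/-- `Ω` is divided by the smooth embedded interface `Γ` into the two open subdomains `Ωs 0` and
`Ωs 1`: near each point of the closure of `Γ` there is a smooth level set function with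
nonvanishing gradient which is positive on `Ωs 0`, negative on `Ωs 1` (and so zero on `Γ`).
`Γ` may be a closed hypersurface inside `Ω`; where it reaches the boundary of `Ω`, it does so
transversally: there `Ω` is a Lipschitz graph domain, with constant at most `L`, with respect to
a direction `e` tangent to `Γ`. -/
structure IsSmoothInterface {d : ℕ} (L : ℝ≥0) (Ω Γ : Set (Pt d)) (Ωs : Fin 2 → Set (Pt d)) :
    Prop where
  isOpen : ∀ k, IsOpen (Ωs k)
  nonempty : ∀ k, (Ωs k).Nonempty
  union_eq : Ωs 0 ∪ Ωs 1 ∪ Γ = Ω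
  disjoint_subdomains : Disjoint (Ωs 0) (Ωs 1)
  disjoint_interface : ∀ k, Disjoint (Ωs k) Γ
  levelSet : ∀ z ∈ closure Γ, ∃ r : ℝ, 0 < r ∧ ∃ φ : Pt d → ℝ,
    ContDiffOn ℝ ∞ φ (Metric.ball z r) ∧ fderiv ℝ φ z ≠ 0 ∧
    (∀ x ∈ Ω ∩ Metric.ball z r, (x ∈ Ωs 0 ↔ 0 < φ x) ∧ (x ∈ Ωs 1 ↔ φ x < 0)) ∧
    (z ∈ frontier Ω → ∃ e : Pt d, IsLipschitzGraphNear Ω z e L ∧ fderiv ℝ φ z e = 0)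

/-! ### Triangulations -/

/-- The closed simplex with vertex set `s`. -/
def cell {d : ℕ} (s : Finset (Pt d)) : Set (Pt d) := convexHull ℝ (s : Set (Pt d))

/-- `T` is (the set of vertex sets of) a conforming triangulation of the closure of `Ω` into
nondegenerate `d`-simplices. -/
structure IsTriangulation {d : ℕ} (Ω : Set (Pt d)) (T : Finset (Finset (Pt d))) : Prop where
  card_eq : ∀ s ∈ T, s.card = d + 1
  indep : ∀ s ∈ T, AffineIndependent ℝ ((↑) : s → Pt d)
  conforming : ∀ s ∈ T, ∀ t ∈ T,
    cell s ∩ cell t ⊆ convexHull ℝ ((s : Set (Pt d)) ∩ (t : Set (Pt d)))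
  cover : ⋃ s ∈ T, cell s = closure Ω

/-- Shape regularity: each simplex contains a ball of radius `ρ > 0` comparable to its
diameter. -/
def IsShapeRegular {d : ℕ} (σ : ℝ) (T : Finset (Finset (Pt d))) : Prop :=
  ∀ s ∈ T, ∃ (c : Pt d) (ρ : ℝ), 0 < ρ ∧ Metric.closedBall c ρ ⊆ cell s ∧
    Metric.diam (cell s) ≤ σ * ρ

/-- Quasi-uniformity with mesh size `h`: all diameters lie between `h / τ` and `h`. -/
def IsQuasiUniform {d : ℕ} (τ h : ℝ) (T : Finset (Finset (Pt d))) : Prop :=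
  ∀ s ∈ T, Metric.diam (cell s) ≤ h ∧ h ≤ τ * Metric.diam (cell s)

open Classical in
/-- The simplices of `T` which meet the closed `δ`-neighbourhood of the (nonempty) set `A`. -/
noncomputable def activeCells {d : ℕ} (T : Finset (Finset (Pt d))) (A : Set (Pt d)) (δ : ℝ) :
    Finset (Finset (Pt d)) :=
  T.filter fun s => ∃ x ∈ cell s, Metric.infDist x A ≤ δ

/-- The open domain covered by a family of simplices. -/
def meshDomain {d : ℕ} (S : Finset (Finset (Pt d))) : Set (Pt d) :=
  interior (⋃ s ∈ S, cell s)

/-! ### Piecewise affine nodal basis and the lumped-mass projection -/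

/-- `w` are barycentric coordinates of `x` in the simplex with vertex set `s`. -/
def IsBarycentric {d : ℕ} (s : Finset (Pt d)) (x : Pt d) (w : Pt d → ℝ) : Prop :=
  (∀ y ∈ s, 0 ≤ w y) ∧ ∑ y ∈ s, w y = 1 ∧ ∑ y ∈ s, w y • y = x

open Classical in
/-- The nodal basis function at the node `z`: the continuous, piecewise affine function on the
union of the simplices of `S` that is `1` at `z` and `0` at every other node. On a simplex it is
the barycentric coordinate belonging to `z` (and `0` if `z` is not a vertex of the simplex). By
`hat_eq` below the value does not depend on the simplex that is chosen. -/
noncomputable def hat {d : ℕ} (S : Finset (Finset (Pt d))) (z x : Pt d) : ℝ :=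
  if h : ∃ p : Finset (Pt d) × (Pt d → ℝ), p.1 ∈ S ∧ IsBarycentric p.1 x p.2 then
    (if z ∈ h.choose.1 then h.choose.2 z else 0)
  else 0

open Classical in
/-- All grid nodes (vertices) of a family of simplices. -/
noncomputable def gridNodes {d : ℕ} (S : Finset (Finset (Pt d))) : Finset (Pt d) :=
  S.biUnion id

/-- The part of the boundary of the mesh domain that lies on the boundary of `Ω`. -/
def outerBoundary {d : ℕ} (Ω : Set (Pt d)) (S : Finset (Finset (Pt d))) : Set (Pt d) :=
  frontier Ω ∩ frontier (meshDomain S)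

open Classical in
/-- The grid nodes that do not lie on the outer boundary. Their basis functions span the finite
element space with homogeneous boundary condition on the outer boundary. -/
noncomputable def freeNodes {d : ℕ} (Ω : Set (Pt d)) (S : Finset (Finset (Pt d))) :
    Finset (Pt d) :=
  (gridNodes S).filter fun z => z ∉ outerBoundary Ω S

/-- The lumped-mass projection onto the span of the nodal basis functions at the nodes in `N`. -/
noncomputable def lumpedProj {d : ℕ} (S : Finset (Finset (Pt d))) (N : Finset (Pt d))
    (v : Pt d → ℝ) (x : Pt d) : ℝ :=
  ∑ z ∈ N, ((∫ y in meshDomain S, v y * hat S z y) / (∫ y in meshDomain S, hat S z y)) * hat S z x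

/-! ### Sobolev space `H¹` -/

/-- `G` is the weak gradient of `v` on the open set `U`. -/
def HasWeakGradient {d : ℕ} (U : Set (Pt d)) (v : Pt d → ℝ) (G : Pt d → Pt d) : Prop :=
  ∀ ψ : Pt d → ℝ, ContDiff ℝ ∞ ψ → HasCompactSupport ψ → tsupport ψ ⊆ U →
    ∀ i : Fin d, ∫ x in U, v x * fderiv ℝ ψ x (EuclideanSpace.single i 1) =
      - ∫ x in U, G x i * ψ x

/-- `v ∈ H¹(U)` with weak gradient `G`. -/
structure MemH1 {d : ℕ} (U : Set (Pt d)) (v : Pt d → ℝ) (G : Pt d → Pt d) : Prop where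
  memLp : MemLp v 2 (volume.restrict U)
  memLp_grad : MemLp G 2 (volume.restrict U)
  weakGrad : HasWeakGradient U v G

/-- `v ∈ H¹(U)` (with weak gradient `G`) vanishes on the closed set `D ⊆ ∂U`: it belongs to the
closure in `H¹(U)` of the functions that vanish in a neighbourhood of `D`. -/
def VanishesOn {d : ℕ} (U D : Set (Pt d)) (v : Pt d → ℝ) (G : Pt d → Pt d) : Prop :=
  ∀ ε : ℝ, 0 < ε → ∃ (w : Pt d → ℝ) (F : Pt d → Pt d), MemH1 U w F ∧
    (∃ O : Set (Pt d), IsOpen O ∧ D ⊆ O ∧ ∀ x ∈ O ∩ U, w x = 0) ∧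
    eLpNorm (fun x => v x - w x) 2 (volume.restrict U) ≤ ENNReal.ofReal ε ∧
    eLpNorm (fun x => G x - F x) 2 (volume.restrict U) ≤ ENNReal.ofReal ε

/-- The `L²(U)` norm, for scalar or vector valued functions. -/
noncomputable def normL2 {d : ℕ} {F : Type} [NormedAddCommGroup F] (U : Set (Pt d))
    (f : Pt d → F) : ℝ≥0∞ :=
  eLpNorm f 2 (volume.restrict U)

/-- `H¹`-stability and first order approximation of an operator `P` at a function `v ∈ H¹(U)`
with weak gradient `G`, with constant `C`: `P v ∈ H¹(U)`, `‖∇ P v‖ ≤ C ‖∇ v‖` and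
`‖v - P v‖ ≤ C h ‖∇ v‖` in `L²(U)`. -/
def StableAndApproximating {d : ℕ} (C h : ℝ) (U : Set (Pt d))
    (P : (Pt d → ℝ) → Pt d → ℝ) (v : Pt d → ℝ) (G : Pt d → Pt d) : Prop :=
  (∃ G' : Pt d → Pt d, MemH1 U (P v) G' ∧ normL2 U G' ≤ ENNReal.ofReal C * normL2 U G) ∧
  normL2 U (fun x => v x - P v x) ≤ ENNReal.ofReal (C * h) * normL2 U G

/-! ### The nodal basis is well defined -/

theorem isBarycentric_unique {d : ℕ} {s : Finset (Pt d)}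
    (hs : AffineIndependent ℝ ((↑) : s → Pt d)) {x : Pt d} {w w' : Pt d → ℝ}
    (h : IsBarycentric s x w) (h' : IsBarycentric s x w') : ∀ y ∈ s, w y = w' y := by
  have key := affineIndependent_iff.1 hs Finset.univ (fun y => w y - w' y)
    (by
      rw [Finset.sum_coe_sort s (fun y => w y - w' y), Finset.sum_sub_distrib, h.2.1, h'.2.1,
        sub_self])
    (by
      rw [Finset.sum_coe_sort s (fun y => (w y - w' y) • y)]
      simp only [sub_smul, Finset.sum_sub_distrib]
      rw [h.2.2, h'.2.2, sub_self])
  intro y hy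
  exact sub_eq_zero.1 (key ⟨y, hy⟩ (Finset.mem_univ _))

open Classical in
theorem isBarycentric_extend {d : ℕ} {s r : Finset (Pt d)} (hr : r ⊆ s) {x : Pt d}
    {w : Pt d → ℝ} (h : IsBarycentric r x w) :
    IsBarycentric s x (fun y => if y ∈ r then w y else 0) := by
  refine ⟨fun y _ => ?_, ?_, ?_⟩
  · by_cases hy : y ∈ r
    · simpa [hy] using h.1 y hy
    · simp [hy]
  · rw [← h.2.1, ← Finset.sum_subset hr]
    · exact Finset.sum_congr rfl fun y hy => by simp [hy]
    · intro y _ hy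
      simp [hy]
  · rw [← h.2.2, ← Finset.sum_subset hr]
    · exact Finset.sum_congr rfl fun y hy => by simp [hy]
    · intro y _ hy
      simp [hy]

open Classical in
/-- On each simplex of a conforming triangulation, the nodal basis function at `z` is the
barycentric coordinate that belongs to `z`. -/
theorem hat_eq {d : ℕ} {Ω : Set (Pt d)} {T S : Finset (Finset (Pt d))}
    (hT : IsTriangulation Ω T) (hS : S ⊆ T) {s : Finset (Pt d)} (hs : s ∈ S) {x : Pt d}
    {w : Pt d → ℝ} (hw : IsBarycentric s x w) (z : Pt d) :
    hat S z x = if z ∈ s then w z else 0 := by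
  have hex : ∃ p : Finset (Pt d) × (Pt d → ℝ), p.1 ∈ S ∧ IsBarycentric p.1 x p.2 :=
    ⟨(s, w), hs, hw⟩
  obtain ⟨ht, hw'⟩ := hex.choose_spec
  rw [hat, dif_pos hex]
  set t := hex.choose.1
  set w' := hex.choose.2
  have mem : ∀ {r : Finset (Pt d)} {u : Pt d → ℝ}, IsBarycentric r x u → x ∈ cell r := by
    intro r u hu
    exact Finset.mem_convexHull'.2 ⟨u, hu.1, hu.2.1, hu.2.2⟩
  have hx := hT.conforming s (hS hs) t (hS ht) ⟨mem hw, mem hw'⟩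
  rw [← Finset.coe_inter] at hx
  obtain ⟨u, hu⟩ := Finset.mem_convexHull'.1 hx
  have e1 := isBarycentric_unique (hT.indep s (hS hs)) hw
    (isBarycentric_extend Finset.inter_subset_left hu)
  have e2 := isBarycentric_unique (hT.indep t (hS ht)) hw'
    (isBarycentric_extend Finset.inter_subset_right hu)
  by_cases h1 : z ∈ s <;> by_cases h2 : z ∈ t <;> simp only [h1, h2, if_true, if_false]
  · rw [e1 z h1, e2 z h2]
  · rw [e1 z h1]; simp [h2]
  · rw [e2 z h2]; simp [h1]

/-! Both projections are sums `∑ c z * hat S z`, and everything rests on one local estimate: for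
each simplex `s` and each vertex `z` of `s`, the integral of `|v - c z|²` over `s` is at most `A h²`
times the integral of `|∇v|²` over the part of the mesh domain in the ball of radius `ρ h` about
`z`, where `A` and `ρ` depend only on the admissible parameters. The hat functions form a partition
of unity and the gradients of the barycentric coordinates of a simplex sum to zero, so this estimate
controls the error and, after division by `h`, the gradient; the balls overlap boundedly
(`interpolant_estimates`). The `L²` bound needs no geometry: it is Jensen's inequality, with
constant one (`lintegral_lumpedProj_le`).

The mesh domain has a ragged boundary, and a Poincaré inequality on its patches could have a bad
constant. The inequality is therefore used only on convex sets, as a bound for the double integral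
of `|v x - v y|²`, and such double integrals are chained. Two simplices with a common facet are
compared through a ball about the barycentre of the facet. A path without repetitions inside a ball
of radius `ρ h` has boundedly many simplices, by volume. Hence only a qualitative fact is needed:
the active simplices at a node are joined through facets by active simplices in such a ball
(`NodeConnected`).

Connectedness comes from cones. At a uniform scale, either `Ω` and the subdomain are invariant under
translations in a cone of directions whose opening depends only on `L`, or the ball does not see the
interface. The `δ`-neighbourhood of the subdomain inherits the invariance. A truncated cone is
convex, a generic segment in it passes between simplices only through facets, and cones with nearby
vertices intersect. If the interface is not seen, the cones may be arbitrarily thin, depending on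
`Ω`; but then the node lies in the closure of the subdomain, so arbitrarily short cones suffice and
the patch radius is not affected. All other features of the geometry go into `h₀`.

For homogeneous boundary values the coefficient at an outer boundary node is zero. A generic ray
that leaves `Ω` before it leaves the subdomain ends on a boundary facet of an active simplex. A
function that vanishes near this facet extends by zero across it, which gives Friedrichs' inequality
on half a ball, and a chain of simplices carries the bound to the node. -/

/-! ### The Poincaré inequality on convex sets in double integral form. -/

/-- Jensen's inequality for squares with a weight, in Lebesgue integral form. -/
theorem lintegral_mul_sq_le {α : Type*} [MeasurableSpace α] (μ : Measure α) {w g : α → ℝ≥0∞}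
    (hw : AEMeasurable w μ) (hg : AEMeasurable g μ) :
    (∫⁻ x, w x * g x ∂μ) ^ 2 ≤ (∫⁻ x, w x ∂μ) * ∫⁻ x, w x * g x ^ 2 ∂μ := by
  have h := ENNReal.lintegral_mul_le_Lp_mul_Lq μ Real.HolderConjugate.two_two
    (hw.pow_const (1 / 2 : ℝ)) ((hw.pow_const (1 / 2 : ℝ)).mul hg)
  have e1 : ∀ a : ℝ≥0∞, (a ^ (1 / 2 : ℝ)) ^ (2 : ℝ) = a := fun a => by
    rw [← ENNReal.rpow_mul]; norm_num
  have e2 : ∀ a : ℝ≥0∞, a ^ (1 / 2 : ℝ) * a ^ (1 / 2 : ℝ) = a := fun a => by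
    rw [← ENNReal.rpow_add_of_nonneg _ _ (by norm_num) (by norm_num)]; norm_num
  simp only [Pi.mul_apply, ENNReal.mul_rpow_of_nonneg _ _ (zero_le_two : (0 : ℝ) ≤ 2), e1,
    ← mul_assoc, e2] at h
  calc _ ≤ _ := pow_le_pow_left' h 2
    _ = _ := by
      rw [mul_pow, ← ENNReal.rpow_natCast, ← ENNReal.rpow_natCast, ← ENNReal.rpow_mul,
        ← ENNReal.rpow_mul]
      norm_num

theorem lintegral_comp_homothety {d : ℕ} {g : Pt d → ℝ≥0∞} (hg : Measurable g) (a : Pt d) {t : ℝ}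
    (ht : 0 < t) : ∫⁻ y, g (a + t • y) = ENNReal.ofReal ((t ^ d)⁻¹) * ∫⁻ y, g y := by
  have h1 : ∫⁻ y, g (a + t • y) = ∫⁻ z, g (a + z) ∂(Measure.map (t • ·) volume) := by
    rw [lintegral_map (by fun_prop) (by fun_prop)]
  rw [h1, Measure.map_addHaar_smul _ ht.ne', lintegral_smul_measure, lintegral_add_left_eq_self,
    finrank_euclideanSpace_fin, abs_of_pos (by positivity), smul_eq_mul]

/-- For fixed `x` the map `y ↦ x + t • (y - x)` is a homothety that maps `V` into itself by
convexity, and its Jacobian contributes `t⁻ᵈ ≤ 2ᵈ`. -/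
theorem lintegral_segment_le_of_half_le {d : ℕ} {V : Set (Pt d)} (hV : Convex ℝ V)
    (hVm : MeasurableSet V) {g : Pt d → ℝ≥0∞} (hg : Measurable g) {t : ℝ} (ht : 1 / 2 ≤ t)
    (ht1 : t ≤ 1) {x : Pt d} (hx : x ∈ V) :
    ∫⁻ y in V, g (x + t • (y - x)) ≤ 2 ^ d * ∫⁻ y in V, g y := by
  have e : ∀ y, x + t • (y - x) = (1 - t) • x + t • y := fun y => by module
  have ht0 : 0 < t := by linarith
  calc ∫⁻ y in V, g (x + t • (y - x))
      ≤ ∫⁻ y in V, V.indicator g ((1 - t) • x + t • y) := by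
        refine setLIntegral_mono' hVm fun y hy => ?_
        rw [e, indicator_of_mem (hV hx hy (by linarith) ht0.le (by ring))]
    _ ≤ ∫⁻ y, V.indicator g ((1 - t) • x + t • y) := setLIntegral_le_lintegral _ _
    _ = ENNReal.ofReal ((t ^ d)⁻¹) * ∫⁻ y in V, g y := by
        rw [lintegral_comp_homothety (hg.indicator hVm) _ ht0, lintegral_indicator hVm]
    _ ≤ 2 ^ d * ∫⁻ y in V, g y := by
        gcongr
        rw [← inv_pow, ENNReal.ofReal_pow (by positivity)]
        gcongr
        rw [← ENNReal.ofReal_ofNat]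
        apply ENNReal.ofReal_le_ofReal
        rw [inv_le_comm₀ ht0 two_pos]; linarith

/-- For `t` below one half the roles of `x` and `y` are exchanged, which replaces `t` by `1 - t`;
the factor `t⁻ᵈ` thus never degenerates. -/
theorem lintegral_lintegral_segment_le {d : ℕ} {V : Set (Pt d)} (hV : Convex ℝ V)
    (hVm : MeasurableSet V) {g : Pt d → ℝ≥0∞} (hg : Measurable g) {t : ℝ} (ht : 0 ≤ t)
    (ht1 : t ≤ 1) :
    ∫⁻ x in V, ∫⁻ y in V, g (x + t • (y - x)) ≤ 2 ^ d * volume V * ∫⁻ y in V, g y := by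
  have key : ∀ s : ℝ, 1 / 2 ≤ s → s ≤ 1 →
      ∫⁻ x in V, ∫⁻ y in V, g (x + s • (y - x)) ≤ 2 ^ d * volume V * ∫⁻ y in V, g y := by
    intro s hs hs1
    calc _ ≤ ∫⁻ x in V, 2 ^ d * ∫⁻ y in V, g y :=
          setLIntegral_mono' hVm fun x hx => lintegral_segment_le_of_half_le hV hVm hg hs hs1 hx
      _ = _ := by rw [setLIntegral_const]; ring
  rcases le_total (1 / 2) t with h | h
  · exact key t h ht1
  · rw [lintegral_lintegral_swap (by fun_prop)]
    convert key (1 - t) (by linarith) (by linarith) using 6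
    module

theorem enorm_sub_sq_le_lintegral_segment {d : ℕ} {f : Pt d → ℝ} (hf : ContDiff ℝ 1 f)
    (x y : Pt d) :
    ‖f x - f y‖ₑ ^ 2 ≤
      ‖y - x‖ₑ ^ 2 * ∫⁻ t in Icc (0 : ℝ) 1, ‖fderiv ℝ f (x + t • (y - x))‖ₑ ^ 2 := by
  have hc : Continuous (fderiv ℝ f) := hf.continuous_fderiv (by norm_num)
  have hd : ∀ t : ℝ, HasDerivAt (fun t : ℝ => f (x + t • (y - x)))
      (fderiv ℝ f (x + t • (y - x)) (y - x)) t := fun t => by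
    have h1 : HasDerivAt (fun t : ℝ => x + t • (y - x)) (y - x) t := by
      simpa using ((hasDerivAt_id t).smul_const (y - x)).const_add x
    exact ((hf.differentiable (by norm_num)) _).hasFDerivAt.comp_hasDerivAt t h1
  have hF := intervalIntegral.integral_eq_sub_of_hasDerivAt (a := 0) (b := 1)
    (fun t _ => hd t) (Continuous.intervalIntegrable (by fun_prop) _ _)
  simp only [one_smul, zero_smul, add_zero, add_sub_cancel] at hF
  have h1 : ‖f x - f y‖ₑ ≤
      ∫⁻ t in Icc (0 : ℝ) 1, 1 * (‖fderiv ℝ f (x + t • (y - x))‖ₑ * ‖y - x‖ₑ) := by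
    rw [← enorm_neg, neg_sub, ← hF, intervalIntegral.integral_of_le zero_le_one,
      ← integral_Icc_eq_integral_Ioc]
    refine (enorm_integral_le_lintegral_enorm _).trans (lintegral_mono fun t => ?_)
    rw [one_mul]
    exact ContinuousLinearMap.le_opENorm _ _
  calc _ ≤ _ := pow_le_pow_left' h1 2
    _ ≤ _ := lintegral_mul_sq_le _ (by fun_prop) (by fun_prop)
    _ = _ := by
      simp only [one_mul, mul_pow, lintegral_const, MeasurableSet.univ, Measure.restrict_apply,
        univ_inter, Real.volume_Icc, sub_zero, ENNReal.ofReal_one]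
      rw [lintegral_mul_const _ (by fun_prop), mul_comm]

/-- The increment is an integral of the derivative along the segment; after Cauchy–Schwarz and
Fubini each fixed parameter `t` costs `2ᵈ |V|`. The double integral form involves no mean value, so
that it can later be chained from set to set. -/
theorem poincare_of_contDiff {d : ℕ} {V : Set (Pt d)} (hV : Convex ℝ V) (hVm : MeasurableSet V)
    {D : ℝ≥0∞} (hD : ∀ x ∈ V, ∀ y ∈ V, edist x y ≤ D) {f : Pt d → ℝ} (hf : ContDiff ℝ 1 f) :
    ∫⁻ x in V, ∫⁻ y in V, ‖f x - f y‖ₑ ^ 2 ≤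
      2 ^ d * D ^ 2 * volume V * ∫⁻ x in V, ‖fderiv ℝ f x‖ₑ ^ 2 := by
  have hc : Continuous (fderiv ℝ f) := hf.continuous_fderiv (by norm_num)
  have hg : Measurable fun x => ‖fderiv ℝ f x‖ₑ ^ 2 := by fun_prop
  calc ∫⁻ x in V, ∫⁻ y in V, ‖f x - f y‖ₑ ^ 2
      ≤ ∫⁻ x in V, ∫⁻ y in V, D ^ 2 *
          ∫⁻ t in Icc (0 : ℝ) 1, ‖fderiv ℝ f (x + t • (y - x))‖ₑ ^ 2 := by
        refine setLIntegral_mono' hVm fun x hx => setLIntegral_mono' hVm fun y hy => ?_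
        refine (enorm_sub_sq_le_lintegral_segment hf x y).trans ?_
        gcongr
        rw [← edist_eq_enorm_sub]
        exact hD y hy x hx
    _ = D ^ 2 * ∫⁻ t in Icc (0 : ℝ) 1, ∫⁻ x in V, ∫⁻ y in V,
          ‖fderiv ℝ f (x + t • (y - x))‖ₑ ^ 2 := by
        have m3 : Measurable fun p : (Pt d × Pt d) × ℝ =>
            ‖fderiv ℝ f (p.1.1 + p.2 • (p.1.2 - p.1.1))‖ₑ ^ 2 := by fun_prop
        have m1 : ∀ x : Pt d, Measurable fun y : Pt d =>
            ∫⁻ t in Icc (0 : ℝ) 1, ‖fderiv ℝ f (x + t • (y - x))‖ₑ ^ 2 := fun x =>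
          Measurable.lintegral_prod_right' (f := fun p : Pt d × ℝ =>
            ‖fderiv ℝ f (x + p.2 • (p.1 - x))‖ₑ ^ 2) (by fun_prop)
        have m2 : Measurable fun x : Pt d => ∫⁻ y in V,
            ∫⁻ t in Icc (0 : ℝ) 1, ‖fderiv ℝ f (x + t • (y - x))‖ₑ ^ 2 :=
          Measurable.lintegral_prod_right' (f := fun p : Pt d × Pt d =>
            ∫⁻ t in Icc (0 : ℝ) 1, ‖fderiv ℝ f (p.1 + t • (p.2 - p.1))‖ₑ ^ 2)
            m3.lintegral_prod_right'
        simp_rw [fun x => lintegral_const_mul (μ := volume.restrict V) (D ^ 2) (m1 x)]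
        rw [lintegral_const_mul _ m2]
        congr 1
        have s1 : ∀ x : Pt d, ∫⁻ y in V, ∫⁻ t in Icc (0 : ℝ) 1,
            ‖fderiv ℝ f (x + t • (y - x))‖ₑ ^ 2 = ∫⁻ t in Icc (0 : ℝ) 1, ∫⁻ y in V,
            ‖fderiv ℝ f (x + t • (y - x))‖ₑ ^ 2 := fun x =>
          lintegral_lintegral_swap (by fun_prop)
        simp_rw [s1]
        refine lintegral_lintegral_swap (Measurable.aemeasurable ?_)
        exact Measurable.lintegral_prod_right' (f := fun p : (Pt d × ℝ) × Pt d =>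
            ‖fderiv ℝ f (p.1.1 + p.1.2 • (p.2 - p.1.1))‖ₑ ^ 2) (by fun_prop)
    _ ≤ D ^ 2 * ∫⁻ t in Icc (0 : ℝ) 1, 2 ^ d * volume V * ∫⁻ x in V, ‖fderiv ℝ f x‖ₑ ^ 2 := by
        refine mul_le_mul' le_rfl ?_
        exact setLIntegral_mono' measurableSet_Icc fun t ht =>
          lintegral_lintegral_segment_le hV hVm hg ht.1 ht.2
    _ = _ := by
        rw [setLIntegral_const, Real.volume_Icc]
        simp only [sub_zero, ENNReal.ofReal_one, mul_one]
        ring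

theorem HasWeakGradient.mono {d : ℕ} {U V : Set (Pt d)} {v : Pt d → ℝ} {G : Pt d → Pt d}
    (h : HasWeakGradient U v G) (hVU : V ⊆ U) : HasWeakGradient V v G := by
  intro ψ h1 h2 h3 i
  have e : ∀ g : Pt d → ℝ, (∀ x ∉ V, g x = 0) → ∫ x in V, g x = ∫ x in U, g x := by
    intro g hg
    rw [setIntegral_eq_integral_of_forall_compl_eq_zero hg,
      setIntegral_eq_integral_of_forall_compl_eq_zero fun x hx => hg x fun h => hx (hVU h)]
  have hz : ∀ x ∉ V, ψ x = 0 := fun x hx => image_eq_zero_of_notMem_tsupport fun h => hx (h3 h)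
  have hz' : ∀ x ∉ V, fderiv ℝ ψ x = 0 := fun x hx =>
    image_eq_zero_of_notMem_tsupport fun h => hx (h3 (tsupport_fderiv_subset ℝ h))
  rw [e _ fun x hx => by simp [hz' x hx], e _ fun x hx => by simp [hz x hx]]
  exact h ψ h1 h2 (h3.trans hVU) i

theorem MemH1.mono {d : ℕ} {U V : Set (Pt d)} {v : Pt d → ℝ} {G : Pt d → Pt d}
    (h : MemH1 U v G) (hVU : V ⊆ U) : MemH1 V v G :=
  ⟨h.memLp.mono_measure (Measure.restrict_mono hVU le_rfl),
    h.memLp_grad.mono_measure (Measure.restrict_mono hVU le_rfl), h.weakGrad.mono hVU⟩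

theorem memLp_two_of_continuous_compact {d : ℕ} {F : Type*} [NormedAddCommGroup F] {U : Set (Pt d)}
    {ψ : Pt d → F} (h1 : Continuous ψ) (h2 : HasCompactSupport ψ) :
    MemLp ψ 2 (volume.restrict U) := by
  have : MemLp ψ 2 (volume : Measure (Pt d)) := h1.memLp_of_hasCompactSupport h2
  exact this.mono_measure Measure.restrict_le_self

/-- Arbitrary directions `u` instead of coordinate directions are what the operator norm of a
derivative requires. -/
theorem MemH1.integral_mul_fderiv {d : ℕ} {U : Set (Pt d)} {v : Pt d → ℝ} {G : Pt d → Pt d}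
    (h : MemH1 U v G) {ψ : Pt d → ℝ} (h1 : ContDiff ℝ ∞ ψ) (h2 : HasCompactSupport ψ)
    (h3 : tsupport ψ ⊆ U) (u : Pt d) :
    ∫ x in U, v x * fderiv ℝ ψ x u = - ∫ x in U, (inner ℝ u (G x) : ℝ) * ψ x := by
  have hu : ∑ i, u i • EuclideanSpace.single i (1 : ℝ) = u := by
    simpa using (EuclideanSpace.basisFun (Fin d) ℝ).sum_repr u
  have e1 : ∀ x, v x * fderiv ℝ ψ x u =
      ∑ i, u i * (v x * fderiv ℝ ψ x (EuclideanSpace.single i 1)) := fun x => by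
    conv_lhs => rw [← hu]
    rw [map_sum, Finset.mul_sum]
    refine Finset.sum_congr rfl fun i _ => ?_
    rw [map_smul, smul_eq_mul]; ring
  have e2 : ∀ x, (inner ℝ u (G x) : ℝ) * ψ x = ∑ i, u i * (G x i * ψ x) := fun x => by
    rw [PiLp.inner_apply, Finset.sum_mul]
    refine Finset.sum_congr rfl fun i _ => ?_
    simp; ring
  have i1 : ∀ i, Integrable (fun x => v x * fderiv ℝ ψ x (EuclideanSpace.single i 1))
      (volume.restrict U) := fun i => by
    refine h.memLp.integrable_mul (memLp_two_of_continuous_compact ?_ ?_)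
    · exact (h1.continuous_fderiv (by simp)).clm_apply continuous_const
    · exact (h2.fderiv_apply (𝕜 := ℝ) _)
  have i2 : ∀ i, Integrable (fun x => G x i * ψ x) (volume.restrict U) := fun i => by
    have hG : MemLp (fun x => G x i) 2 (volume.restrict U) :=
      h.memLp_grad.of_le (by
        have := h.memLp_grad.aestronglyMeasurable
        exact (EuclideanSpace.proj (𝕜 := ℝ) i).continuous.comp_aestronglyMeasurable this)
        (ae_of_all _ fun x => PiLp.norm_apply_le (G x) i)
    exact hG.integrable_mul (memLp_two_of_continuous_compact h1.continuous h2)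
  simp_rw [e1, e2]
  rw [integral_finsetSum _ fun i _ => (i1 i).const_mul _,
    integral_finsetSum _ fun i _ => (i2 i).const_mul _, ← Finset.sum_neg_distrib]
  refine Finset.sum_congr rfl fun i _ => ?_
  rw [integral_const_mul, integral_const_mul, h.weakGrad ψ h1 h2 h3 i, mul_neg]

/-- The derivative of a mollification of an `H¹` function, at distance from the boundary. -/
theorem enorm_fderiv_convolution_le {d : ℕ} {V : Set (Pt d)} (hVm : MeasurableSet V)
    {v : Pt d → ℝ} {G : Pt d → Pt d} (h : MemH1 V v G) (φ : ContDiffBump (0 : Pt d)) {x : Pt d}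
    (hx : Metric.closedBall x φ.rOut ⊆ V) :
    ‖fderiv ℝ (convolution (φ.normed volume) (V.indicator v)
      (ContinuousLinearMap.lsmul ℝ ℝ) volume) x‖ₑ ^ 2 ≤
      ∫⁻ y in V, ‖φ.normed volume (x - y)‖ₑ * ‖G y‖ₑ ^ 2 := by
  set w := φ.normed (volume : Measure (Pt d)) with hw
  have hwc : ContDiff ℝ ∞ w := φ.contDiff_normed
  have hws : HasCompactSupport w := φ.hasCompactSupport_normed
  have hli : LocallyIntegrable (V.indicator v) volume :=
    ((memLp_indicator_iff_restrict hVm).2 h.memLp).locallyIntegrable (by norm_num)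
  have hflip : convolution w (V.indicator v) (ContinuousLinearMap.lsmul ℝ ℝ) volume =
      convolution (V.indicator v) w (ContinuousLinearMap.lsmul ℝ ℝ).flip volume :=
    (convolution_flip _).symm
  have hder := hws.hasFDerivAt_convolution_right (ContinuousLinearMap.lsmul ℝ ℝ).flip hli
    (hwc.of_le (by simp)) x
  have hwcd : Continuous (fderiv ℝ w) := hwc.continuous_fderiv (by simp)
  -- The derivative falls on the kernel. As the closed ball about `x` lies in `V`, the function `y ↦
  -- w (x - y)` is an admissible test function, and the weak gradient takes the derivative back.
  have key : ∀ u, fderiv ℝ (convolution w (V.indicator v)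
      (ContinuousLinearMap.lsmul ℝ ℝ) volume) x u =
      ∫ y in V, (inner ℝ u (G y) : ℝ) * w (x - y) := by
    intro u
    rw [hflip, hder.fderiv, convolution_precompR_apply _ hli (hws.fderiv ℝ) hwcd, convolution_def]
    have hψ : ∀ y, fderiv ℝ (fun y => w (x - y)) y u = - fderiv ℝ w (x - y) u := fun y => by
      have h1 : HasFDerivAt (fun y : Pt d => x - y) (-ContinuousLinearMap.id ℝ (Pt d)) y :=
        (hasFDerivAt_id y).const_sub x
      have h2 := ((hwc.differentiable (by simp)) (x - y)).hasFDerivAt.comp y h1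
      have h3 : HasFDerivAt (fun y => w (x - y)) _ y := h2
      rw [h3.fderiv]; simp
    have hsupp : tsupport (fun y => w (x - y)) ⊆ Metric.closedBall x φ.rOut := by
      refine closure_minimal (fun y hy => ?_) Metric.isClosed_closedBall
      have : x - y ∈ Function.support w := hy
      rw [hw, φ.support_normed_eq, mem_ball_zero_iff] at this
      rw [Metric.mem_closedBall, dist_comm, dist_eq_norm]; exact this.le
    have hint := h.integral_mul_fderiv (ψ := fun y => w (x - y)) (hwc.comp (by fun_prop))
      (HasCompactSupport.of_support_subset_isCompact (isCompact_closedBall x φ.rOut)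
        (subset_closure.trans hsupp)) (hsupp.trans hx) u
    simp only [hψ, mul_neg, integral_neg, neg_inj] at hint
    rw [← hint, ← integral_indicator hVm]
    refine integral_congr_ae (ae_of_all _ fun y => ?_)
    by_cases hy : y ∈ V <;> simp [hy, mul_comm]
  have hGm : AEMeasurable (fun y => ‖G y‖ₑ) (volume.restrict V) :=
    h.memLp_grad.aestronglyMeasurable.enorm
  have h1 : ‖fderiv ℝ (convolution w (V.indicator v)
      (ContinuousLinearMap.lsmul ℝ ℝ) volume) x‖ₑ ≤ ∫⁻ y in V, ‖w (x - y)‖ₑ * ‖G y‖ₑ := by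
    refine ContinuousLinearMap.opENorm_le_bound _ fun u => ?_
    rw [key u, ← lintegral_mul_const'' _ (by fun_prop)]
    refine (enorm_integral_le_lintegral_enorm _).trans (lintegral_mono fun y => ?_)
    rw [enorm_mul, mul_comm, mul_assoc]
    refine mul_le_mul' le_rfl ?_
    rw [mul_comm]
    rw [enorm_eq_nnnorm, enorm_eq_nnnorm, enorm_eq_nnnorm, ← ENNReal.coe_mul]
    exact ENNReal.coe_le_coe.2 (nnnorm_inner_le_nnnorm u (G y))
  have hwm : Measurable fun y => ‖w (x - y)‖ₑ :=
    (hwc.continuous.comp (continuous_sub_left x)).measurable.enorm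
  calc _ ≤ _ := pow_le_pow_left' h1 2
    _ ≤ _ := lintegral_mul_sq_le _ hwm.aemeasurable hGm
    _ ≤ 1 * ∫⁻ y in V, ‖w (x - y)‖ₑ * ‖G y‖ₑ ^ 2 := by
      gcongr
      refine (setLIntegral_le_lintegral _ _).trans ?_
      rw [lintegral_sub_left_eq_self (fun y => ‖w y‖ₑ) x]
      have : ∫⁻ y, ‖w y‖ₑ = ENNReal.ofReal (∫ y, w y) := by
        rw [ofReal_integral_eq_lintegral_ofReal φ.integrable_normed
          (ae_of_all _ fun y => φ.nonneg_normed y)]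
        exact lintegral_congr fun y => Real.enorm_of_nonneg (φ.nonneg_normed y)
      rw [this, φ.integral_normed, ENNReal.ofReal_one]
    _ = _ := one_mul _

theorem lintegral_enorm_normed_sub {d : ℕ} (φ : ContDiffBump (0 : Pt d)) (y : Pt d) :
    ∫⁻ x, ‖φ.normed volume (x - y)‖ₑ = 1 := by
  rw [lintegral_sub_right_eq_self (fun y => ‖φ.normed volume y‖ₑ) y]
  have : ∫⁻ y, ‖φ.normed volume y‖ₑ = ENNReal.ofReal (∫ y, φ.normed volume y) := by
    rw [ofReal_integral_eq_lintegral_ofReal φ.integrable_normed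
      (ae_of_all _ fun y => φ.nonneg_normed y)]
    exact lintegral_congr fun y => Real.enorm_of_nonneg (φ.nonneg_normed y)
  rw [this, φ.integral_normed, ENNReal.ofReal_one]

open Filter Topology in
/-- The Poincaré inequality on convex open sets, in double integral form. -/
theorem MemH1.poincare {d : ℕ} {V : Set (Pt d)} (hV : Convex ℝ V) (hVo : IsOpen V)
    {D : ℝ≥0∞} (hD : ∀ x ∈ V, ∀ y ∈ V, edist x y ≤ D)
    {v : Pt d → ℝ} {G : Pt d → Pt d} (h : MemH1 V v G) :
    ∫⁻ x in V, ∫⁻ y in V, ‖v x - v y‖ₑ ^ 2 ≤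
      2 ^ d * D ^ 2 * volume V * ∫⁻ x in V, ‖G x‖ₑ ^ 2 := by
  have hVm := hVo.measurableSet
  -- The two radii keep the fixed ratio two, as almost everywhere convergence of the mollifications
  -- requires.
  let φ : ℕ → ContDiffBump (0 : Pt d) := fun n =>
    ⟨1 / (2 * ((n : ℝ) + 1)), 1 / ((n : ℝ) + 1), by positivity, by
      apply one_div_lt_one_div_of_lt <;> linarith [(n.cast_nonneg : (0 : ℝ) ≤ n)]⟩
  have hφ : Tendsto (fun n => (φ n).rOut) atTop (𝓝 0) := tendsto_one_div_add_atTop_nhds_zero_nat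
  let f : ℕ → Pt d → ℝ := fun n => convolution ((φ n).normed volume) (V.indicator v)
    (ContinuousLinearMap.lsmul ℝ ℝ) volume
  have hli : LocallyIntegrable (V.indicator v) volume :=
    ((memLp_indicator_iff_restrict hVm).2 h.memLp).locallyIntegrable (by norm_num)
  have hf : ∀ n, ContDiff ℝ 1 (f n) := fun n => by
    have : ContDiff ℝ ((1 : ℕ∞) : WithTop ℕ∞) (f n) :=
      (φ n).hasCompactSupport_normed.contDiff_convolution_left _ (φ n).contDiff_normed hli
    simpa using this
  have hconv : ∀ᵐ x : Pt d, Tendsto (fun n => f n x) atTop (𝓝 (V.indicator v x)) := by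
    refine ContDiffBump.ae_convolution_tendsto_right_of_locallyIntegrable (K := 2) hφ
      (Eventually.of_forall fun n => ?_) hli
    change 1 / ((n : ℝ) + 1) ≤ 2 * (1 / (2 * ((n : ℝ) + 1)))
    apply le_of_eq; field_simp
  -- The inner parallel sets are convex, exhaust `V`, and keep the mollification away from the
  -- boundary.
  let W : ℕ → Set (Pt d) := fun n => interior {x | Metric.closedBall x (φ n).rOut ⊆ V}
  have hWV : ∀ n, W n ⊆ V := fun n x hx =>
    (interior_subset hx) (Metric.mem_closedBall_self (φ n).rOut_pos.le)
  have hWconv : ∀ n, Convex ℝ (W n) := by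
    refine fun n => Convex.interior ?_
    intro x hx y hy a b ha hb hab z hz
    have hz' : z - (a • x + b • y) ∈ Metric.closedBall (0 : Pt d) (φ n).rOut := by
      rw [mem_closedBall_zero_iff, ← dist_eq_norm]; exact hz
    have e : z = a • (x + (z - (a • x + b • y))) + b • (y + (z - (a • x + b • y))) := by
      rw [smul_add, smul_add, add_add_add_comm, ← add_smul, hab]; module
    rw [e]
    rw [mem_closedBall_zero_iff] at hz'
    exact hV (hx (by simpa using hz')) (hy (by simpa using hz')) ha hb hab
  have hWev : ∀ x ∈ V, ∀ᶠ n in atTop, x ∈ W n := by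
    intro x hx
    obtain ⟨r, hr, hrV⟩ := Metric.isOpen_iff.1 hVo x hx
    filter_upwards [hφ.eventually_lt_const (half_pos hr)] with n hn
    refine mem_interior.2 ⟨Metric.ball x (r / 2), fun y hy z hz => hrV ?_, Metric.isOpen_ball,
      Metric.mem_ball_self (half_pos hr)⟩
    rw [Metric.mem_ball] at hy ⊢
    rw [Metric.mem_closedBall] at hz
    linarith [dist_triangle z y x]
  have hGm : AEMeasurable (fun y => ‖G y‖ₑ) (volume.restrict V) :=
    h.memLp_grad.aestronglyMeasurable.enorm
  have hbound : ∀ n, ∫⁻ x in W n, ∫⁻ y in W n, ‖f n x - f n y‖ₑ ^ 2 ≤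
      2 ^ d * D ^ 2 * volume V * ∫⁻ x in V, ‖G x‖ₑ ^ 2 := by
    intro n
    refine (poincare_of_contDiff (hWconv n) isOpen_interior.measurableSet
      (fun x hx y hy => hD x (hWV n hx) y (hWV n hy)) (hf n)).trans ?_
    refine mul_le_mul' (mul_le_mul' le_rfl (measure_mono (hWV n))) ?_
    have hc : Continuous ((φ n).normed (volume : Measure (Pt d))) := (φ n).continuous_normed
    calc ∫⁻ x in W n, ‖fderiv ℝ (f n) x‖ₑ ^ 2
        ≤ ∫⁻ x in W n, ∫⁻ y in V, ‖(φ n).normed volume (x - y)‖ₑ * ‖G y‖ₑ ^ 2 :=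
          setLIntegral_mono' isOpen_interior.measurableSet fun x hx =>
            enorm_fderiv_convolution_le hVm h (φ n) (interior_subset hx)
      _ ≤ ∫⁻ x, ∫⁻ y in V, ‖(φ n).normed volume (x - y)‖ₑ * ‖G y‖ₑ ^ 2 :=
          setLIntegral_le_lintegral _ _
      _ = ∫⁻ y in V, ∫⁻ x, ‖(φ n).normed volume (x - y)‖ₑ * ‖G y‖ₑ ^ 2 := by
          refine lintegral_lintegral_swap ?_
          have m1 : AEMeasurable (fun p : Pt d × Pt d => ‖G p.2‖ₑ)
              (volume.prod (volume.restrict V)) :=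
            hGm.comp_quasiMeasurePreserving Measure.quasiMeasurePreserving_snd
          have m2 : Measurable (fun p : Pt d × Pt d => ‖(φ n).normed volume (p.1 - p.2)‖ₑ) :=
            (hc.comp (continuous_fst.sub continuous_snd)).measurable.enorm
          exact m2.aemeasurable.mul (m1.pow_const 2)
      _ = ∫⁻ y in V, ‖G y‖ₑ ^ 2 := by
          refine lintegral_congr fun y => ?_
          have hcm : Measurable fun x => ‖(φ n).normed volume (x - y)‖ₑ :=
            (hc.comp (continuous_sub_right y)).measurable.enorm
          rw [lintegral_mul_const _ hcm, lintegral_enorm_normed_sub, one_mul]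
  set μ := (volume : Measure (Pt d)).restrict V with hμ
  -- The indicator moves the integrals over the growing sets to the fixed product measure, where
  -- Fatou's lemma applies.
  let F : ℕ → Pt d × Pt d → ℝ≥0∞ := fun n =>
    (W n ×ˢ W n).indicator fun p => ‖f n p.1 - f n p.2‖ₑ ^ 2
  have hWm : ∀ n, MeasurableSet (W n ×ˢ W n) := fun n =>
    isOpen_interior.measurableSet.prod isOpen_interior.measurableSet
  have hm0 : ∀ n, Measurable fun p : Pt d × Pt d => ‖f n p.1 - f n p.2‖ₑ ^ 2 := fun n => by
    have := (hf n).continuous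
    fun_prop
  have hFm : ∀ n, Measurable (F n) := fun n => (hm0 n).indicator (hWm n)
  have hFint : ∀ n, ∫⁻ p, F n p ∂(μ.prod μ) ≤
      2 ^ d * D ^ 2 * volume V * ∫⁻ x in V, ‖G x‖ₑ ^ 2 := by
    intro n
    refine le_trans (le_of_eq ?_) (hbound n)
    rw [lintegral_indicator (hWm n), ← Measure.prod_restrict, lintegral_prod _ (hm0 n).aemeasurable,
      hμ, Measure.restrict_restrict isOpen_interior.measurableSet,
      inter_eq_self_of_subset_left (hWV n)]
  have hvm : AEStronglyMeasurable (fun p : Pt d × Pt d => v p.1 - v p.2) (μ.prod μ) := by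
    have h0 := h.memLp.aestronglyMeasurable
    exact (h0.comp_quasiMeasurePreserving Measure.quasiMeasurePreserving_fst).sub
      (h0.comp_quasiMeasurePreserving Measure.quasiMeasurePreserving_snd)
  have hconvV : ∀ᵐ x ∂μ, x ∈ V ∧ Tendsto (fun n => f n x) atTop (𝓝 (v x)) := by
    filter_upwards [ae_restrict_of_ae hconv, ae_restrict_mem hVm] with x h1 h2
    rw [indicator_of_mem h2] at h1
    exact ⟨h2, h1⟩
  have hlim : ∀ᵐ p ∂(μ.prod μ), Tendsto (fun n => F n p) atTop (𝓝 (‖v p.1 - v p.2‖ₑ ^ 2)) := by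
    filter_upwards [Measure.quasiMeasurePreserving_fst.ae hconvV,
      Measure.quasiMeasurePreserving_snd.ae hconvV] with p h1 h2
    have h3 : Tendsto (fun n => ‖f n p.1 - f n p.2‖ₑ ^ 2) atTop (𝓝 (‖v p.1 - v p.2‖ₑ ^ 2)) :=
      ((ENNReal.continuous_pow 2).tendsto _).comp ((continuous_enorm.tendsto _).comp
        (h1.2.sub h2.2))
    refine h3.congr' ?_
    filter_upwards [hWev _ h1.1, hWev _ h2.1] with n g1 g2
    simp only [F]
    rw [indicator_of_mem (show p ∈ W n ×ˢ W n from ⟨g1, g2⟩)]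
  calc ∫⁻ x in V, ∫⁻ y in V, ‖v x - v y‖ₑ ^ 2
      = ∫⁻ p, ‖v p.1 - v p.2‖ₑ ^ 2 ∂(μ.prod μ) :=
        (lintegral_prod _ (hvm.enorm.pow_const 2)).symm
    _ = ∫⁻ p, liminf (fun n => F n p) atTop ∂(μ.prod μ) :=
        lintegral_congr_ae (hlim.mono fun p hp => hp.liminf_eq.symm)
    _ ≤ liminf (fun n => ∫⁻ p, F n p ∂(μ.prod μ)) atTop := lintegral_liminf_le hFm
    _ ≤ _ := by
        refine (liminf_le_liminf (Eventually.of_forall hFint)).trans ?_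
        simp [hμ]

/-! ### Simplices and barycentric coordinates. -/

/-- `s` is the vertex set of a nondegenerate `d`-simplex. -/
structure IsSimplex {d : ℕ} (s : Finset (Pt d)) : Prop where
  card_eq : s.card = d + 1
  indep : AffineIndependent ℝ ((↑) : s → Pt d)

theorem IsTriangulation.isSimplex {d : ℕ} {Ω : Set (Pt d)} {T : Finset (Finset (Pt d))}
    (hT : IsTriangulation Ω T) {s : Finset (Pt d)} (hs : s ∈ T) : IsSimplex s :=
  ⟨hT.card_eq s hs, hT.indep s hs⟩

theorem IsBarycentric.mem_cell {d : ℕ} {s : Finset (Pt d)} {x : Pt d} {w : Pt d → ℝ}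
    (h : IsBarycentric s x w) : x ∈ cell s :=
  Finset.mem_convexHull'.2 ⟨w, h.1, h.2.1, h.2.2⟩

theorem convex_cell {d : ℕ} (s : Finset (Pt d)) : Convex ℝ (cell s) := convex_convexHull _ _

theorem isCompact_cell {d : ℕ} (s : Finset (Pt d)) : IsCompact (cell s) :=
  s.finite_toSet.isCompact_convexHull ℝ

theorem isClosed_cell {d : ℕ} (s : Finset (Pt d)) : IsClosed (cell s) := (isCompact_cell s).isClosed

theorem measurableSet_cell {d : ℕ} (s : Finset (Pt d)) : MeasurableSet (cell s) :=
  (isClosed_cell s).measurableSet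

theorem mem_cell_of_mem {d : ℕ} {s : Finset (Pt d)} {x : Pt d} (hx : x ∈ s) : x ∈ cell s :=
  subset_convexHull ℝ _ hx

theorem isClosed_biUnion_cell {d : ℕ} (S : Finset (Finset (Pt d))) : IsClosed (⋃ s ∈ S, cell s) :=
  S.finite_toSet.isClosed_biUnion fun s _ => isClosed_cell s

namespace IsSimplex

variable {d : ℕ} {s : Finset (Pt d)}

/-- The vertices of a simplex as an affine basis. -/
noncomputable def basis (hs : IsSimplex s) : AffineBasis s ℝ (Pt d) :=
  ⟨(↑), hs.indep, by
    rw [hs.indep.affineSpan_eq_top_iff_card_eq_finrank_add_one]; simp [hs.card_eq]⟩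

open Classical in
/-- The barycentric coordinate belonging to the vertex `y`; zero if `y` is not a vertex. -/
noncomputable def coord (hs : IsSimplex s) (y : Pt d) : Pt d →ᵃ[ℝ] ℝ :=
  if h : y ∈ s then hs.basis.coord ⟨y, h⟩ else 0

/-- The gradient of a barycentric coordinate. -/
noncomputable def grad (hs : IsSimplex s) (y : Pt d) : Pt d :=
  (InnerProductSpace.toDual ℝ (Pt d)).symm (LinearMap.toContinuousLinearMap (hs.coord y).linear)

theorem coord_of_mem (hs : IsSimplex s) {y : Pt d} (hy : y ∈ s) :
    hs.coord y = hs.basis.coord ⟨y, hy⟩ := dif_pos hy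

theorem coord_of_notMem (hs : IsSimplex s) {y : Pt d} (hy : y ∉ s) : hs.coord y = 0 := dif_neg hy

theorem coord_sub (hs : IsSimplex s) (y x x' : Pt d) :
    hs.coord y x - hs.coord y x' = inner ℝ (hs.grad y) (x - x') := by
  rw [grad, InnerProductSpace.toDual_symm_apply]
  simpa using ((hs.coord y).linearMap_vsub x x').symm

theorem coord_add (hs : IsSimplex s) (y x u : Pt d) :
    hs.coord y (x + u) = hs.coord y x + inner ℝ (hs.grad y) u := by
  have := hs.coord_sub y (x + u) x
  rw [add_sub_cancel_left] at this
  linarith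

theorem continuous_coord (hs : IsSimplex s) (y : Pt d) : Continuous (hs.coord y) :=
  (hs.coord y).continuous_of_finiteDimensional

theorem sum_coord (hs : IsSimplex s) (x : Pt d) : ∑ y ∈ s, hs.coord y x = 1 := by
  rw [← hs.basis.sum_coord_apply_eq_one x, ← Finset.sum_coe_sort]
  exact Finset.sum_congr rfl fun y _ => by rw [hs.coord_of_mem y.2]

theorem sum_coord_smul (hs : IsSimplex s) (x : Pt d) : ∑ y ∈ s, hs.coord y x • y = x := by
  conv_rhs => rw [← hs.basis.linear_combination_coord_eq_self x]
  rw [← Finset.sum_coe_sort]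
  exact Finset.sum_congr rfl fun y _ => by rw [hs.coord_of_mem y.2]; rfl

open Classical in
theorem coord_vertex (hs : IsSimplex s) {y y' : Pt d} (hy : y ∈ s) (hy' : y' ∈ s) :
    hs.coord y y' = if y = y' then 1 else 0 := by
  have : hs.basis.coord ⟨y, hy⟩ y' = _ := hs.basis.coord_apply ⟨y, hy⟩ ⟨y', hy'⟩
  rw [hs.coord_of_mem hy]
  simpa using this

theorem range_basis (hs : IsSimplex s) : range hs.basis = (s : Set (Pt d)) :=
  Subtype.range_coe

theorem mem_cell_iff (hs : IsSimplex s) {x : Pt d} : x ∈ cell s ↔ ∀ y ∈ s, 0 ≤ hs.coord y x := by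
  rw [cell, ← hs.range_basis, hs.basis.convexHull_eq_nonneg_coord, mem_ofPred_eq]
  refine ⟨fun h y hy => hs.coord_of_mem hy ▸ h ⟨y, hy⟩, fun h y => ?_⟩
  have := h y y.2
  rwa [hs.coord_of_mem y.2] at this

theorem mem_interior_cell_iff (hs : IsSimplex s) {x : Pt d} :
    x ∈ interior (cell s) ↔ ∀ y ∈ s, 0 < hs.coord y x := by
  rw [cell, ← hs.range_basis, hs.basis.interior_convexHull, mem_ofPred_eq]
  refine ⟨fun h y hy => hs.coord_of_mem hy ▸ h ⟨y, hy⟩, fun h y => ?_⟩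
  have := h y y.2
  rwa [hs.coord_of_mem y.2] at this

theorem isBarycentric (hs : IsSimplex s) {x : Pt d} (hx : x ∈ cell s) :
    IsBarycentric s x fun y => hs.coord y x :=
  ⟨hs.mem_cell_iff.1 hx, hs.sum_coord x, hs.sum_coord_smul x⟩

theorem coord_nonneg (hs : IsSimplex s) {x : Pt d} (hx : x ∈ cell s) (y : Pt d) :
    0 ≤ hs.coord y x := by
  by_cases hy : y ∈ s
  · exact hs.mem_cell_iff.1 hx y hy
  · simp [hs.coord_of_notMem hy]

theorem coord_le_one (hs : IsSimplex s) {x : Pt d} (hx : x ∈ cell s) (y : Pt d) :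
    hs.coord y x ≤ 1 := by
  by_cases hy : y ∈ s
  · rw [← hs.sum_coord x]
    exact Finset.single_le_sum (f := fun y => hs.coord y x) (fun y _ => hs.coord_nonneg hx y) hy
  · simp [hs.coord_of_notMem hy]

/-- A step of length `ρ` from the centre in the direction of the gradient stays in the simplex and
changes the coordinate by `ρ` times the norm of the gradient; coordinates range in `[0, 1]`. -/
theorem norm_grad_le (hs : IsSimplex s) {c : Pt d} {ρ : ℝ} (hρ : 0 < ρ)
    (hc : Metric.closedBall c ρ ⊆ cell s) (y : Pt d) : ‖hs.grad y‖ ≤ 1 / ρ := by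
  set g := hs.grad y
  rcases eq_or_ne g 0 with h | h
  · rw [h, norm_zero]; positivity
  have hg : 0 < ‖g‖ := norm_pos_iff.2 h
  have hx : c + (ρ / ‖g‖) • g ∈ Metric.closedBall c ρ := by
    rw [mem_closedBall_iff_norm, add_sub_cancel_left, norm_smul, norm_div, norm_norm,
      Real.norm_of_nonneg hρ.le, div_mul_cancel₀ _ hg.ne']
  have h1 := hs.coord_le_one (hc hx) y
  have h2 := hs.coord_nonneg (hc (Metric.mem_closedBall_self hρ.le)) y
  rw [hs.coord_add, inner_smul_right, real_inner_self_eq_norm_sq] at h1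
  have h3 : ρ / ‖g‖ * ‖g‖ ^ 2 = ρ * ‖g‖ := by field_simp
  rw [le_div_iff₀ hρ]
  linarith

theorem abs_coord_sub_le (hs : IsSimplex s) {c : Pt d} {ρ : ℝ} (hρ : 0 < ρ)
    (hc : Metric.closedBall c ρ ⊆ cell s) (y x x' : Pt d) :
    |hs.coord y x - hs.coord y x'| ≤ dist x x' / ρ := by
  rw [hs.coord_sub, dist_eq_norm]
  refine (abs_real_inner_le_norm _ _).trans ?_
  have := mul_le_mul_of_nonneg_right (hs.norm_grad_le hρ hc y) (norm_nonneg (x - x'))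
  linarith [one_div_mul_eq_div ρ ‖x - x'‖]

/-- A face of a simplex consists of the points where the other coordinates vanish. -/
theorem mem_face_iff (hs : IsSimplex s) {r : Finset (Pt d)} (hr : r ⊆ s) {x : Pt d} :
    x ∈ cell r ↔ x ∈ cell s ∧ ∀ y ∈ s, y ∉ r → hs.coord y x = 0 := by
  classical
  constructor
  · intro hx
    obtain ⟨w, hw⟩ := Finset.mem_convexHull'.1 hx
    have hb := isBarycentric_extend hr (x := x) (w := w) ⟨hw.1, hw.2.1, hw.2.2⟩
    refine ⟨hb.mem_cell, fun y hy hyr => ?_⟩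
    rw [isBarycentric_unique hs.indep (hs.isBarycentric hb.mem_cell) hb y hy, if_neg hyr]
  · rintro ⟨hx, h⟩
    refine Finset.mem_convexHull'.2 ⟨fun y => hs.coord y x, fun y _ => hs.coord_nonneg hx y, ?_, ?_⟩
    · rw [← hs.sum_coord x]
      exact Finset.sum_subset hr fun y hy hyr => h y hy hyr
    · conv_rhs => rw [← hs.sum_coord_smul x]
      exact Finset.sum_subset hr fun y hy hyr => by
        simp only [h y hy hyr, zero_smul]

theorem interior_nonempty (hs : IsSimplex s) : (interior (cell s)).Nonempty := by
  have h0 : (0 : ℝ) < s.card := by rw [hs.card_eq]; positivity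
  have hw := IsBarycentric.mem_cell (s := s) (x := ∑ y ∈ s, (s.card : ℝ)⁻¹ • y)
    (w := fun _ => (s.card : ℝ)⁻¹) ⟨fun _ _ => by positivity, by simp [h0.ne'], rfl⟩
  refine ⟨∑ y ∈ s, (s.card : ℝ)⁻¹ • y, hs.mem_interior_cell_iff.2 fun y hy => ?_⟩
  rw [isBarycentric_unique hs.indep (hs.isBarycentric hw) (w' := fun _ => (s.card : ℝ)⁻¹)
    ⟨fun _ _ => by positivity, by simp [h0.ne'], rfl⟩ y hy]
  positivity

theorem closure_interior (hs : IsSimplex s) : closure (interior (cell s)) = cell s := by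
  rw [(convex_cell s).closure_interior_eq_closure_of_nonempty_interior hs.interior_nonempty,
    (isClosed_cell s).closure_eq]

/-- The affine function `hs.coord` is determined by its values at the vertices. -/
theorem affine_apply (hs : IsSimplex s) (f : Pt d →ᵃ[ℝ] ℝ) (x : Pt d) :
    f x = ∑ y ∈ s, hs.coord y x * f y := by
  have h := Finset.map_affineCombination s id (fun y => hs.coord y x) (hs.sum_coord x) f
  rw [s.affineCombination_eq_linear_combination _ _ (hs.sum_coord x),
    s.affineCombination_eq_linear_combination _ _ (hs.sum_coord x)] at h
  simpa [hs.sum_coord_smul] using h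

end IsSimplex

theorem hat_eq_coord {d : ℕ} {Ω : Set (Pt d)} {T S : Finset (Finset (Pt d))}
    (hT : IsTriangulation Ω T) (hS : S ⊆ T) {s : Finset (Pt d)} (hs : s ∈ S) (h : IsSimplex s)
    {x : Pt d} (hx : x ∈ cell s) (z : Pt d) : hat S z x = h.coord z x := by
  rw [hat_eq hT hS hs (h.isBarycentric hx) z]
  split_ifs with hz
  · rfl
  · simp [h.coord_of_notMem hz]

theorem hat_eq_zero {d : ℕ} {S : Finset (Finset (Pt d))} {x : Pt d} (hx : x ∉ ⋃ s ∈ S, cell s)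
    (z : Pt d) : hat S z x = 0 := by
  rw [hat, dif_neg]
  rintro ⟨p, hp, hb⟩
  exact hx (mem_biUnion hp hb.mem_cell)

namespace IsSimplex

variable {d : ℕ} {s t : Finset (Pt d)}

/-- Barycentric coordinates in the common face, extended by zero, serve both simplices, and
barycentric coordinates are unique. -/
theorem coord_eq_coord (hs : IsSimplex s) (ht : IsSimplex t) {r : Finset (Pt d)} (hrs : r ⊆ s)
    (hrt : r ⊆ t) {x : Pt d} (hx : x ∈ cell r) {y : Pt d} (hy : y ∈ r) :
    hs.coord y x = ht.coord y x := by
  classical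
  obtain ⟨w, hw⟩ := Finset.mem_convexHull'.1 hx
  have hb : IsBarycentric r x w := ⟨hw.1, hw.2.1, hw.2.2⟩
  rw [isBarycentric_unique hs.indep (hs.isBarycentric (isBarycentric_extend hrs hb).mem_cell)
      (isBarycentric_extend hrs hb) y (hrs hy),
    isBarycentric_unique ht.indep (ht.isBarycentric (isBarycentric_extend hrt hb).mem_cell)
      (isBarycentric_extend hrt hb) y (hrt hy)]

open Classical in
theorem exists_eq_insert (hs : IsSimplex s) {r : Finset (Pt d)} (hr : r ⊆ s) (hrc : r.card = d) :
    ∃ o ∉ r, insert o r = s := by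
  have h1 : (s \ r).card = 1 := by
    rw [Finset.card_sdiff_of_subset hr, hs.card_eq, hrc]; omega
  obtain ⟨o, ho⟩ := Finset.card_eq_one.1 h1
  have ho' : o ∈ s \ r := ho ▸ Finset.mem_singleton_self o
  rw [Finset.mem_sdiff] at ho'
  refine ⟨o, ho'.2, ?_⟩
  rw [Finset.insert_eq, ← ho, Finset.sdiff_union_of_subset hr]

open Classical in
theorem mem_cell_of_insert (hs : IsSimplex s) {o : Pt d} {r : Finset (Pt d)} (hso : insert o r = s)
    {x : Pt d} (h0 : 0 ≤ hs.coord o x) (h : ∀ y ∈ r, 0 ≤ hs.coord y x) : x ∈ cell s := by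
  refine hs.mem_cell_iff.2 fun y hy => ?_
  have hy' : y ∈ insert o r := by rw [hso]; exact hy
  rcases Finset.mem_insert.1 hy' with rfl | hy'
  · exact h0
  · exact h y hy'

open Classical in
/-- Two simplices of a conforming pair that share a facet lie on opposite sides of it. -/
theorem exists_coord_eq_neg_mul (hs : IsSimplex s) (ht : IsSimplex t)
    (hc : cell s ∩ cell t ⊆ cell (s ∩ t)) {o o' : Pt d} (ho : o ∉ s ∩ t)
    (hso : insert o (s ∩ t) = s) (ho' : o' ∉ s ∩ t) (hto : insert o' (s ∩ t) = t)
    {p : Pt d} (hp : p ∈ cell (s ∩ t)) (hpos : ∀ y ∈ s ∩ t, 0 < hs.coord y p) :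
    ∃ c < 0, ∀ x, ht.coord o' x = c * hs.coord o x := by
  have hos : o ∈ s := hso ▸ Finset.mem_insert_self _ _
  have hot : o' ∈ t := hto ▸ Finset.mem_insert_self _ _
  have hF : ∀ {y}, y ∈ s ∩ t → y ∈ s ∧ y ∈ t := fun h => Finset.mem_inter.1 h
  -- Both sides are affine functions that vanish at the shared vertices, so that only the value at
  -- `o` matters.
  have hlin : ∀ x, ht.coord o' x = ht.coord o' o * hs.coord o x := by
    intro x
    rw [hs.affine_apply (ht.coord o') x, Finset.sum_eq_single_of_mem o hos, mul_comm]
    intro y hy hyo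
    have hy' : y ∈ insert o (s ∩ t) := by rw [hso]; exact hy
    replace hy := (Finset.mem_insert.1 hy').resolve_left hyo
    rw [ht.coord_vertex hot (hF hy).2, if_neg (fun h : o' = y => ho' (h ▸ hy)), mul_zero]
  refine ⟨ht.coord o' o, ?_, hlin⟩
  -- With a nonnegative factor, a short step from `p` towards `o` would stay in both simplices and
  -- yet leave their common face, against conformity.
  by_contra! hge
  have hpo : hs.coord o p = 0 := ((hs.mem_face_iff Finset.inter_subset_left).1 hp).2 o hos ho
  have hcont : ∀ (u : Finset (Pt d)) (hu : IsSimplex u) (y : Pt d), Continuous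
      fun ε : ℝ => hu.coord y (p + ε • (o - p)) := fun u hu y =>
    (hu.continuous_coord y).comp (by fun_prop)
  have hev : ∀ᶠ ε in nhdsWithin (0 : ℝ) (Ioi 0), (∀ y ∈ s ∩ t, 0 < hs.coord y (p + ε • (o - p))) ∧
      (∀ y ∈ s ∩ t, 0 < ht.coord y (p + ε • (o - p))) := by
    refine nhdsWithin_le_nhds ?_
    refine Filter.Eventually.and ?_ ?_ <;>
      refine (Filter.eventually_all_finset _).2 fun y hy => ?_
    · refine (hcont s hs y).tendsto 0 |>.eventually_const_lt ?_
      simpa using hpos y hy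
    · refine (hcont t ht y).tendsto 0 |>.eventually_const_lt ?_
      have := hpos y hy
      rw [hs.coord_eq_coord ht Finset.inter_subset_left Finset.inter_subset_right hp hy] at this
      simpa using this
  obtain ⟨ε, ⟨h1, h2⟩, hε⟩ := (hev.and self_mem_nhdsWithin).exists
  have hε : 0 < ε := hε
  have hx : hs.coord o (p + ε • (o - p)) = ε := by
    rw [hs.coord_add, inner_smul_right, ← hs.coord_sub, hs.coord_vertex hos hos, hpo]; simp
  have hxs : p + ε • (o - p) ∈ cell s :=
    hs.mem_cell_of_insert hso (by rw [hx]; exact hε.le) fun y hy => (h1 y hy).le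
  have hxt : p + ε • (o - p) ∈ cell t :=
    ht.mem_cell_of_insert hto (by rw [hlin, hx]; exact mul_nonneg hge hε.le)
      fun y hy => (h2 y hy).le
  have := ((hs.mem_face_iff Finset.inter_subset_left).1 (hc ⟨hxs, hxt⟩)).2 o hos ho
  rw [hx] at this
  exact hε.ne' this

/-- The barycentre of a nonempty facet. -/
theorem exists_face_centroid (hs : IsSimplex s) (hd : 0 < d) {r : Finset (Pt d)} (hr : r ⊆ s)
    (hrc : r.card = d) : ∃ b ∈ cell r, ∀ y ∈ r, hs.coord y b = 1 / d := by
  classical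
  have hd0 : (0 : ℝ) < d := by exact_mod_cast hd
  have hb : IsBarycentric r (∑ y ∈ r, (1 / d : ℝ) • y) fun _ => 1 / d :=
    ⟨fun _ _ => by positivity, by simp [hrc, hd0.ne'], rfl⟩
  refine ⟨_, hb.mem_cell, fun y hy => ?_⟩
  have hb' := isBarycentric_extend hr hb
  rw [isBarycentric_unique hs.indep (hs.isBarycentric hb'.mem_cell) hb' y (hr hy), if_pos hy]

end IsSimplex

/-! ### Shape regular and quasi-uniform triangulations -/

/-- A conforming triangulation into simplices of diameter at most `h` that contain balls of radius
`θ * h`. -/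
structure IsRegularMesh {d : ℕ} (Ω : Set (Pt d)) (T : Finset (Finset (Pt d))) (θ h : ℝ) :
    Prop where
  tri : IsTriangulation Ω T
  θ_pos : 0 < θ
  h_pos : 0 < h
  ball : ∀ s ∈ T, ∃ c, Metric.closedBall c (θ * h) ⊆ cell s
  dist_le : ∀ s ∈ T, ∀ x ∈ cell s, ∀ y ∈ cell s, dist x y ≤ h

/-- The measure of a ball of radius `h`. -/
noncomputable def ballVol (d : ℕ) (h : ℝ) : ℝ≥0∞ := volume (Metric.ball (0 : Pt d) h)

theorem ballVol_pos {d : ℕ} {h : ℝ} (hh : 0 < h) : 0 < ballVol d h := Metric.measure_ball_pos _ _ hh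

theorem ballVol_ne_top {d : ℕ} {h : ℝ} : ballVol d h ≠ ⊤ := measure_ball_lt_top.ne

theorem ballVol_mul {d : ℕ} {a h : ℝ} (ha : 0 < a) :
    ballVol d (a * h) = ENNReal.ofReal (a ^ d) * ballVol d h := by
  rw [ballVol, Measure.addHaar_ball_mul_of_pos _ _ ha, finrank_euclideanSpace_fin, ballVol]

theorem volume_ball_eq {d : ℕ} (x : Pt d) (h : ℝ) : volume (Metric.ball x h) = ballVol d h :=
  Measure.addHaar_ball_center _ _ _

theorem volume_closedBall_eq {d : ℕ} (x : Pt d) {h : ℝ} (hh : 0 < h) :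
    volume (Metric.closedBall x h) = ballVol d h := by
  rw [Measure.addHaar_closedBall _ _ hh.le, ballVol, Measure.addHaar_ball_of_pos _ _ hh]

/-- An affine function that vanishes at the centre is nonnegative on at least half of a ball. -/
theorem ballVol_le_two_mul {d : ℕ} (f : Pt d →ᵃ[ℝ] ℝ) {b : Pt d} (hb : f b = 0) (r : ℝ) :
    ballVol d r ≤ 2 * volume (Metric.ball b r ∩ {x | 0 ≤ f x}) := by
  have hm : MeasurableSet {x | 0 ≤ f x} :=
    measurableSet_le measurable_const f.continuous_of_finiteDimensional.measurable
  have hm' : MeasurableSet (Metric.ball b r ∩ {x | 0 ≤ f x}) := measurableSet_ball.inter hm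
  -- The point reflection at `b` interchanges the two half balls and preserves volume.
  have hpre : (fun x => (2 : ℝ) • b - x) ⁻¹' (Metric.ball b r ∩ {x | 0 ≤ f x}) =
      Metric.ball b r ∩ {x | f x ≤ 0} := by
    ext x
    have e1 : dist ((2 : ℝ) • b - x) b = dist x b := by
      rw [dist_eq_norm, dist_eq_norm, ← norm_neg]; congr 1; module
    have e2 : f ((2 : ℝ) • b - x) = - f x := by
      have h1 := f.linearMap_vsub b x
      have h2 := f.linearMap_vsub ((2 : ℝ) • b - x) b
      have h3 : (2 : ℝ) • b - x -ᵥ b = b -ᵥ x := by simp only [vsub_eq_sub]; module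
      rw [h3, h1] at h2
      simp only [vsub_eq_sub, hb] at h2
      linarith
    simp [Metric.mem_ball, e1, e2]
  have hvol : volume (Metric.ball b r ∩ {x | f x ≤ 0}) =
      volume (Metric.ball b r ∩ {x | 0 ≤ f x}) := by
    rw [← hpre]
    exact (Measure.measurePreserving_sub_left volume ((2 : ℝ) • b)).measure_preimage
      hm'.nullMeasurableSet
  have hcov : Metric.ball b r ⊆ (Metric.ball b r ∩ {x | f x ≤ 0}) ∪
      (Metric.ball b r ∩ {x | 0 ≤ f x}) := fun x hx => by
    rcases le_total (f x) 0 with h | h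
    · exact Or.inl ⟨hx, h⟩
    · exact Or.inr ⟨hx, h⟩
  rw [← volume_ball_eq b r, two_mul]
  refine (measure_mono hcov).trans ((measure_union_le _ _).trans ?_)
  rw [hvol]

namespace IsRegularMesh

variable {d : ℕ} {Ω : Set (Pt d)} {T : Finset (Finset (Pt d))} {θ h : ℝ}

theorem radius_pos (hM : IsRegularMesh Ω T θ h) : 0 < θ * h := mul_pos hM.θ_pos hM.h_pos

theorem volume_cell_le (hM : IsRegularMesh Ω T θ h) {s : Finset (Pt d)} (hs : s ∈ T) :
    volume (cell s) ≤ ballVol d h := by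
  obtain ⟨x, hx⟩ := (hM.tri.isSimplex hs).interior_nonempty
  rw [← volume_closedBall_eq x hM.h_pos]
  exact measure_mono fun y hy => hM.dist_le s hs y hy x (interior_subset hx)

theorem ballVol_le_volume_cell (hM : IsRegularMesh Ω T θ h) {s : Finset (Pt d)} (hs : s ∈ T) :
    ballVol d (θ * h) ≤ volume (cell s) := by
  obtain ⟨c, hc⟩ := hM.ball s hs
  rw [← volume_closedBall_eq c hM.radius_pos]
  exact measure_mono hc

open Classical in
/-- Near the barycentre of a common facet, two simplices cover a ball. -/
theorem exists_ball_of_face (hM : IsRegularMesh Ω T θ h) (hd : 0 < d) {s t : Finset (Pt d)}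
    (hs : s ∈ T) (ht : t ∈ T) (hc : (s ∩ t).card = d) :
    ∃ b ∈ cell s ∩ cell t, Metric.ball b (θ * h / d) ⊆ cell s ∪ cell t ∧
      ballVol d (θ * h / d) ≤ 2 * volume (Metric.ball b (θ * h / d) ∩ cell s) ∧
      ballVol d (θ * h / d) ≤ 2 * volume (Metric.ball b (θ * h / d) ∩ cell t) := by
  have hd0 : (0 : ℝ) < d := by exact_mod_cast hd
  have Hs := hM.tri.isSimplex hs
  have Ht := hM.tri.isSimplex ht
  obtain ⟨o, ho, hso⟩ := Hs.exists_eq_insert Finset.inter_subset_left hc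
  obtain ⟨o', ho', hto⟩ := Ht.exists_eq_insert Finset.inter_subset_right hc
  obtain ⟨b, hb, hbc⟩ := Hs.exists_face_centroid hd Finset.inter_subset_left hc
  have hconf : cell s ∩ cell t ⊆ cell (s ∩ t) := by
    simpa [cell] using hM.tri.conforming s hs t ht
  obtain ⟨c, hcneg, hlin⟩ := Hs.exists_coord_eq_neg_mul Ht hconf ho hso ho' hto hb
    fun y hy => by rw [hbc y hy]; positivity
  have hbc' : ∀ y ∈ s ∩ t, Ht.coord y b = 1 / d := fun y hy => by
    rw [← Hs.coord_eq_coord Ht Finset.inter_subset_left Finset.inter_subset_right hb hy, hbc y hy]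
  have hbs := ((Hs.mem_face_iff Finset.inter_subset_left).1 hb)
  have hbt := ((Ht.mem_face_iff Finset.inter_subset_right).1 hb)
  have hos : o ∈ s := hso ▸ Finset.mem_insert_self _ _
  have hot : o' ∈ t := hto ▸ Finset.mem_insert_self _ _
  -- The radius is chosen for this: gradients of coordinates are at most `1 / (θ * h)`, so within `θ
  -- * h / d` no coordinate drops by more than its value `1 / d` at the barycentre.
  have hnear : ∀ {u : Finset (Pt d)} (hu : u ∈ T) (Hu : IsSimplex u) {y}, Hu.coord y b = 1 / d →
      ∀ x ∈ Metric.ball b (θ * h / d), 0 ≤ Hu.coord y x := by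
    intro u hu Hu y hy x hx
    obtain ⟨c, hc⟩ := hM.ball u hu
    have h1 := Hu.abs_coord_sub_le hM.radius_pos hc y x b
    have h2 : dist x b / (θ * h) ≤ 1 / d := by
      rw [div_le_iff₀ hM.radius_pos]
      have := Metric.mem_ball.1 hx
      calc dist x b ≤ θ * h / d := this.le
        _ = _ := by ring
    have h3 := (abs_le.1 h1).1
    rw [hy] at h3
    linarith
  have hins : ∀ x ∈ Metric.ball b (θ * h / d), 0 ≤ Hs.coord o x → x ∈ cell s :=
    fun x hx h0 => Hs.mem_cell_of_insert hso h0 fun y hy => hnear hs Hs (hbc y hy) x hx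
  have hint : ∀ x ∈ Metric.ball b (θ * h / d), 0 ≤ Ht.coord o' x → x ∈ cell t :=
    fun x hx h0 => Ht.mem_cell_of_insert hto h0 fun y hy => hnear ht Ht (hbc' y hy) x hx
  refine ⟨b, ⟨hbs.1, hbt.1⟩, fun x hx => ?_, ?_, ?_⟩
  · rcases le_total 0 (Hs.coord o x) with h0 | h0
    · exact Or.inl (hins x hx h0)
    · exact Or.inr (hint x hx (by rw [hlin]; exact mul_nonneg_of_nonpos_of_nonpos hcneg.le h0))
  · refine (ballVol_le_two_mul (Hs.coord o) (hbs.2 o hos ho) _).trans ?_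
    refine mul_le_mul' le_rfl (measure_mono ?_)
    exact fun x hx => ⟨hx.1, hins x hx.1 hx.2⟩
  · refine (ballVol_le_two_mul (Ht.coord o') (hbt.2 o' hot ho') _).trans ?_
    refine mul_le_mul' le_rfl (measure_mono ?_)
    exact fun x hx => ⟨hx.1, hint x hx.1 hx.2⟩

end IsRegularMesh

/-! ### Double integral energies -/

/-- The double integral of the squared differences of `v` over `A × B`. -/
noncomputable def energy {d : ℕ} (v : Pt d → ℝ) (A B : Set (Pt d)) : ℝ≥0∞ :=
  ∫⁻ x in A, ∫⁻ y in B, ‖v x - v y‖ₑ ^ 2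

theorem energy_mono {d : ℕ} (v : Pt d → ℝ) {A A' B B' : Set (Pt d)} (hA : A ⊆ A') (hB : B ⊆ B') :
    energy v A B ≤ energy v A' B' :=
  (lintegral_mono_set hA).trans (lintegral_mono fun _ => lintegral_mono_set hB)

theorem enorm_sub_sq_le_two_mul (a b c : ℝ) :
    ‖a - b‖ₑ ^ 2 ≤ 2 * (‖a - c‖ₑ ^ 2 + ‖b - c‖ₑ ^ 2) := by
  have h : ‖a - b‖ₑ ≤ ‖a - c‖ₑ + ‖b - c‖ₑ := by
    have := enorm_sub_le (a := a - c) (b := b - c)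
    rwa [sub_sub_sub_cancel_right] at this
  have h3 := ENNReal.rpow_add_le_mul_rpow_add_rpow ‖a - c‖ₑ ‖b - c‖ₑ (p := 2) (by norm_num)
  norm_num at h3
  exact (pow_le_pow_left' h 2).trans h3

/-- The triangle inequality `|v x - v y|² ≤ 2 (|v x - v z|² + |v y - v z|²)`, integrated over all `z
∈ C`, which serves as a stepping stone between `A` and `B`. -/
theorem volume_mul_energy_le {d : ℕ} {v : Pt d → ℝ} {A B C : Set (Pt d)}
    (hC : AEMeasurable v (volume.restrict C)) (hB : volume B ≠ ⊤)
    (hC' : volume C ≠ ⊤) :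
    volume C * energy v A B ≤ 2 * (volume B * energy v A C + volume A * energy v B C) := by
  have m : ∀ a : ℝ, AEMeasurable (fun z => ‖a - v z‖ₑ ^ 2) (volume.restrict C) := fun a =>
    (hC.const_sub a).enorm.pow_const 2
  have h1 : ∀ x y, volume C * ‖v x - v y‖ₑ ^ 2 ≤
      2 * (∫⁻ z in C, ‖v x - v z‖ₑ ^ 2) + 2 * ∫⁻ z in C, ‖v y - v z‖ₑ ^ 2 := by
    intro x y
    calc volume C * ‖v x - v y‖ₑ ^ 2 = ∫⁻ z in C, ‖v x - v y‖ₑ ^ 2 := by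
          rw [setLIntegral_const, mul_comm]
      _ ≤ ∫⁻ z in C, 2 * (‖v x - v z‖ₑ ^ 2 + ‖v y - v z‖ₑ ^ 2) :=
          lintegral_mono fun z => enorm_sub_sq_le_two_mul _ _ _
      _ = _ := by
          rw [lintegral_const_mul' _ _ (by simp), lintegral_add_left' (m _), mul_add]
  have h2 : ∀ x, volume C * ∫⁻ y in B, ‖v x - v y‖ₑ ^ 2 ≤
      2 * volume B * (∫⁻ z in C, ‖v x - v z‖ₑ ^ 2) + 2 * energy v B C := by
    intro x
    rw [← lintegral_const_mul' _ _ hC']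
    refine (lintegral_mono fun y => h1 x y).trans ?_
    rw [lintegral_add_left measurable_const, setLIntegral_const,
      lintegral_const_mul' _ _ (by simp), energy]
    exact le_of_eq (by ring)
  rw [energy, ← lintegral_const_mul' _ _ hC']
  refine (lintegral_mono fun x => h2 x).trans ?_
  rw [lintegral_add_right _ measurable_const, setLIntegral_const,
    lintegral_const_mul' _ _ (ENNReal.mul_ne_top (by simp) hB), energy]
  exact le_of_eq (by unfold energy; ring)

/-- The form used in chains: all sets have volume at most `V`, the intermediate set is not much
smaller, and `V` cancels. -/
theorem energy_le_of_volume_le {d : ℕ} {v : Pt d → ℝ} {A B C : Set (Pt d)} {V Q : ℝ≥0∞}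
    (hC : AEMeasurable v (volume.restrict C)) (hV : V ≠ 0) (hV' : V ≠ ⊤) (hA : volume A ≤ V)
    (hB : volume B ≤ V) (hC' : volume C ≤ V) (hQ : V ≤ Q * volume C) :
    energy v A B ≤ 2 * Q * (energy v A C + energy v B C) := by
  have h := volume_mul_energy_le (A := A) hC (ne_top_of_le_ne_top hV' hB)
    (ne_top_of_le_ne_top hV' hC')
  refine (ENNReal.mul_le_mul_iff_right hV hV').1 ?_
  calc V * energy v A B ≤ Q * volume C * energy v A B := by gcongr
    _ = Q * (volume C * energy v A B) := by ring
    _ ≤ Q * (2 * (volume B * energy v A C + volume A * energy v B C)) := by gcongr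
    _ ≤ Q * (2 * (V * energy v A C + V * energy v B C)) := by gcongr
    _ = _ := by ring

theorem energy_congr {d : ℕ} (v : Pt d → ℝ) {A A' B B' : Set (Pt d)}
    (hA : A =ᵐ[volume] A') (hB : B =ᵐ[volume] B') : energy v A B = energy v A' B' := by
  rw [energy, Measure.restrict_congr_set hA, Measure.restrict_congr_set hB, energy]

/-! ### Chains of simplices -/

open Classical in
/-- Two simplices of a family are adjacent if they share a facet. -/
noncomputable def faceGraph {d : ℕ} (S : Finset (Finset (Pt d))) : SimpleGraph (Finset (Pt d)) where
  Adj s t := s ∈ S ∧ t ∈ S ∧ s ≠ t ∧ (s ∩ t).card = d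
  symm := ⟨fun s t h => ⟨h.2.1, h.1, h.2.2.1.symm, by rw [Finset.inter_comm]; exact h.2.2.2⟩⟩
  loopless := ⟨fun _ h => h.2.2.1 rfl⟩

/-- Constants for the comparison of a function on two simplices that are joined by a chain. -/
noncomputable def chainConst (Q : ℝ≥0∞) : ℕ → ℝ≥0∞
  | 0 => 1
  | n + 1 => 2 * Q * (chainConst Q n + 2 * Q * (4 * Q + 1))

theorem chainConst_ne_top {Q : ℝ≥0∞} (hQ : Q ≠ ⊤) (n : ℕ) : chainConst Q n ≠ ⊤ := by
  induction n with
  | zero => simp [chainConst]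
  | succ n ih => rw [chainConst]; finiteness

theorem interior_ae_eq_cell {d : ℕ} (s : Finset (Pt d)) :
    interior (cell s) =ᵐ[volume] cell s := by
  refine ae_eq_of_subset_of_measure_ge interior_subset ?_
    isOpen_interior.measurableSet.nullMeasurableSet (isCompact_cell s).measure_lt_top.ne
  have h := (convex_cell s).addHaar_frontier volume
  have h2 : cell s ⊆ interior (cell s) ∪ frontier (cell s) := by
    rw [← closure_eq_interior_union_frontier]; exact subset_closure
  exact (measure_mono h2).trans ((measure_union_le _ _).trans (by rw [h, add_zero]))

theorem interior_cell_subset_meshDomain {d : ℕ} {S : Finset (Finset (Pt d))} {s : Finset (Pt d)}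
    (hs : s ∈ S) : interior (cell s) ⊆ meshDomain S :=
  interior_mono (subset_biUnion_of_mem (u := fun s => cell s) hs)

theorem isOpen_meshDomain {d : ℕ} (S : Finset (Finset (Pt d))) : IsOpen (meshDomain S) :=
  isOpen_interior

namespace IsRegularMesh

variable {d : ℕ} {Ω : Set (Pt d)} {T S : Finset (Finset (Pt d))} {θ h : ℝ}

/-- The ratio of the measures of simplices and of the balls around barycentres of facets. -/
noncomputable def volRatio (d : ℕ) (θ : ℝ) : ℝ≥0∞ := 2 * ENNReal.ofReal ((d / θ) ^ d)

theorem volRatio_ne_top (d : ℕ) (θ : ℝ) : volRatio d θ ≠ ⊤ := by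
  unfold volRatio; finiteness

theorem ballVol_le_volRatio_mul (hM : IsRegularMesh Ω T θ h) (hd : 0 < d) {m : ℝ≥0∞}
    (hm : ballVol d (θ * h / d) ≤ 2 * m) : ballVol d h ≤ volRatio d θ * m := by
  have hd0 : (0 : ℝ) < d := by exact_mod_cast hd
  have e : h = d / θ * (θ * h / d) := by
    have := hM.θ_pos.ne'
    field_simp
  calc ballVol d h = ENNReal.ofReal ((d / θ) ^ d) * ballVol d (θ * h / d) := by
        conv_lhs => rw [e]
        exact ballVol_mul (div_pos hd0 hM.θ_pos)
    _ ≤ ENNReal.ofReal ((d / θ) ^ d) * (2 * m) := by gcongr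
    _ = _ := by unfold volRatio; ring

theorem ballVol_le_volRatio_mul_cell (hM : IsRegularMesh Ω T θ h) (hd : 0 < d) {s : Finset (Pt d)}
    (hs : s ∈ T) : ballVol d h ≤ volRatio d θ * volume (cell s) := by
  refine hM.ballVol_le_volRatio_mul hd ?_
  refine le_trans (measure_mono (Metric.ball_subset_ball ?_))
    ((hM.ballVol_le_volume_cell hs).trans (le_mul_of_one_le_left' one_le_two))
  exact div_le_self hM.radius_pos.le (by exact_mod_cast hd)

/-- Poincaré's inequality on the interior. The set `W` will be the ball of the patch, so that all
links of a chain are bounded by one and the same quantity; `2 * h` in place of `h` makes the bound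
valid also for the balls at facets. -/
theorem energy_cell_le (hM : IsRegularMesh Ω T θ h) {v : Pt d → ℝ}
    {G : Pt d → Pt d} (hv : MemH1 (meshDomain S) v G) (hST : S ⊆ T) {s : Finset (Pt d)}
    (hs : s ∈ S) {W : Set (Pt d)} (hW : cell s ⊆ W) :
    energy v (cell s) (cell s) ≤
      2 ^ d * ENNReal.ofReal (2 * h) ^ 2 * ballVol d h *
        ∫⁻ x in W ∩ meshDomain S, ‖G x‖ₑ ^ 2 := by
  rw [← energy_congr v (interior_ae_eq_cell s) (interior_ae_eq_cell s)]
  have h1 := (hv.mono (interior_cell_subset_meshDomain hs)).poincare (convex_cell s).interior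
    isOpen_interior (D := ENNReal.ofReal (2 * h)) fun x hx y hy => by
      rw [edist_dist]
      apply ENNReal.ofReal_le_ofReal
      linarith [hM.dist_le s (hST hs) x (interior_subset hx) y (interior_subset hy), hM.h_pos]
  refine h1.trans ?_
  gcongr
  · exact (measure_mono interior_subset).trans (hM.volume_cell_le (hST hs))
  · exact fun x hx => ⟨hW (interior_subset hx), interior_cell_subset_meshDomain hs hx⟩

theorem aemeasurable_restrict_cell {v : Pt d → ℝ} {G : Pt d → Pt d}
    (hv : MemH1 (meshDomain S) v G) {s : Finset (Pt d)} (hs : s ∈ S) :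
    AEMeasurable v (volume.restrict (cell s)) := by
  rw [← Measure.restrict_congr_set (interior_ae_eq_cell s)]
  exact (hv.mono (interior_cell_subset_meshDomain hs)).memLp.aestronglyMeasurable.aemeasurable

open Classical in
-- The union of two adjacent simplices need not be convex. The comparison therefore runs through a
-- ball about the barycentre of the common facet: from `s` to the half ball in `s`, across the ball
-- to the half ball in `t`, and on to `t`. Each half ball has a fixed share of the volume.
theorem energy_adjacent_le (hM : IsRegularMesh Ω T θ h) (hd : 0 < d) {v : Pt d → ℝ}
    {G : Pt d → Pt d} (hv : MemH1 (meshDomain S) v G) (hST : S ⊆ T) {s t : Finset (Pt d)}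
    (hs : s ∈ S) (ht : t ∈ S) (hc : (s ∩ t).card = d) {W : Set (Pt d)} (hsW : cell s ⊆ W)
    (htW : cell t ⊆ W) :
    energy v (cell s) (cell t) ≤ 2 * volRatio d θ * (4 * volRatio d θ + 1) *
      (2 ^ d * ENNReal.ofReal (2 * h) ^ 2 * ballVol d h *
        ∫⁻ x in W ∩ meshDomain S, ‖G x‖ₑ ^ 2) := by
  obtain ⟨b, hb, hB, h1, h2⟩ := hM.exists_ball_of_face hd (hST hs) (hST ht) hc
  set B := Metric.ball b (θ * h / d)
  set e := 2 ^ d * ENNReal.ofReal (2 * h) ^ 2 * ballVol d h *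
        ∫⁻ x in W ∩ meshDomain S, ‖G x‖ₑ ^ 2
  set Q := volRatio d θ
  have hBU : B ⊆ meshDomain S := interior_maximal (hB.trans (union_subset
    (subset_biUnion_of_mem (u := fun s => cell s) hs)
    (subset_biUnion_of_mem (u := fun s => cell s) ht))) Metric.isOpen_ball
  have hnear : ∀ x ∈ B, dist x b ≤ h := fun x hx => by
    rcases hB hx with h | h
    · exact hM.dist_le s (hST hs) x h b hb.1
    · exact hM.dist_le t (hST ht) x h b hb.2
  have hBV : volume B ≤ ballVol d h := by
    rw [← volume_closedBall_eq b hM.h_pos]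
    exact measure_mono hnear
  have hBe : energy v B B ≤ e := by
    refine ((hv.mono hBU).poincare (convex_ball _ _) Metric.isOpen_ball
      (D := ENNReal.ofReal (2 * h)) fun x hx y hy => ?_).trans ?_
    · rw [edist_dist]
      apply ENNReal.ofReal_le_ofReal
      linarith [dist_triangle_right x y b, hnear x hx, hnear y hy]
    · simp only [e]
      gcongr
      exact fun x hx => ⟨(hB.trans (union_subset hsW htW)) hx, hBU hx⟩
  have hss := hM.energy_cell_le hv hST hs hsW
  have htt := hM.energy_cell_le hv hST ht htW
  have hV0 := (ballVol_pos (d := d) hM.h_pos).ne'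
  have hsV := hM.volume_cell_le (hST hs)
  have htV := hM.volume_cell_le (hST ht)
  have hm1 : AEMeasurable v (volume.restrict (B ∩ cell s)) :=
    (aemeasurable_restrict_cell hv hs).mono_measure (Measure.restrict_mono inter_subset_right le_rfl)
  have hm2 : AEMeasurable v (volume.restrict (B ∩ cell t)) :=
    (aemeasurable_restrict_cell hv ht).mono_measure (Measure.restrict_mono inter_subset_right le_rfl)
  have hH1 : volume (B ∩ cell s) ≤ ballVol d h := (measure_mono inter_subset_left).trans hBV
  have hH2 : volume (B ∩ cell t) ≤ ballVol d h := (measure_mono inter_subset_left).trans hBV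
  have k1 : energy v (cell s) (B ∩ cell t) ≤ 4 * Q * e := by
    refine (energy_le_of_volume_le hm1 hV0 ballVol_ne_top hsV hH2 hH1
      (hM.ballVol_le_volRatio_mul hd h1)).trans ?_
    calc _ ≤ 2 * Q * (e + e) := by
          gcongr
          · exact (energy_mono v le_rfl inter_subset_right).trans hss
          · exact (energy_mono v inter_subset_left inter_subset_left).trans hBe
      _ = _ := by ring
  refine (energy_le_of_volume_le hm2 hV0 ballVol_ne_top hsV htV hH2
    (hM.ballVol_le_volRatio_mul hd h2)).trans ?_
  calc _ ≤ 2 * Q * (4 * Q * e + e) := by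
        gcongr
        exact (energy_mono v le_rfl inter_subset_right).trans htt
    _ = _ := by ring

/-- The end simplex is compared with the first simplex of the walk through the second one; this
recursion defines `chainConst`. -/
theorem energy_walk_le (hM : IsRegularMesh Ω T θ h) (hd : 0 < d) {v : Pt d → ℝ}
    {G : Pt d → Pt d} (hv : MemH1 (meshDomain S) v G) (hST : S ⊆ T)
    {R : Finset (Finset (Pt d))} (hRS : R ⊆ S) {W : Set (Pt d)} (hW : ∀ s ∈ R, cell s ⊆ W)
    {s t : Finset (Pt d)} (p : (faceGraph R).Walk s t) (ht : t ∈ R) :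
    energy v (cell t) (cell s) ≤ chainConst (volRatio d θ) p.length *
      (2 ^ d * ENNReal.ofReal (2 * h) ^ 2 * ballVol d h *
        ∫⁻ x in W ∩ meshDomain S, ‖G x‖ₑ ^ 2) := by
  induction p with
  | nil =>
    rw [SimpleGraph.Walk.length_nil, chainConst, one_mul]
    exact hM.energy_cell_le hv hST (hRS ht) (hW _ ht)
  | cons hadj p ih =>
    rename_i a b c
    rw [SimpleGraph.Walk.length_cons, chainConst]
    have hV0 := (ballVol_pos (d := d) hM.h_pos).ne'
    refine (energy_le_of_volume_le (aemeasurable_restrict_cell hv (hRS hadj.2.1)) hV0 ballVol_ne_top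
      (hM.volume_cell_le (hST (hRS ht))) (hM.volume_cell_le (hST (hRS hadj.1)))
      (hM.volume_cell_le (hST (hRS hadj.2.1)))
      (hM.ballVol_le_volRatio_mul_cell hd (hST (hRS hadj.2.1)))).trans ?_
    rw [mul_assoc (2 * volRatio d θ), add_mul (chainConst _ _)]
    gcongr
    · exact ih ht
    · exact hM.energy_adjacent_le hd hv hST (hRS hadj.1) (hRS hadj.2.1) hadj.2.2.2
        (hW _ hadj.1) (hW _ hadj.2.1)

theorem disjoint_interior (hM : IsRegularMesh Ω T θ h) {s t : Finset (Pt d)} (hs : s ∈ T)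
    (ht : t ∈ T) (hst : s ≠ t) : Disjoint (interior (cell s)) (interior (cell t)) := by
  classical
  rw [Set.disjoint_left]
  intro x hxs hxt
  have Hs := hM.tri.isSimplex hs
  have hx := hM.tri.conforming s hs t ht ⟨interior_subset hxs, interior_subset hxt⟩
  rw [← Finset.coe_inter] at hx
  have h1 := ((Hs.mem_face_iff Finset.inter_subset_left).1 hx).2
  have h2 : s ⊆ t := fun y hy => by
    by_contra hyt
    have := Hs.mem_interior_cell_iff.1 hxs y hy
    rw [h1 y hy fun h => hyt (Finset.mem_inter.1 h).2] at this
    exact lt_irrefl _ this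
  exact hst (Finset.eq_of_subset_of_card_le h2 (by rw [hM.tri.card_eq s hs, hM.tri.card_eq t ht]))

/-- Packing: the interiors are disjoint and each has at least the volume of a ball of radius `θ *
h`. -/
theorem card_le_of_subset_closedBall (hM : IsRegularMesh Ω T θ h)
    {R : Finset (Finset (Pt d))} (hR : R ⊆ T) {z : Pt d} {ρ : ℝ} (hρ : 0 < ρ)
    (hW : ∀ s ∈ R, cell s ⊆ Metric.closedBall z (ρ * h)) : (R.card : ℝ) ≤ (ρ / θ) ^ d := by
  have h1 : (R.card : ℝ≥0∞) * ballVol d (θ * h) ≤ ballVol d (ρ * h) := by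
    rw [← volume_closedBall_eq z (mul_pos hρ hM.h_pos)]
    calc (R.card : ℝ≥0∞) * ballVol d (θ * h) = ∑ s ∈ R, ballVol d (θ * h) := by simp
      _ ≤ ∑ s ∈ R, volume (interior (cell s)) := by
          refine Finset.sum_le_sum fun s hs => ?_
          rw [measure_congr (interior_ae_eq_cell s)]
          exact hM.ballVol_le_volume_cell (hR hs)
      _ = volume (⋃ s ∈ R, interior (cell s)) :=
          (measure_biUnion_finset (fun s hs t ht hst => hM.disjoint_interior (hR hs) (hR ht) hst)
            fun s _ => isOpen_interior.measurableSet).symm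
      _ ≤ _ := measure_mono (iUnion₂_subset fun s hs => interior_subset.trans (hW s hs))
  have e : ρ * h = ρ / θ * (θ * h) := by have := hM.θ_pos.ne'; field_simp
  rw [e, ballVol_mul (div_pos hρ hM.θ_pos),
    ENNReal.mul_le_mul_iff_left (ballVol_pos hM.radius_pos).ne' ballVol_ne_top] at h1
  rw [← ENNReal.ofReal_natCast] at h1
  exact (ENNReal.ofReal_le_ofReal_iff (pow_nonneg (div_pos hρ hM.θ_pos).le d)).1 h1

/-- The constant for the comparison of simplices in a ball of radius `ρ * h`. -/
noncomputable def patchConst (d : ℕ) (θ ρ : ℝ) : ℝ≥0∞ :=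
  (∑ n ∈ Finset.range (⌊(ρ / θ) ^ d⌋₊ + 1), chainConst (volRatio d θ) n) * (2 ^ d * 4)

theorem patchConst_ne_top (d : ℕ) (θ ρ : ℝ) : patchConst d θ ρ ≠ ⊤ := by
  refine ENNReal.mul_ne_top ?_ (by finiteness)
  exact ENNReal.sum_ne_top.2 fun n _ => chainConst_ne_top (volRatio_ne_top d θ) n

/-- A path without repetitions has no more simplices than fit into the ball, so the constant does
not depend on how the two simplices are joined. -/
theorem energy_reachable_le (hM : IsRegularMesh Ω T θ h) (hd : 0 < d) {v : Pt d → ℝ}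
    {G : Pt d → Pt d} (hv : MemH1 (meshDomain S) v G) (hST : S ⊆ T)
    {R : Finset (Finset (Pt d))} (hRS : R ⊆ S) {z : Pt d} {ρ : ℝ} (hρ : 0 < ρ)
    (hW : ∀ s ∈ R, cell s ⊆ Metric.closedBall z (ρ * h))
    {s t : Finset (Pt d)} (ht : t ∈ R) (hst : (faceGraph R).Reachable s t) :
    energy v (cell t) (cell s) ≤ patchConst d θ ρ * ENNReal.ofReal h ^ 2 * ballVol d h *
        ∫⁻ x in Metric.closedBall z (ρ * h) ∩ meshDomain S, ‖G x‖ₑ ^ 2 := by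
  classical
  obtain ⟨p, hp⟩ := hst.exists_isPath
  have hlen : p.length < ⌊(ρ / θ) ^ d⌋₊ + 1 := by
    have h1 : p.support.toFinset ⊆ R := by
      intro u hu
      rw [List.mem_toFinset] at hu
      -- The vertices of the graph are arbitrary finite sets. Those of the path before its end lie
      -- in `R` since they have a neighbour; the end does by hypothesis.
      by_cases hut : u = t
      · rw [hut]; exact ht
      · obtain ⟨w, hw⟩ : ∃ w, (faceGraph R).Adj u w := by
          let q := p.dropUntil u hu
          have hq : ¬ q.Nil := fun hn => hut hn.eq
          exact ⟨_, q.adj_snd hq⟩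
        exact hw.1
    have h2 := Finset.card_le_card h1
    rw [List.toFinset_card_of_nodup hp.support_nodup, SimpleGraph.Walk.length_support] at h2
    have h3 := Nat.le_floor (hM.card_le_of_subset_closedBall (hRS.trans hST) hρ hW)
    omega
  refine (hM.energy_walk_le hd hv hST hRS hW p ht).trans ?_
  have e : ENNReal.ofReal (2 * h) ^ 2 = 4 * ENNReal.ofReal h ^ 2 := by
    rw [ENNReal.ofReal_mul zero_le_two, mul_pow, ENNReal.ofReal_ofNat]; norm_num
  rw [e]
  calc _ ≤ (∑ n ∈ Finset.range (⌊(ρ / θ) ^ d⌋₊ + 1), chainConst (volRatio d θ) n) * _ := by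
        gcongr ?_ * _
        exact Finset.single_le_sum (f := fun n => chainConst (volRatio d θ) n)
          (fun _ _ => zero_le) (Finset.mem_range.2 hlen)
    _ = _ := by unfold patchConst; ring

end IsRegularMesh

/-! ### Piecewise affine functions -/

open Filter Topology in
/-- A segment that stays in a finite union of cells starts inside one of them. -/
theorem exists_cell_of_segment {d : ℕ} {S : Finset (Finset (Pt d))} {x w : Pt d}
    (h : ∃ᶠ t in 𝓝[>] (0 : ℝ), x + t • w ∈ ⋃ s ∈ S, cell s) :
    ∃ s ∈ S, ∃ t₁ > (0 : ℝ), ∀ t ∈ Icc 0 t₁, x + t • w ∈ cell s := by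
  have h' : ∃ᶠ t in 𝓝[>] (0 : ℝ), ∃ s ∈ S, x + t • w ∈ cell s :=
    h.mono fun t ht => by simpa using ht
  -- One of the finitely many cells is met for arbitrarily small `t`. It contains `x` since it is
  -- closed, and an initial segment since it is convex.
  obtain ⟨s, hs, hf⟩ := (frequently_exists_finset S).1 h'
  have hx : x ∈ cell s := by
    have ht : Tendsto (fun t : ℝ => x + t • w) (𝓝[>] 0) (𝓝 x) := by
      have : Continuous fun t : ℝ => x + t • w := by fun_prop
      simpa using (this.tendsto 0).mono_left nhdsWithin_le_nhds
    exact (isClosed_cell s).mem_of_frequently_of_tendsto hf ht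
  obtain ⟨t₁, ht₁, hpos⟩ := (hf.and_eventually self_mem_nhdsWithin).exists
  have hpos : 0 < t₁ := hpos
  refine ⟨s, hs, t₁, hpos, fun t ht => ?_⟩
  have e : x + t • w = x + (t / t₁) • (x + t₁ • w - x) := by
    rw [add_sub_cancel_left, smul_smul, div_mul_cancel₀ _ hpos.ne']
  rw [e]
  exact (convex_cell s).add_smul_sub_mem hx ht₁ ⟨div_nonneg ht.1 hpos.le, (div_le_one hpos).2 ht.2⟩

/-- `f` is affine with gradient `g s` on each simplex of the family. -/
def IsPiecewiseAffine {d : ℕ} (S : Finset (Finset (Pt d))) (f : Pt d → ℝ)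
    (g : Finset (Pt d) → Pt d) : Prop :=
  ∀ s ∈ S, ∀ x ∈ cell s, ∀ y ∈ cell s, f x - f y = inner ℝ (g s) (x - y)

/-- The piecewise constant function with value `g s` in the interior of the cell of `s`. -/
noncomputable def piecewiseConst {d : ℕ} (S : Finset (Finset (Pt d)))
    (g : Finset (Pt d) → Pt d) (x : Pt d) : Pt d :=
  ∑ s ∈ S, (interior (cell s)).indicator (fun _ => g s) x

theorem measurable_piecewiseConst {d : ℕ} (S : Finset (Finset (Pt d)))
    (g : Finset (Pt d) → Pt d) : Measurable (piecewiseConst S g) :=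
  Finset.measurable_fun_sum S fun _ _ => measurable_const.indicator isOpen_interior.measurableSet

theorem norm_piecewiseConst_le {d : ℕ} (S : Finset (Finset (Pt d)))
    (g : Finset (Pt d) → Pt d) (x : Pt d) : ‖piecewiseConst S g x‖ ≤ ∑ s ∈ S, ‖g s‖ :=
  (norm_sum_le _ _).trans (Finset.sum_le_sum fun _ _ => norm_indicator_le_norm_self _ _)

theorem piecewiseConst_eq {d : ℕ} {S : Finset (Finset (Pt d))}
    (hS : (S : Set (Finset (Pt d))).PairwiseDisjoint fun s => interior (cell s))
    (g : Finset (Pt d) → Pt d) {s : Finset (Pt d)} (hs : s ∈ S) {x : Pt d}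
    (hx : x ∈ interior (cell s)) : piecewiseConst S g x = g s := by
  rw [piecewiseConst, Finset.sum_eq_single_of_mem s hs, indicator_of_mem hx]
  intro t ht hts
  exact indicator_of_notMem (fun hxt => Set.disjoint_left.1 (hS ht hs hts) hxt hx) _

theorem IsPiecewiseAffine.continuousOn {d : ℕ} {S : Finset (Finset (Pt d))} {f : Pt d → ℝ}
    {g : Finset (Pt d) → Pt d} (hf : IsPiecewiseAffine S f g) :
    ContinuousOn f (⋃ s ∈ S, cell s) := by
  have h := LocallyFinite.continuousOn_iUnion (ι := S) (f := fun s => cell (s : Finset (Pt d)))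
    (g := f) (locallyFinite_of_finite _) (fun s => isClosed_cell _) fun s => by
      intro x hx
      have hc : ContinuousWithinAt (fun y => f x + inner ℝ (g s) (y - x)) (cell (s : Finset (Pt d)))
        x := by
          have : Continuous fun y => f x + inner ℝ (g s) (y - x) := by fun_prop
          exact this.continuousWithinAt
      refine hc.congr (fun y hy => ?_) ?_
      · have := hf s s.2 y hy x hx
        linarith
      · simp
  rw [iUnion_subtype] at h
  exact h

open Filter Topology in
-- Along the segment `f` is continuous and has a right derivative given by a cell in which the
-- remaining segment starts; the mean value inequality needs no more. The crude Lipschitz constant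
-- only serves as a dominating bound and does not enter the final estimates.
theorem IsPiecewiseAffine.abs_sub_le {d : ℕ} {S : Finset (Finset (Pt d))} {f : Pt d → ℝ}
    {g : Finset (Pt d) → Pt d} (hf : IsPiecewiseAffine S f g) {x w : Pt d}
    (h : ∀ t ∈ Icc (0 : ℝ) 1, x + t • w ∈ ⋃ s ∈ S, cell s) :
    |f (x + w) - f x| ≤ (∑ s ∈ S, ‖g s‖) * ‖w‖ := by
  set Λ := ∑ s ∈ S, ‖g s‖
  have hcell : ∀ t ∈ Ico (0 : ℝ) 1, ∃ s ∈ S, ∃ t₁ > (0 : ℝ), ∀ u ∈ Icc 0 t₁,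
      x + (t + u) • w ∈ cell s := by
    intro t ht
    obtain ⟨s, hs, t₁, ht₁, h1⟩ := exists_cell_of_segment (S := S) (x := x + t • w) (w := w) (by
      refine Eventually.frequently ?_
      have h1 : ∀ᶠ u in 𝓝[>] (0 : ℝ), u < 1 - t :=
        nhdsWithin_le_nhds (eventually_lt_nhds (by linarith [ht.2]))
      filter_upwards [h1, self_mem_nhdsWithin] with u hu hu0
      have hu0 : 0 < u := hu0
      rw [add_assoc, ← add_smul]
      exact h _ ⟨by linarith [ht.1], by linarith⟩)
    refine ⟨s, hs, t₁, ht₁, fun u hu => ?_⟩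
    rw [add_smul, ← add_assoc]
    exact h1 u hu
  choose! c hc t₁ ht₁ hmem using hcell
  have key := norm_image_sub_le_of_norm_deriv_right_le_segment (f := fun t : ℝ => f (x + t • w))
    (f' := fun t => inner ℝ (g (c t)) w) (a := 0) (b := 1) (C := Λ * ‖w‖) ?_ ?_ ?_
    1 ⟨zero_le_one, le_rfl⟩
  · simpa using key
  · exact hf.continuousOn.comp (Continuous.continuousOn (by fun_prop)) h
  · intro t ht
    have h1 : HasDerivWithinAt (fun u : ℝ => f (x + t • w) + (u - t) * inner ℝ (g (c t)) w)
        (inner ℝ (g (c t)) w) (Ici t) t := by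
      have := (((hasDerivAt_id t).sub_const t).mul_const (inner ℝ (g (c t)) w)).const_add
        (f (x + t • w))
      simpa using this.hasDerivWithinAt
    refine h1.congr_of_eventuallyEq ?_ (by simp)
    have h2 : ∀ᶠ u in 𝓝[≥] t, u < t + t₁ t :=
      nhdsWithin_le_nhds (eventually_lt_nhds (by linarith [ht₁ t ht]))
    filter_upwards [h2, self_mem_nhdsWithin] with u hu hut
    have hut : t ≤ u := hut
    have m1 := hmem t ht (u - t) ⟨by linarith, by linarith⟩
    have m2 := hmem t ht 0 ⟨le_rfl, (ht₁ t ht).le⟩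
    rw [add_sub_cancel] at m1
    rw [add_zero] at m2
    have := hf _ (hc t ht) _ m1 _ m2
    have e : x + u • w - (x + t • w) = (u - t) • w := by module
    rw [e, inner_smul_right] at this
    linarith
  · intro t ht
    refine (norm_inner_le_norm _ _).trans ?_
    gcongr
    exact Finset.single_le_sum (f := fun s => ‖g s‖) (fun _ _ => norm_nonneg _) (hc t ht)

theorem volume_cover_diff_interior {d : ℕ} (S : Finset (Finset (Pt d))) :
    ∀ᵐ x : Pt d, x ∈ (⋃ s ∈ S, cell s) → ∃ s ∈ S, x ∈ interior (cell s) := by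
  have h : ∀ᵐ x : Pt d, ∀ s ∈ S, (x ∈ interior (cell s) ↔ x ∈ cell s) :=
    (Finset.eventually_all S).2 fun s _ => (interior_ae_eq_cell s).mem_iff
  filter_upwards [h] with x hx hxc
  obtain ⟨s, hs, hxs⟩ := mem_iUnion₂.1 hxc
  exact ⟨s, hs, (hx s hs).2 hxs⟩

theorem isBounded_cover {d : ℕ} (S : Finset (Finset (Pt d))) :
    IsCompact (⋃ s ∈ S, cell s) := S.finite_toSet.isCompact_biUnion fun s _ => isCompact_cell s

theorem volume_meshDomain_ne_top {d : ℕ} (S : Finset (Finset (Pt d))) :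
    volume (meshDomain S) ≠ ⊤ :=
  ((measure_mono interior_subset).trans_lt (isBounded_cover S).measure_lt_top).ne

open Filter Topology in
/-- A continuous piecewise affine function is weakly differentiable. -/
theorem IsPiecewiseAffine.hasWeakGradient {d : ℕ} {S : Finset (Finset (Pt d))} {f : Pt d → ℝ}
    {g : Finset (Pt d) → Pt d} (hf : IsPiecewiseAffine S f g)
    (hS : (S : Set (Finset (Pt d))).PairwiseDisjoint fun s => interior (cell s)) :
    HasWeakGradient (meshDomain S) f (piecewiseConst S g) := by
  intro ψ hψ hψc hψU i
  set e : Pt d := EuclideanSpace.single i 1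
  set K := ⋃ s ∈ S, cell s
  set Λ := ∑ s ∈ S, ‖g s‖
  have hΛ : 0 ≤ Λ := Finset.sum_nonneg fun _ _ => norm_nonneg _
  have hKc : IsCompact K := isBounded_cover S
  have he : ‖e‖ = 1 := by simp [e]
  obtain ⟨B, hB⟩ := hKc.exists_bound_of_continuousOn hf.continuousOn
  -- Extension by zero makes translations of the whole space available; the jump at the boundary is
  -- not seen, since `ψ` vanishes there.
  let f0 := K.indicator f
  have hf0i : Integrable f0 volume := by
    rw [integrable_indicator_iff hKc.measurableSet]
    exact hf.continuousOn.integrableOn_compact hKc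
  have hψz : ∀ x ∉ meshDomain S, ψ x = 0 := fun x hx =>
    image_eq_zero_of_notMem_tsupport fun h => hx (hψU h)
  have hψz' : ∀ x ∉ meshDomain S, fderiv ℝ ψ x = 0 := fun x hx =>
    image_eq_zero_of_notMem_tsupport fun h => hx (hψU (tsupport_fderiv_subset ℝ h))
  obtain ⟨C, hC⟩ := hψ.lipschitzWith_of_hasCompactSupport hψc (by simp)
  -- The margin `η` leaves room for shifting the support of `ψ` inside the mesh domain.
  obtain ⟨η, hη, hηU⟩ := hψc.isCompact.exists_cthickening_subset_open (isOpen_meshDomain S) hψU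
  have hin : ∀ x ∈ tsupport ψ, ∀ t ∈ Icc (0 : ℝ) η, x - t • e ∈ meshDomain S := by
    intro x hx t ht
    refine hηU (Metric.mem_cthickening_of_dist_le _ x _ _ hx ?_)
    rw [dist_eq_norm, sub_sub_cancel_left, norm_neg, norm_smul, he, mul_one,
      Real.norm_of_nonneg ht.1]
    exact ht.2
  have hKU : meshDomain S ⊆ K := interior_subset
  -- Difference quotients replace integration by parts on single simplices, so that no facet terms
  -- have to be cancelled. The quotients of `ψ` and those of `f0` have equal integrals, and both
  -- converge by domination.
  have hl1 : Tendsto (fun t : ℝ => ∫ x, f0 x * (t⁻¹ * (ψ (x + t • e) - ψ x))) (𝓝[>] 0)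
      (𝓝 (∫ x, f0 x * fderiv ℝ ψ x e)) := by
    refine tendsto_integral_filter_of_dominated_convergence (fun x => ‖f0 x‖ * C)
      (Eventually.of_forall fun t => ?_) ?_ (hf0i.norm.mul_const _) (ae_of_all _ fun x => ?_)
    · have := hψ.continuous
      exact hf0i.aestronglyMeasurable.mul (Continuous.aestronglyMeasurable (by fun_prop))
    · filter_upwards [self_mem_nhdsWithin] with t ht
      have ht : 0 < t := ht
      refine ae_of_all _ fun x => ?_
      rw [norm_mul, norm_mul]
      gcongr
      have h1 := hC.dist_le_mul (x + t • e) x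
      rw [dist_eq_norm, dist_eq_norm, add_sub_cancel_left, norm_smul, he, mul_one] at h1
      rw [norm_inv, inv_mul_le_iff₀ (norm_pos_iff.2 ht.ne')]
      linarith
    · refine Tendsto.const_mul _ ?_
      have h1 : HasDerivAt (fun t : ℝ => ψ (x + t • e)) (fderiv ℝ ψ x e) 0 := by
        have h2 : HasDerivAt (fun t : ℝ => x + t • e) e 0 := by
          simpa using ((hasDerivAt_id (0 : ℝ)).smul_const e).const_add x
        have h3 : HasFDerivAt ψ (fderiv ℝ ψ x) (x + (0 : ℝ) • e) := by
          rw [zero_smul, add_zero]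
          exact ((hψ.differentiable (by simp)) x).hasFDerivAt
        exact h3.comp_hasDerivAt 0 h2
      simpa using h1.tendsto_slope_zero_right
  have hl2 : Tendsto (fun t : ℝ => ∫ x, (t⁻¹ * (f0 (x - t • e) - f0 x)) * ψ x) (𝓝[>] 0)
      (𝓝 (∫ x, (-(piecewiseConst S g x i)) * ψ x)) := by
    refine tendsto_integral_filter_of_dominated_convergence (fun x => Λ * ‖ψ x‖)
      (Eventually.of_forall fun t => ?_) ?_
      ((hψ.continuous.integrable_of_hasCompactSupport hψc).norm.const_mul _) ?_
    · refine AEStronglyMeasurable.mul (AEStronglyMeasurable.const_mul ?_ _)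
        hψ.continuous.aestronglyMeasurable
      exact ((hf0i.comp_sub_right (t • e)).aestronglyMeasurable).sub hf0i.aestronglyMeasurable
    · filter_upwards [self_mem_nhdsWithin, nhdsWithin_le_nhds (eventually_le_nhds hη)] with t ht ht'
      have ht : 0 < t := ht
      refine ae_of_all _ fun x => ?_
      rw [norm_mul]
      by_cases hx : x ∈ tsupport ψ
      · gcongr
        have h1 := hf.abs_sub_le (x := x) (w := -(t • e)) fun u hu => hKU (by
          rw [smul_neg, ← sub_eq_add_neg, smul_smul]
          refine hin x hx _ ⟨mul_nonneg hu.1 ht.le, ?_⟩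
          nlinarith [hu.2])
        rw [← sub_eq_add_neg, norm_neg, norm_smul, he, mul_one] at h1
        have m1 : x - t • e ∈ K := hKU (hin x hx t ⟨ht.le, ht'⟩)
        have m2 : x ∈ K := hKU (hψU hx)
        rw [norm_mul, norm_inv, inv_mul_le_iff₀ (norm_pos_iff.2 ht.ne'), mul_comm]
        simp only [f0]
        rw [indicator_of_mem m1, indicator_of_mem m2]
        exact h1
      · rw [image_eq_zero_of_notMem_tsupport hx]; simp
    · filter_upwards [volume_cover_diff_interior S] with x hxc
      by_cases hx : x ∈ tsupport ψ
      · refine Tendsto.mul_const _ ?_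
        obtain ⟨s, hs, hxs⟩ := hxc (hKU (hψU hx))
        have h1 : ∀ᶠ t in 𝓝[>] (0 : ℝ), x - t • e ∈ interior (cell s) := by
          have hc : Continuous fun t : ℝ => x - t • e := by fun_prop
          refine nhdsWithin_le_nhds ((hc.tendsto 0).eventually (isOpen_interior.mem_nhds ?_))
          simpa using hxs
        refine tendsto_const_nhds.congr' ?_
        filter_upwards [h1, self_mem_nhdsWithin] with t h1 ht
        have ht : 0 < t := ht
        have m1 := interior_subset h1
        have m2 := interior_subset hxs
        simp only [f0]
        rw [indicator_of_mem (show x - t • e ∈ K from mem_iUnion₂.2 ⟨s, hs, m1⟩),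
          indicator_of_mem (show x ∈ K from mem_iUnion₂.2 ⟨s, hs, m2⟩),
          hf s hs _ m1 _ m2, piecewiseConst_eq hS g hs hxs, sub_sub_cancel_left, inner_neg_right,
          inner_smul_right]
        have : inner ℝ (g s) e = g s i := by simp [e, EuclideanSpace.inner_single_right]
        rw [this]
        field_simp
      · rw [image_eq_zero_of_notMem_tsupport hx]; simp
  -- Discrete integration by parts, from translation invariance of the measure.
  have heq : ∀ t : ℝ, ∫ x, f0 x * (t⁻¹ * (ψ (x + t • e) - ψ x)) =
      ∫ x, (t⁻¹ * (f0 (x - t • e) - f0 x)) * ψ x := by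
    intro t
    have hb : ∃ M, ∀ x, ‖ψ x‖ ≤ M := hψ.continuous.bounded_above_of_compact_support hψc |>.imp
      fun M h => h
    obtain ⟨M, hM⟩ := hb
    have hψm : AEStronglyMeasurable ψ (volume : Measure (Pt d)) := hψ.continuous.aestronglyMeasurable
    have i1 : Integrable (fun x => f0 x * ψ (x + t • e)) volume :=
      hf0i.mul_bdd (by have := hψ.continuous; exact Continuous.aestronglyMeasurable (by fun_prop))
        (ae_of_all _ fun x => hM _)
    have i2 : Integrable (fun x => f0 x * ψ x) volume := hf0i.mul_bdd hψm (ae_of_all _ hM)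
    have i3 : Integrable (fun x => f0 (x - t • e) * ψ x) volume :=
      (hf0i.comp_sub_right (t • e)).mul_bdd hψm (ae_of_all _ hM)
    have s1 : ∫ x, f0 x * ψ (x + t • e) = ∫ x, f0 (x - t • e) * ψ x := by
      rw [← integral_sub_right_eq_self _ (t • e)]
      simp
    have e1 : ∀ x, f0 x * (t⁻¹ * (ψ (x + t • e) - ψ x)) =
        t⁻¹ * (f0 x * ψ (x + t • e) - f0 x * ψ x) := fun x => by ring
    have e2 : ∀ x, (t⁻¹ * (f0 (x - t • e) - f0 x)) * ψ x =
        t⁻¹ * (f0 (x - t • e) * ψ x - f0 x * ψ x) := fun x => by ring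
    simp_rw [e1, e2]
    rw [integral_const_mul, integral_const_mul, integral_sub i1 i2, integral_sub i3 i2, s1]
  have hfin := tendsto_nhds_unique hl1 (by simpa only [heq] using hl2)
  rw [setIntegral_eq_integral_of_forall_compl_eq_zero fun x hx => by simp [hψz' x hx],
    setIntegral_eq_integral_of_forall_compl_eq_zero fun x hx => by simp [hψz x hx]]
  simp_rw [neg_mul, integral_neg] at hfin
  rw [← hfin]
  refine integral_congr_ae (ae_of_all _ fun x => ?_)
  by_cases hx : x ∈ K
  · simp only [f0]; rw [indicator_of_mem hx]
  · simp [hψz' x fun h => hx (hKU h)]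

/-! ### The nodal basis -/

theorem enorm_sq_eq_ofReal (a : ℝ) : ‖a‖ₑ ^ 2 = ENNReal.ofReal (a ^ 2) := by
  rw [← sq_abs, ENNReal.ofReal_pow (abs_nonneg a), ← Real.norm_eq_abs, ofReal_norm]

/-- Jensen's inequality for squares of finite convex combinations. -/
theorem enorm_sum_mul_sq_le {ι : Type*} {N : Finset ι} {c w : ι → ℝ} (hw : ∀ i ∈ N, 0 ≤ w i)
    (hsum : ∑ i ∈ N, w i ≤ 1) :
    ‖∑ i ∈ N, c i * w i‖ₑ ^ 2 ≤ ∑ i ∈ N, ‖w i‖ₑ * ‖c i‖ₑ ^ 2 := by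
  have h1 : (∑ i ∈ N, c i * w i) ^ 2 ≤ ∑ i ∈ N, w i * c i ^ 2 := by
    have h2 := N.sum_sq_le_sum_mul_sum_of_sq_le_mul (r := fun i => c i * w i) (f := w)
      (g := fun i => w i * c i ^ 2) hw (fun i hi => mul_nonneg (hw i hi) (sq_nonneg _))
      fun i _ => le_of_eq (by ring)
    refine h2.trans (mul_le_of_le_one_left ?_ hsum)
    exact Finset.sum_nonneg fun i hi => mul_nonneg (hw i hi) (sq_nonneg _)
  rw [enorm_sq_eq_ofReal]
  refine (ENNReal.ofReal_le_ofReal h1).trans (le_of_eq ?_)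
  rw [ENNReal.ofReal_sum_of_nonneg fun i hi => mul_nonneg (hw i hi) (sq_nonneg _)]
  refine Finset.sum_congr rfl fun i hi => ?_
  rw [ENNReal.ofReal_mul (hw i hi), enorm_sq_eq_ofReal, Real.enorm_of_nonneg (hw i hi)]

theorem enorm_sum_sq_le {ι : Type*} {E : Type*} [NormedAddCommGroup E] (N : Finset ι) (c : ι → E) :
    ‖∑ i ∈ N, c i‖ₑ ^ 2 ≤ N.card * ∑ i ∈ N, ‖c i‖ₑ ^ 2 := by
  have h1 : ‖∑ i ∈ N, c i‖ ^ 2 ≤ N.card * ∑ i ∈ N, ‖c i‖ ^ 2 :=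
    (pow_le_pow_left₀ (norm_nonneg _) (norm_sum_le _ _) 2).trans (sq_sum_le_card_mul_sum_sq)
  have e : ∀ x : E, ‖x‖ₑ ^ 2 = ENNReal.ofReal (‖x‖ ^ 2) := fun x => by
    rw [ENNReal.ofReal_pow (norm_nonneg x), ofReal_norm]
  simp_rw [e]
  rw [← ENNReal.ofReal_sum_of_nonneg fun _ _ => sq_nonneg _, ← ENNReal.ofReal_natCast,
    ← ENNReal.ofReal_mul (Nat.cast_nonneg _)]
  exact ENNReal.ofReal_le_ofReal h1

open Classical in
/-- The gradient of a barycentric coordinate, as a total function of the vertex set. -/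
noncomputable def cellGrad {d : ℕ} (s : Finset (Pt d)) (z : Pt d) : Pt d :=
  if h : IsSimplex s then h.grad z else 0

theorem cellGrad_eq {d : ℕ} {s : Finset (Pt d)} (H : IsSimplex s) (z : Pt d) :
    cellGrad s z = H.grad z := dif_pos H

namespace IsTriangulation

variable {d : ℕ} {Ω : Set (Pt d)} {T S : Finset (Finset (Pt d))}

theorem hat_nonneg (hT : IsTriangulation Ω T) (hST : S ⊆ T) (z x : Pt d) : 0 ≤ hat S z x := by
  by_cases hx : x ∈ ⋃ s ∈ S, cell s
  · obtain ⟨s, hs, hxs⟩ := mem_iUnion₂.1 hx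
    rw [hat_eq_coord hT hST hs (hT.isSimplex (hST hs)) hxs]
    exact (hT.isSimplex (hST hs)).coord_nonneg hxs z
  · rw [hat_eq_zero hx]

theorem hat_eq_zero_of_notMem (hT : IsTriangulation Ω T) (hST : S ⊆ T) {s : Finset (Pt d)}
    (hs : s ∈ S) {x z : Pt d} (hx : x ∈ cell s) (hz : z ∉ s) : hat S z x = 0 := by
  rw [hat_eq_coord hT hST hs (hT.isSimplex (hST hs)) hx, IsSimplex.coord_of_notMem _ hz]
  rfl

theorem sum_mul_hat (hT : IsTriangulation Ω T) (hST : S ⊆ T) {s : Finset (Pt d)}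
    (hs : s ∈ S) {x : Pt d} (hx : x ∈ cell s) (c : Pt d → ℝ) :
    ∑ z ∈ gridNodes S, c z * hat S z x = ∑ z ∈ s, c z * (hT.isSimplex (hST hs)).coord z x := by
  classical
  have hsub : s ⊆ gridNodes S := fun z hz => Finset.mem_biUnion.2 ⟨s, hs, hz⟩
  rw [← Finset.sum_subset hsub fun z _ hz => by
    rw [hT.hat_eq_zero_of_notMem hST hs hx hz, mul_zero]]
  exact Finset.sum_congr rfl fun z _ => by rw [hat_eq_coord hT hST hs _ hx]

theorem sum_hat_le_one (hT : IsTriangulation Ω T) (hST : S ⊆ T) {N : Finset (Pt d)}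
    (hN : N ⊆ gridNodes S) (x : Pt d) : ∑ z ∈ N, hat S z x ≤ 1 := by
  by_cases hx : x ∈ ⋃ s ∈ S, cell s
  · obtain ⟨s, hs, hxs⟩ := mem_iUnion₂.1 hx
    have h1 := hT.sum_mul_hat hST hs hxs fun _ => 1
    simp only [one_mul, (hT.isSimplex (hST hs)).sum_coord] at h1
    rw [← h1]
    exact Finset.sum_le_sum_of_subset_of_nonneg hN fun z _ _ => hT.hat_nonneg hST z x
  · simp [hat_eq_zero hx]

theorem hat_le_one (hT : IsTriangulation Ω T) (hST : S ⊆ T) (z x : Pt d) : hat S z x ≤ 1 := by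
  by_cases hx : x ∈ ⋃ s ∈ S, cell s
  · obtain ⟨s, hs, hxs⟩ := mem_iUnion₂.1 hx
    rw [hat_eq_coord hT hST hs (hT.isSimplex (hST hs)) hxs]
    exact (hT.isSimplex (hST hs)).coord_le_one hxs z
  · rw [hat_eq_zero hx]; exact zero_le_one

theorem isPiecewiseAffine_hat (hT : IsTriangulation Ω T) (hST : S ⊆ T) (z : Pt d) :
    IsPiecewiseAffine S (hat S z) fun s => cellGrad s z := by
  intro s hs x hx y hy
  have H := hT.isSimplex (hST hs)
  rw [hat_eq_coord hT hST hs H hx, hat_eq_coord hT hST hs H hy, H.coord_sub, ← cellGrad_eq H z]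

theorem isPiecewiseAffine_sum (hT : IsTriangulation Ω T) (hST : S ⊆ T) (N : Finset (Pt d))
    (c : Pt d → ℝ) : IsPiecewiseAffine S (fun x => ∑ z ∈ N, c z * hat S z x)
      fun s => ∑ z ∈ N, c z • cellGrad s z := by
  intro s hs x hx y hy
  simp only
  rw [← Finset.sum_sub_distrib, sum_inner]
  refine Finset.sum_congr rfl fun z _ => ?_
  rw [← mul_sub, hT.isPiecewiseAffine_hat hST z s hs x hx y hy, real_inner_smul_left]

theorem measurable_hat (hT : IsTriangulation Ω T) (hST : S ⊆ T) (z : Pt d) :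
    Measurable (hat S z) := by
  classical
  have h := (hT.isPiecewiseAffine_hat hST z).continuousOn.measurable_piecewise
    (g := fun _ => (0 : ℝ)) continuousOn_const (isClosed_biUnion_cell S).measurableSet
  convert h using 1
  ext x
  by_cases hx : x ∈ ⋃ s ∈ S, cell s
  · rw [piecewise_eq_of_mem _ _ _ hx]
  · rw [piecewise_eq_of_notMem _ _ _ hx, hat_eq_zero hx]

theorem memLp_hat (hT : IsTriangulation Ω T) (hST : S ⊆ T) (z : Pt d) (p : ℝ≥0∞) :
    MemLp (hat S z) p (volume.restrict (meshDomain S)) := by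
  have : IsFiniteMeasure ((volume : Measure (Pt d)).restrict (meshDomain S)) :=
    isFiniteMeasure_restrict.2 (volume_meshDomain_ne_top S)
  refine MemLp.of_bound (hT.measurable_hat hST z).aestronglyMeasurable 1 (ae_of_all _ fun x => ?_)
  rw [Real.norm_of_nonneg (hT.hat_nonneg hST z x)]
  exact hT.hat_le_one hST z x

end IsTriangulation

/-! ### Nodal means and the `L²` bound. -/

/-- A weighted mean is a minimizer of the weighted square deviation, up to a factor. -/
theorem enorm_sub_mean_sq_mul_le {α : Type*} [MeasurableSpace α] {μ : Measure α} {φ v : α → ℝ}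
    (hφ : ∀ x, 0 ≤ φ x) (hφi : Integrable φ μ) (hvφ : Integrable (fun x => v x * φ x) μ)
    (hv : AEMeasurable v μ) (a : ℝ) :
    ‖a - (∫ y, v y * φ y ∂μ) / ∫ y, φ y ∂μ‖ₑ ^ 2 * ∫⁻ y, ‖φ y‖ₑ ∂μ ≤
      ∫⁻ y, ‖φ y‖ₑ * ‖a - v y‖ₑ ^ 2 ∂μ := by
  set m := ∫ y, φ y ∂μ with hm
  have hmE : ∫⁻ y, ‖φ y‖ₑ ∂μ = ‖m‖ₑ := by
    rw [Real.enorm_of_nonneg (integral_nonneg hφ),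
      ofReal_integral_eq_lintegral_ofReal hφi (ae_of_all _ hφ)]
    exact lintegral_congr fun y => Real.enorm_of_nonneg (hφ y)
  rw [hmE]
  -- For a weight of mass zero the left side vanishes, whatever the value of the quotient.
  by_cases hm0 : m = 0
  · simp [hm0]
  have hmE0 : ‖m‖ₑ ≠ 0 := enorm_ne_zero.2 hm0
  have e : (a - (∫ y, v y * φ y ∂μ) / m) * m = ∫ y, φ y * (a - v y) ∂μ := by
    have e1 : ∀ y, φ y * (a - v y) = a * φ y - v y * φ y := fun y => by ring
    simp_rw [e1]
    rw [integral_sub (hφi.const_mul a) hvφ, integral_const_mul, sub_mul, div_mul_cancel₀ _ hm0]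
  refine (ENNReal.mul_le_mul_iff_right hmE0 enorm_ne_top).1 ?_
  calc ‖m‖ₑ * (‖a - (∫ y, v y * φ y ∂μ) / m‖ₑ ^ 2 * ‖m‖ₑ)
      = ‖(a - (∫ y, v y * φ y ∂μ) / m) * m‖ₑ ^ 2 := by rw [enorm_mul]; ring
    _ ≤ (∫⁻ y, ‖φ y‖ₑ * ‖a - v y‖ₑ ∂μ) ^ 2 := by
        rw [e]
        refine pow_le_pow_left' ((enorm_integral_le_lintegral_enorm _).trans (le_of_eq ?_)) 2
        exact lintegral_congr fun y => enorm_mul _ _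
    _ ≤ _ := by
        rw [← hmE]
        exact lintegral_mul_sq_le μ hφi.aestronglyMeasurable.enorm (hv.const_sub a).enorm

section Stability

variable {d : ℕ} {Ω : Set (Pt d)} {T S : Finset (Finset (Pt d))}

/-- The coefficients of the lumped mass projection. -/
noncomputable def nodalMean (S : Finset (Finset (Pt d))) (v : Pt d → ℝ) (z : Pt d) : ℝ :=
  (∫ y in meshDomain S, v y * hat S z y) / ∫ y in meshDomain S, hat S z y

theorem IsTriangulation.enorm_sub_nodalMean_le (hT : IsTriangulation Ω T) (hST : S ⊆ T)
    {v : Pt d → ℝ} (hv : MemLp v 2 (volume.restrict (meshDomain S))) (z : Pt d) (a : ℝ) :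
    ‖a - nodalMean S v z‖ₑ ^ 2 * ∫⁻ y in meshDomain S, ‖hat S z y‖ₑ ≤
      ∫⁻ y in meshDomain S, ‖hat S z y‖ₑ * ‖a - v y‖ₑ ^ 2 := by
  have : IsFiniteMeasure ((volume : Measure (Pt d)).restrict (meshDomain S)) :=
    isFiniteMeasure_restrict.2 (volume_meshDomain_ne_top S)
  refine enorm_sub_mean_sq_mul_le (hT.hat_nonneg hST z)
    ((hT.memLp_hat hST z 1).integrable le_rfl) ?_ hv.aestronglyMeasurable.aemeasurable a
  exact hv.integrable_mul (hT.memLp_hat hST z 2)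

/-- Lumped mass projections do not increase the `L²` norm. -/
theorem IsTriangulation.lintegral_lumpedProj_le (hT : IsTriangulation Ω T) (hST : S ⊆ T)
    {N : Finset (Pt d)} (hN : N ⊆ gridNodes S) {v : Pt d → ℝ}
    (hv : MemLp v 2 (volume.restrict (meshDomain S))) :
    ∫⁻ x in meshDomain S, ‖lumpedProj S N v x‖ₑ ^ 2 ≤ ∫⁻ x in meshDomain S, ‖v x‖ₑ ^ 2 := by
  have hm : ∀ z, Measurable fun x => ‖hat S z x‖ₑ := fun z => (hT.measurable_hat hST z).enorm
  have hvm : AEMeasurable (fun x => ‖v x‖ₑ ^ 2) (volume.restrict (meshDomain S)) :=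
    hv.aestronglyMeasurable.enorm.pow_const 2
  calc ∫⁻ x in meshDomain S, ‖lumpedProj S N v x‖ₑ ^ 2
      -- Jensen's inequality. The basis functions sum to at most one, so any subset of the nodes is
      -- admissible.
      ≤ ∫⁻ x in meshDomain S, ∑ z ∈ N, ‖hat S z x‖ₑ * ‖nodalMean S v z‖ₑ ^ 2 :=
        lintegral_mono fun x => enorm_sum_mul_sq_le (fun z _ => hT.hat_nonneg hST z x)
          (hT.sum_hat_le_one hST hN x)
    _ = ∑ z ∈ N, ‖nodalMean S v z‖ₑ ^ 2 * ∫⁻ x in meshDomain S, ‖hat S z x‖ₑ := by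
        rw [lintegral_finsetSum _ fun z _ => (hm z).mul_const _]
        exact Finset.sum_congr rfl fun z _ => by rw [lintegral_mul_const _ (hm z), mul_comm]
    -- The estimate for the mean at `a = 0`: its factor, the mass of the basis function, is the one
    -- produced by the integration.
    _ ≤ ∑ z ∈ N, ∫⁻ x in meshDomain S, ‖hat S z x‖ₑ * ‖v x‖ₑ ^ 2 := by
        refine Finset.sum_le_sum fun z _ => ?_
        have := hT.enorm_sub_nodalMean_le hST hv z 0
        simpa only [zero_sub, enorm_neg] using this
    _ = ∫⁻ x in meshDomain S, ∑ z ∈ N, ‖hat S z x‖ₑ * ‖v x‖ₑ ^ 2 :=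
        (lintegral_finsetSum' _ fun z _ => (hm z).aemeasurable.mul hvm).symm
    _ ≤ _ := by
        refine lintegral_mono fun x => ?_
        rw [← Finset.sum_mul]
        refine mul_le_of_le_one_left' ?_
        have e : ∑ z ∈ N, ‖hat S z x‖ₑ = ENNReal.ofReal (∑ z ∈ N, hat S z x) := by
          rw [ENNReal.ofReal_sum_of_nonneg fun z _ => hT.hat_nonneg hST z x]
          exact Finset.sum_congr rfl fun z _ => Real.enorm_of_nonneg (hT.hat_nonneg hST z x)
        rw [e, ← ENNReal.ofReal_one]
        exact ENNReal.ofReal_le_ofReal (hT.sum_hat_le_one hST hN x)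

end Stability

namespace IsRegularMesh

variable {d : ℕ} {Ω : Set (Pt d)} {T S : Finset (Finset (Pt d))} {θ h : ℝ}

/-- A lower bound for the mass of a nodal basis function. -/
theorem ballVol_le_lintegral_hat (hM : IsRegularMesh Ω T θ h) (hST : S ⊆ T) {s : Finset (Pt d)}
    (hs : s ∈ S) {z : Pt d} (hz : z ∈ s) :
    ballVol d h ≤ 2 * ENNReal.ofReal ((2 / θ) ^ d) * ∫⁻ y in meshDomain S, ‖hat S z y‖ₑ := by
  have H := hM.tri.isSimplex (hST hs)
  obtain ⟨c, hc⟩ := hM.ball s (hST hs)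
  -- The homothety with centre `z` and ratio one half maps the inscribed ball to the ball about `b`,
  -- and it maps the simplex to points where the coordinate of `z` is at least one half.
  set b := (1 / 2 : ℝ) • (z + c)
  have hb : ∀ x ∈ Metric.closedBall b (θ * h / 2), x ∈ cell s ∧ 1 / 2 ≤ H.coord z x := by
    intro x hx
    have hx' : z + 2 • (x - z) ∈ cell s := hc (by
      have e : z + 2 • (x - z) - c = (2 : ℝ) • (x - b) := by simp only [b]; module
      rw [mem_closedBall_iff_norm, e, norm_smul, ← dist_eq_norm]
      rw [Metric.mem_closedBall] at hx
      norm_num; linarith)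
    have e : x = (1 / 2 : ℝ) • z + (1 / 2 : ℝ) • (z + 2 • (x - z)) := by module
    refine ⟨?_, ?_⟩
    · rw [e]
      exact convex_cell s (mem_cell_of_mem hz) hx' (by norm_num) (by norm_num) (by norm_num)
    · have h1 := H.coord_nonneg hx' z
      have h2 := H.coord_vertex hz hz
      have h3 := H.coord_sub z (z + 2 • (x - z)) z
      have h4 := H.coord_sub z x z
      rw [add_sub_cancel_left, ← Nat.cast_smul_eq_nsmul ℝ, inner_smul_right, ← h4] at h3
      rw [← Nat.cast_smul_eq_nsmul ℝ] at h1
      rw [if_pos rfl] at h2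
      push_cast at h1 h3
      linarith
  have hr : 0 < θ * h / 2 := half_pos hM.radius_pos
  have h1 : ENNReal.ofReal (1 / 2) * ballVol d (θ * h / 2) ≤
      ∫⁻ y in meshDomain S, ‖hat S z y‖ₑ := by
    rw [← volume_ball_eq b, ← setLIntegral_const]
    calc ∫⁻ y in Metric.ball b (θ * h / 2), ENNReal.ofReal (1 / 2)
        ≤ ∫⁻ y in Metric.ball b (θ * h / 2), ‖hat S z y‖ₑ := by
          refine setLIntegral_mono' measurableSet_ball fun y hy => ?_
          obtain ⟨h2, h3⟩ := hb y (Metric.ball_subset_closedBall hy)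
          rw [hat_eq_coord hM.tri hST hs H h2, Real.enorm_of_nonneg (H.coord_nonneg h2 z)]
          exact ENNReal.ofReal_le_ofReal h3
      _ ≤ _ := lintegral_mono_set (interior_maximal (fun y hy => mem_iUnion₂.2
          ⟨s, hs, (hb y (Metric.ball_subset_closedBall hy)).1⟩) Metric.isOpen_ball)
  have e : h = 2 / θ * (θ * h / 2) := by have := hM.θ_pos.ne'; field_simp
  calc ballVol d h = ENNReal.ofReal ((2 / θ) ^ d) * ballVol d (θ * h / 2) := by
        conv_lhs => rw [e]
        exact ballVol_mul (div_pos two_pos hM.θ_pos)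
    _ = 2 * ENNReal.ofReal ((2 / θ) ^ d) *
          (ENNReal.ofReal (1 / 2) * ballVol d (θ * h / 2)) := by
        have : (2 : ℝ≥0∞) * ENNReal.ofReal (1 / 2) = 1 := by
          rw [← ENNReal.ofReal_ofNat, ← ENNReal.ofReal_mul zero_le_two]; norm_num
        rw [mul_right_comm, ← mul_assoc 2, this, one_mul, mul_comm]
    _ ≤ _ := by gcongr

open Classical in
theorem card_star_le (hM : IsRegularMesh Ω T θ h) (hST : S ⊆ T) (z : Pt d) :
    (((S.filter fun t => z ∈ t).card : ℕ) : ℝ≥0∞) ≤ ENNReal.ofReal ((1 / θ) ^ d) := by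
  rw [← ENNReal.ofReal_natCast]
  refine ENNReal.ofReal_le_ofReal (hM.card_le_of_subset_closedBall (z := z)
    ((Finset.filter_subset _ _).trans hST) one_pos fun s hs x hx => ?_)
  rw [Finset.mem_filter] at hs
  rw [one_mul]
  exact hM.dist_le s (hST hs.1) x hx z (mem_cell_of_mem hs.2)

/-- The constant in the comparison with the nodal means. -/
noncomputable def meanConst (d : ℕ) (θ : ℝ) : ℝ≥0∞ :=
  2 * ENNReal.ofReal ((2 / θ) ^ d) * ENNReal.ofReal ((1 / θ) ^ d)

/-- The squared deviation of `v x` from the mean is at most a weighted average of `|v x - v y|²`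
over the star of `z`. The weight is at most one, its mass is comparable to the volume of a ball of
radius `h`, and the star has boundedly many simplices; integration over `x` leaves the energies
between `s` and the star. -/
theorem lintegral_sub_nodalMean_le (hM : IsRegularMesh Ω T θ h) (hST : S ⊆ T) {v : Pt d → ℝ}
    (hv : MemLp v 2 (volume.restrict (meshDomain S))) {s : Finset (Pt d)} (hs : s ∈ S) {z : Pt d}
    (hz : z ∈ s) {Y : ℝ≥0∞}
    (hE : ∀ t ∈ S, z ∈ t → energy v (cell s) (cell t) ≤ ballVol d h * Y) :
    ∫⁻ x in cell s, ‖v x - nodalMean S v z‖ₑ ^ 2 ≤ meanConst d θ * Y := by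
  classical
  set m := ∫⁻ y in meshDomain S, ‖hat S z y‖ₑ
  have hm := hM.ballVol_le_lintegral_hat hST hs hz
  have hV0 := (ballVol_pos (d := d) hM.h_pos).ne'
  have key : ∀ a : ℝ, ‖a - nodalMean S v z‖ₑ ^ 2 * m ≤
      ∑ t ∈ S.filter fun t => z ∈ t, ∫⁻ y in cell t, ‖a - v y‖ₑ ^ 2 := by
    intro a
    refine (hM.tri.enorm_sub_nodalMean_le hST hv z a).trans ?_
    have h1 : ∀ y ∈ meshDomain S, ‖hat S z y‖ₑ * ‖a - v y‖ₑ ^ 2 ≤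
        ∑ t ∈ S.filter fun t => z ∈ t, (cell t).indicator (fun y => ‖a - v y‖ₑ ^ 2) y := by
      intro y hy
      obtain ⟨t, ht, hyt⟩ := mem_iUnion₂.1 (interior_subset hy)
      by_cases hzt : z ∈ t
      · refine le_trans ?_ (Finset.single_le_sum (f := fun t =>
          (cell t).indicator (fun y => ‖a - v y‖ₑ ^ 2) y) (fun _ _ => zero_le)
          (Finset.mem_filter.2 ⟨ht, hzt⟩))
        rw [indicator_of_mem hyt]
        refine mul_le_of_le_one_left' ?_
        rw [Real.enorm_of_nonneg (hM.tri.hat_nonneg hST z y), ← ENNReal.ofReal_one]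
        exact ENNReal.ofReal_le_ofReal (hM.tri.hat_le_one hST z y)
      · rw [hM.tri.hat_eq_zero_of_notMem hST ht hyt hzt, enorm_zero, zero_mul]
        exact zero_le
    refine (setLIntegral_mono' (isOpen_meshDomain S).measurableSet h1).trans ?_
    have hvm : AEMeasurable (fun y => ‖a - v y‖ₑ ^ 2) (volume.restrict (meshDomain S)) :=
      (hv.aestronglyMeasurable.aemeasurable.const_sub a).enorm.pow_const 2
    rw [lintegral_finsetSum' _ fun t _ => hvm.indicator (measurableSet_cell t)]
    refine Finset.sum_le_sum fun t _ => ?_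
    rw [lintegral_indicator (measurableSet_cell t), Measure.restrict_restrict (measurableSet_cell t)]
    exact lintegral_mono_set inter_subset_left
  have hVtop : ballVol d h ≠ ⊤ := ballVol_ne_top
  have hsum : (∫⁻ x in cell s, ‖v x - nodalMean S v z‖ₑ ^ 2) * m ≤
      ENNReal.ofReal ((1 / θ) ^ d) * (ballVol d h * Y) := by
    have hvs : AEMeasurable v (volume.restrict (cell s)) := by
      rw [← Measure.restrict_congr_set (interior_ae_eq_cell s)]
      exact (hv.aestronglyMeasurable.aemeasurable).mono_measure
        (Measure.restrict_mono (interior_cell_subset_meshDomain hs) le_rfl)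
    rw [← lintegral_mul_const'' _ ((hvs.sub_const _).enorm.pow_const 2)]
    refine (lintegral_mono fun x => key (v x)).trans ?_
    rw [lintegral_finsetSum']
    · refine (Finset.sum_le_card_nsmul _ _ (ballVol d h * Y) fun t ht => ?_).trans ?_
      · exact hE t (Finset.mem_filter.1 ht).1 (Finset.mem_filter.1 ht).2
      · rw [nsmul_eq_mul]
        gcongr
        exact hM.card_star_le hST z
    · intro t ht
      have hvt : AEMeasurable v (volume.restrict (cell t)) := by
        rw [← Measure.restrict_congr_set (interior_ae_eq_cell t)]
        exact (hv.aestronglyMeasurable.aemeasurable).mono_measure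
          (Measure.restrict_mono (interior_cell_subset_meshDomain (Finset.mem_filter.1 ht).1) le_rfl)
      have := ((hvs.comp_quasiMeasurePreserving
        (Measure.quasiMeasurePreserving_fst (ν := volume.restrict (cell t)))).sub
        (hvt.comp_quasiMeasurePreserving
        (Measure.quasiMeasurePreserving_snd (μ := volume.restrict (cell s))))).enorm.pow_const 2
      exact this.lintegral_prod_right'
  refine (ENNReal.mul_le_mul_iff_right hV0 hVtop).1 ?_
  calc ballVol d h * ∫⁻ x in cell s, ‖v x - nodalMean S v z‖ₑ ^ 2
      ≤ 2 * ENNReal.ofReal ((2 / θ) ^ d) * m * ∫⁻ x in cell s, ‖v x - nodalMean S v z‖ₑ ^ 2 := by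
        gcongr
    _ = 2 * ENNReal.ofReal ((2 / θ) ^ d) *
          ((∫⁻ x in cell s, ‖v x - nodalMean S v z‖ₑ ^ 2) * m) := by ring
    _ ≤ 2 * ENNReal.ofReal ((2 / θ) ^ d) * (ENNReal.ofReal ((1 / θ) ^ d) * (ballVol d h * Y)) := by
        gcongr
    _ = _ := by unfold meanConst; ring

end IsRegularMesh

theorem lintegral_biUnion_finset_le {α ι : Type*} [MeasurableSpace α] (μ : Measure α)
    (N : Finset ι) (A : ι → Set α) (f : α → ℝ≥0∞) :
    ∫⁻ x in ⋃ i ∈ N, A i, f x ∂μ ≤ ∑ i ∈ N, ∫⁻ x in A i, f x ∂μ := by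
  classical
  induction N using Finset.induction_on with
  | empty => simp
  | insert a N ha ih =>
    rw [Finset.set_biUnion_insert, Finset.sum_insert ha]
    exact (lintegral_union_le _ _ _).trans (by gcongr)

namespace IsSimplex

variable {d : ℕ} {s : Finset (Pt d)}

theorem sum_grad (hs : IsSimplex s) : ∑ z ∈ s, hs.grad z = 0 := by
  refine ext_inner_right ℝ fun u => ?_
  rw [sum_inner, inner_zero_left]
  have h : ∀ z, inner ℝ (hs.grad z) u = hs.coord z (0 + u) - hs.coord z 0 := fun z => by
    rw [hs.coord_add]; ring
  simp_rw [h]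
  rw [Finset.sum_sub_distrib, hs.sum_coord, hs.sum_coord, sub_self]

theorem grad_of_notMem (hs : IsSimplex s) {z : Pt d} (hz : z ∉ s) : hs.grad z = 0 := by
  rw [grad, hs.coord_of_notMem hz]; simp

end IsSimplex

/-! ### From estimates at the nodes to global estimates. -/

namespace IsRegularMesh

variable {d : ℕ} {Ω : Set (Pt d)} {T S : Finset (Finset (Pt d))} {θ h : ℝ}

/-- The overlap of the balls of radius `ρ * h` around the vertices of the simplices. -/
noncomputable def overlapConst (d : ℕ) (θ ρ : ℝ) : ℝ≥0∞ :=
  (d + 1 : ℕ) * ENNReal.ofReal (((ρ + 1) / θ) ^ d)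

/-- A point in the ball about a vertex of a simplex has the whole simplex within distance `(ρ + 1) *
h`. By packing there are boundedly many such simplices, each with `d + 1` vertices. -/
theorem sum_lintegral_closedBall_le (hM : IsRegularMesh Ω T θ h) (hST : S ⊆ T) {ρ : ℝ} (hρ : 0 < ρ)
    {U : Set (Pt d)} {g : Pt d → ℝ≥0∞} (hg : AEMeasurable g (volume.restrict U)) :
    ∑ s ∈ S, ∑ z ∈ s, ∫⁻ x in Metric.closedBall z (ρ * h) ∩ U, g x ≤
      overlapConst d θ ρ * ∫⁻ x in U, g x := by
  classical
  have hm : ∀ z : Pt d, MeasurableSet (Metric.closedBall z (ρ * h)) := fun z =>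
    measurableSet_closedBall
  have e : ∀ z : Pt d, ∫⁻ x in Metric.closedBall z (ρ * h) ∩ U, g x =
      ∫⁻ x in U, (Metric.closedBall z (ρ * h)).indicator g x := fun z => by
    rw [lintegral_indicator (hm z), Measure.restrict_restrict (hm z)]
  simp_rw [e]
  have e2 : ∀ s ∈ S, ∑ z ∈ s, ∫⁻ x in U, (Metric.closedBall z (ρ * h)).indicator g x =
      ∫⁻ x in U, ∑ z ∈ s, (Metric.closedBall z (ρ * h)).indicator g x := fun s _ =>
    (lintegral_finsetSum' _ fun z _ => hg.indicator (hm z)).symm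
  rw [Finset.sum_congr rfl e2, ← lintegral_finsetSum' _ fun s _ =>
    Finset.aemeasurable_fun_sum s fun z _ => hg.indicator (hm z)]
  have hC : overlapConst d θ ρ ≠ ⊤ := by unfold overlapConst; finiteness
  rw [← lintegral_const_mul' _ _ hC]
  refine lintegral_mono fun x => ?_
  set R := S.filter fun s => ∃ z ∈ s, dist x z ≤ ρ * h
  have hR : (R.card : ℝ≥0∞) ≤ ENNReal.ofReal (((ρ + 1) / θ) ^ d) := by
    rw [← ENNReal.ofReal_natCast]
    refine ENNReal.ofReal_le_ofReal (hM.card_le_of_subset_closedBall (z := x)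
      ((Finset.filter_subset _ _).trans hST) (by linarith) fun s hs y hy => ?_)
    obtain ⟨hsS, z, hz, hxz⟩ := Finset.mem_filter.1 hs
    have h1 := hM.dist_le s (hST hsS) y hy z (mem_cell_of_mem hz)
    rw [Metric.mem_closedBall]
    linarith [dist_triangle_right y x z]
  calc ∑ s ∈ S, ∑ z ∈ s, (Metric.closedBall z (ρ * h)).indicator g x
      = ∑ s ∈ R, ∑ z ∈ s, (Metric.closedBall z (ρ * h)).indicator g x := by
        refine (Finset.sum_subset (Finset.filter_subset _ _) fun s hs hsR => ?_).symm
        refine Finset.sum_eq_zero fun z hz => indicator_of_notMem (fun hx => hsR ?_) _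
        exact Finset.mem_filter.2 ⟨hs, z, hz, hx⟩
    _ ≤ ∑ s ∈ R, (d + 1 : ℕ) * g x := by
        refine Finset.sum_le_sum fun s hs => ?_
        rw [← hM.tri.card_eq s (hST (Finset.mem_filter.1 hs).1), ← nsmul_eq_mul]
        exact Finset.sum_le_card_nsmul _ _ _ fun z _ => indicator_le_self _ _ _
    _ = R.card * ((d + 1 : ℕ) * g x) := by rw [Finset.sum_const, nsmul_eq_mul]
    _ ≤ ENNReal.ofReal (((ρ + 1) / θ) ^ d) * ((d + 1 : ℕ) * g x) := by gcongr
    _ = _ := by unfold overlapConst; ring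

theorem enorm_sub_interpolant_sq_le (hM : IsRegularMesh Ω T θ h) (hST : S ⊆ T) {s : Finset (Pt d)}
    (hs : s ∈ S) {x : Pt d} (hx : x ∈ cell s) (c : Pt d → ℝ) (a : ℝ) :
    ‖a - ∑ z ∈ gridNodes S, c z * hat S z x‖ₑ ^ 2 ≤ ∑ z ∈ s, ‖a - c z‖ₑ ^ 2 := by
  have H := hM.tri.isSimplex (hST hs)
  have e : a - ∑ z ∈ gridNodes S, c z * hat S z x = ∑ z ∈ s, (a - c z) * H.coord z x := by
    rw [hM.tri.sum_mul_hat hST hs hx]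
    simp_rw [sub_mul]
    rw [Finset.sum_sub_distrib, ← Finset.mul_sum, H.sum_coord, mul_one]
  rw [e]
  refine (enorm_sum_mul_sq_le (fun z _ => H.coord_nonneg hx z) (H.sum_coord x).le).trans ?_
  refine Finset.sum_le_sum fun z _ => mul_le_of_le_one_left' ?_
  rw [Real.enorm_of_nonneg (H.coord_nonneg hx z), ← ENNReal.ofReal_one]
  exact ENNReal.ofReal_le_ofReal (H.coord_le_one hx z)

/-- The gradients of the coordinates of a simplex sum to zero, so any constant `a` may be subtracted
from the coefficients. With `a = v x` the gradient is controlled by the same quantities as the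
error. -/
theorem enorm_grad_interpolant_sq_le (hM : IsRegularMesh Ω T θ h) (hST : S ⊆ T)
    {s : Finset (Pt d)} (hs : s ∈ S) (c : Pt d → ℝ) (a : ℝ) :
    ‖∑ z ∈ gridNodes S, c z • cellGrad s z‖ₑ ^ 2 ≤
      (d + 1 : ℕ) * ENNReal.ofReal (1 / (θ * h)) ^ 2 * ∑ z ∈ s, ‖a - c z‖ₑ ^ 2 := by
  classical
  have H := hM.tri.isSimplex (hST hs)
  have hsub : s ⊆ gridNodes S := fun z hz => Finset.mem_biUnion.2 ⟨s, hs, hz⟩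
  have e : ∑ z ∈ gridNodes S, c z • cellGrad s z = ∑ z ∈ s, (-(a - c z)) • H.grad z := by
    rw [← Finset.sum_subset hsub fun z _ hz => by
      rw [cellGrad_eq H, H.grad_of_notMem hz, smul_zero]]
    have : ∑ z ∈ s, (-(a - c z)) • H.grad z = ∑ z ∈ s, c z • H.grad z - a • ∑ z ∈ s, H.grad z := by
      rw [Finset.smul_sum, ← Finset.sum_sub_distrib]
      exact Finset.sum_congr rfl fun z _ => by module
    rw [this, H.sum_grad, smul_zero, sub_zero]
    exact Finset.sum_congr rfl fun z _ => by rw [cellGrad_eq H]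
  obtain ⟨b, hb⟩ := hM.ball s (hST hs)
  rw [e]
  refine (enorm_sum_sq_le _ _).trans ?_
  rw [hM.tri.card_eq s (hST hs), mul_assoc]
  refine mul_le_mul' le_rfl ?_
  rw [Finset.mul_sum]
  refine Finset.sum_le_sum fun z _ => ?_
  rw [enorm_smul, enorm_neg, mul_pow, mul_comm]
  gcongr
  rw [← ofReal_norm]
  exact ENNReal.ofReal_le_ofReal (H.norm_grad_le hM.radius_pos hb z)

theorem pairwiseDisjoint_interior (hM : IsRegularMesh Ω T θ h) (hST : S ⊆ T) :
    (S : Set (Finset (Pt d))).PairwiseDisjoint fun s => interior (cell s) :=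
  fun _ hs _ ht hst => hM.disjoint_interior (hST hs) (hST ht) hst

/-- If the coefficients approximate `v` on the simplices around the nodes, then the finite element
function with these coefficients is stable and approximates `v`. -/
theorem interpolant_estimates (hM : IsRegularMesh Ω T θ h) (hST : S ⊆ T)
    {v : Pt d → ℝ} {G : Pt d → Pt d} (hv : MemH1 (meshDomain S) v G) (c : Pt d → ℝ) {ρ : ℝ}
    (hρ : 0 < ρ) {A : ℝ≥0∞}
    (hc : ∀ s ∈ S, ∀ z ∈ s, ∫⁻ x in cell s, ‖v x - c z‖ₑ ^ 2 ≤
      A * ENNReal.ofReal h ^ 2 *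
        ∫⁻ x in Metric.closedBall z (ρ * h) ∩ meshDomain S, ‖G x‖ₑ ^ 2) :
    (∃ G' : Pt d → Pt d, MemH1 (meshDomain S) (fun x => ∑ z ∈ gridNodes S, c z * hat S z x) G' ∧
      ∫⁻ x in meshDomain S, ‖G' x‖ₑ ^ 2 ≤ (d + 1 : ℕ) * ENNReal.ofReal (1 / θ) ^ 2 *
        (A * overlapConst d θ ρ) * ∫⁻ x in meshDomain S, ‖G x‖ₑ ^ 2) ∧
    ∫⁻ x in meshDomain S, ‖v x - ∑ z ∈ gridNodes S, c z * hat S z x‖ₑ ^ 2 ≤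
      A * overlapConst d θ ρ * ENNReal.ofReal h ^ 2 * ∫⁻ x in meshDomain S, ‖G x‖ₑ ^ 2 := by
  have : IsFiniteMeasure ((volume : Measure (Pt d)).restrict (meshDomain S)) :=
    isFiniteMeasure_restrict.2 (volume_meshDomain_ne_top S)
  have hsum : ∑ s ∈ S, ∫⁻ x in cell s, ∑ z ∈ s, ‖v x - c z‖ₑ ^ 2 ≤
      A * overlapConst d θ ρ * ENNReal.ofReal h ^ 2 * ∫⁻ x in meshDomain S, ‖G x‖ₑ ^ 2 := by
    calc ∑ s ∈ S, ∫⁻ x in cell s, ∑ z ∈ s, ‖v x - c z‖ₑ ^ 2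
        ≤ ∑ s ∈ S, ∑ z ∈ s, A * ENNReal.ofReal h ^ 2 *
            ∫⁻ x in Metric.closedBall z (ρ * h) ∩ meshDomain S, ‖G x‖ₑ ^ 2 := by
          refine Finset.sum_le_sum fun s hs => ?_
          rw [lintegral_finsetSum' _ fun z _ =>
            ((aemeasurable_restrict_cell hv hs).sub_const (c z)).enorm.pow_const 2]
          exact Finset.sum_le_sum fun z hz => hc s hs z hz
      _ = A * ENNReal.ofReal h ^ 2 * ∑ s ∈ S, ∑ z ∈ s,
            ∫⁻ x in Metric.closedBall z (ρ * h) ∩ meshDomain S, ‖G x‖ₑ ^ 2 := by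
          simp_rw [Finset.mul_sum]
      _ ≤ A * ENNReal.ofReal h ^ 2 *
            (overlapConst d θ ρ * ∫⁻ x in meshDomain S, ‖G x‖ₑ ^ 2) := by
          gcongr
          exact hM.sum_lintegral_closedBall_le hST hρ
            (hv.memLp_grad.aestronglyMeasurable.enorm.pow_const 2)
      _ = _ := by ring
  have hcov : ∀ f : Pt d → ℝ≥0∞, ∫⁻ x in meshDomain S, f x ≤ ∑ s ∈ S, ∫⁻ x in cell s, f x :=
    fun f => (lintegral_mono_set interior_subset).trans (lintegral_biUnion_finset_le _ _ _ _)
  have hPA := hM.tri.isPiecewiseAffine_sum hST (gridNodes S) c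
  refine ⟨⟨piecewiseConst S fun s => ∑ z ∈ gridNodes S, c z • cellGrad s z, ⟨?_, ?_, ?_⟩, ?_⟩, ?_⟩
  · exact memLp_finsetSum (gridNodes S) fun z _ => (hM.tri.memLp_hat hST z 2).const_mul (c z)
  · exact MemLp.of_bound (measurable_piecewiseConst _ _).aestronglyMeasurable _
      (ae_of_all _ (norm_piecewiseConst_le _ _))
  · exact hPA.hasWeakGradient (hM.pairwiseDisjoint_interior hST)
  · have hh : ENNReal.ofReal (1 / (θ * h)) ^ 2 * ENNReal.ofReal h ^ 2 =
        ENNReal.ofReal (1 / θ) ^ 2 := by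
      rw [← mul_pow, ← ENNReal.ofReal_mul (by have := hM.radius_pos; positivity)]
      congr 2
      have := hM.h_pos.ne'
      have := hM.θ_pos.ne'
      field_simp
    refine (hcov _).trans ?_
    calc _ ≤ ∑ s ∈ S, ∫⁻ x in cell s, (d + 1 : ℕ) * ENNReal.ofReal (1 / (θ * h)) ^ 2 *
            ∑ z ∈ s, ‖v x - c z‖ₑ ^ 2 := by
          refine Finset.sum_le_sum fun s hs => ?_
          rw [← Measure.restrict_congr_set (interior_ae_eq_cell s)]
          refine setLIntegral_mono' isOpen_interior.measurableSet fun x hx => ?_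
          rw [piecewiseConst_eq (hM.pairwiseDisjoint_interior hST) _ hs hx]
          exact hM.enorm_grad_interpolant_sq_le hST hs c (v x)
      _ = (d + 1 : ℕ) * ENNReal.ofReal (1 / (θ * h)) ^ 2 *
            ∑ s ∈ S, ∫⁻ x in cell s, ∑ z ∈ s, ‖v x - c z‖ₑ ^ 2 := by
          rw [Finset.mul_sum]
          exact Finset.sum_congr rfl fun s _ => lintegral_const_mul' _ _ (by finiteness)
      _ ≤ (d + 1 : ℕ) * ENNReal.ofReal (1 / (θ * h)) ^ 2 *
            (A * overlapConst d θ ρ * ENNReal.ofReal h ^ 2 *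
              ∫⁻ x in meshDomain S, ‖G x‖ₑ ^ 2) := by gcongr
      _ = (d + 1 : ℕ) * (ENNReal.ofReal (1 / (θ * h)) ^ 2 * ENNReal.ofReal h ^ 2) *
            (A * overlapConst d θ ρ) * ∫⁻ x in meshDomain S, ‖G x‖ₑ ^ 2 := by ring
      _ = _ := by rw [hh]
  · refine (hcov _).trans (le_trans (Finset.sum_le_sum fun s hs => ?_) hsum)
    exact setLIntegral_mono' (measurableSet_cell s) fun x hx =>
      hM.enorm_sub_interpolant_sq_le hST hs hx c (v x)

end IsRegularMesh

/-! ### Chains of simplices through facets -/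

/-- At most `d` points span a proper affine subspace, which is a null set. -/
theorem volume_affineSpan_insert {d : ℕ} {r : Finset (Pt d)} (hr : r.card < d) (x : Pt d) :
    volume (affineSpan ℝ (insert x (r : Set (Pt d))) : Set (Pt d)) = 0 := by
  classical
  refine Measure.addHaar_affineSubspace _ _ fun htop => ?_
  have h1 : (insert x r).card ≤ d := (Finset.card_insert_le _ _).trans hr
  have h0 : 0 < (insert x r).card := Finset.card_pos.2 (Finset.insert_nonempty _ _)
  have h2 := finrank_vectorSpan_image_finset_le ℝ (id : Pt d → Pt d) (insert x r)
    (n := (insert x r).card - 1) (by omega)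
  rw [Finset.image_id, Finset.coe_insert, ← direction_affineSpan, htop,
    AffineSubspace.direction_top, finrank_top, finrank_euclideanSpace_fin] at h2
  omega

/-- A nonempty open set contains points in general position. -/
theorem exists_notMem_affineSpan {d : ℕ} {W : Set (Pt d)} (hW : IsOpen W) (hne : W.Nonempty)
    (F : Finset (Finset (Pt d))) (hF : ∀ r ∈ F, r.card < d) (p : Finset (Pt d) → Pt d) :
    ∃ y ∈ W, ∀ r ∈ F, y ∉ affineSpan ℝ (insert (p r) (r : Set (Pt d))) := by
  by_contra! h
  have h1 : W ⊆ ⋃ r ∈ F, (affineSpan ℝ (insert (p r) (r : Set (Pt d))) : Set (Pt d)) :=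
    fun y hy => mem_iUnion₂.2 <| by
      obtain ⟨r, hr, hyr⟩ := h y hy
      exact ⟨r, hr, hyr⟩
  refine (hW.measure_pos volume hne).ne' (measure_mono_null h1 ?_)
  exact (measure_biUnion_null_iff F.countable_toSet).2 fun r hr =>
    volume_affineSpan_insert (hF r hr) _

open Classical in
/-- The low dimensional faces of a family of simplices. -/
noncomputable def lowFaces {d : ℕ} (T : Finset (Finset (Pt d))) : Finset (Finset (Pt d)) :=
  T.biUnion fun s => s.powerset.filter fun r => r.card < d

theorem mem_lowFaces {d : ℕ} {T : Finset (Finset (Pt d))} {s r : Finset (Pt d)} (hs : s ∈ T)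
    (hr : r ⊆ s) (hc : r.card < d) : r ∈ lowFaces T := by
  classical
  exact Finset.mem_biUnion.2 ⟨s, hs, Finset.mem_filter.2 ⟨Finset.mem_powerset.2 hr, hc⟩⟩

theorem card_lt_of_mem_lowFaces {d : ℕ} {T : Finset (Finset (Pt d))} {r : Finset (Pt d)}
    (hr : r ∈ lowFaces T) : r.card < d := by
  classical
  obtain ⟨s, _, h⟩ := Finset.mem_biUnion.1 hr
  exact (Finset.mem_filter.1 h).2

theorem cell_subset_affineSpan {d : ℕ} (r : Finset (Pt d)) :
    cell r ⊆ affineSpan ℝ (r : Set (Pt d)) := convexHull_subset_affineSpan _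

namespace IsTriangulation

variable {d : ℕ} {Ω : Set (Pt d)} {T : Finset (Finset (Pt d))}

open Classical in
theorem mem_cell_inter (hT : IsTriangulation Ω T) {s t : Finset (Pt d)} (hs : s ∈ T) (ht : t ∈ T)
    {x : Pt d} (hxs : x ∈ cell s) (hxt : x ∈ cell t) : x ∈ cell (s ∩ t) := by
  have := hT.conforming s hs t ht ⟨hxs, hxt⟩
  rwa [← Finset.coe_inter] at this

/-- By conformity `x` lies in the common face, and vertices outside this face have coordinate zero
at `x`. -/
theorem subset_of_coord_pos (hT : IsTriangulation Ω T) {s t : Finset (Pt d)} (hs : s ∈ T)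
    (ht : t ∈ T) {r : Finset (Pt d)} (hr : r ⊆ s) {x : Pt d} (hxs : x ∈ cell s) (hxt : x ∈ cell t)
    (hpos : ∀ y ∈ r, 0 < (hT.isSimplex hs).coord y x) : r ⊆ t := by
  classical
  intro y hy
  by_contra hyt
  have := (((hT.isSimplex hs).mem_face_iff Finset.inter_subset_left).1
    (hT.mem_cell_inter hs ht hxs hxt)).2 y (hr hy) fun h => hyt (Finset.mem_inter.1 h).2
  exact (hpos y hy).ne' this

theorem eq_of_mem_interior (hT : IsTriangulation Ω T) {s t : Finset (Pt d)} (hs : s ∈ T)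
    (ht : t ∈ T) {x : Pt d} (hxs : x ∈ interior (cell s)) (hxt : x ∈ cell t) : s = t :=
  Finset.eq_of_subset_of_card_le
    (hT.subset_of_coord_pos hs ht le_rfl (interior_subset hxs) hxt
      ((hT.isSimplex hs).mem_interior_cell_iff.1 hxs))
    (by rw [hT.card_eq s hs, hT.card_eq t ht])

open Classical in
-- Off the faces of codimension at least two, distinct simplices can meet only in a common facet.
theorem card_inter_eq (hT : IsTriangulation Ω T) {s t : Finset (Pt d)} (hs : s ∈ T) (ht : t ∈ T)
    (hst : s ≠ t) {x : Pt d} (hxs : x ∈ cell s) (hxt : x ∈ cell t)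
    (hx : ∀ r ∈ lowFaces T, x ∉ cell r) : (s ∩ t).card = d := by
  have h1 : d ≤ (s ∩ t).card := by
    by_contra! h
    exact hx _ (mem_lowFaces hs Finset.inter_subset_left h) (hT.mem_cell_inter hs ht hxs hxt)
  have h2 : (s ∩ t).card < s.card := by
    refine Finset.card_lt_card (Finset.ssubset_iff_subset_ne.2 ⟨Finset.inter_subset_left, ?_⟩)
    intro he
    exact hst (Finset.eq_of_subset_of_card_le (Finset.inter_eq_left.1 he)
      (by rw [hT.card_eq s hs, hT.card_eq t ht]))
  rw [hT.card_eq s hs] at h2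
  omega

open Filter Topology in
/-- The simplices that meet a convex open set are joined by chains of simplices sharing facets. -/
theorem reachable_of_convex (hT : IsTriangulation Ω T) {V : Set (Pt d)} (hV : Convex ℝ V)
    (hVo : IsOpen V) (hVT : V ⊆ ⋃ s ∈ T, cell s) {R : Finset (Finset (Pt d))}
    (hRT : R ⊆ T) (hR : ∀ t ∈ T, (cell t ∩ V).Nonempty → t ∈ R) {s t : Finset (Pt d)}
    (hs : s ∈ T) (ht : t ∈ T)
    (hsV : (cell s ∩ V).Nonempty) (htV : (cell t ∩ V).Nonempty) :
    (faceGraph R).Reachable s t := by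
  classical
  have hint : ∀ {u : Finset (Pt d)}, u ∈ T → (cell u ∩ V).Nonempty →
      (interior (cell u) ∩ V).Nonempty := by
    rintro u hu ⟨x, hx, hxV⟩
    rw [← (hT.isSimplex hu).closure_interior] at hx
    obtain ⟨y, hyV, hy⟩ := mem_closure_iff.1 hx V hVo hxV
    exact ⟨y, hy, hyV⟩
  obtain ⟨x, hxs, hxV⟩ := hint hs hsV
  -- Since `y` avoids the affine hulls of `x` with the low dimensional faces, the segment from `x`
  -- to `y` meets no such face except possibly at `x` itself.
  obtain ⟨y, ⟨hyt, hyV⟩, hyg⟩ := exists_notMem_affineSpan (isOpen_interior.inter hVo) (hint ht htV)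
    (lowFaces T) (fun r hr => card_lt_of_mem_lowFaces hr) fun _ => x
  have hγV : ∀ u ∈ Icc (0 : ℝ) 1, x + u • (y - x) ∈ V := fun u hu =>
    hV.add_smul_sub_mem hxV hyV hu
  have hgen : ∀ u : ℝ, u ≠ 0 → ∀ r ∈ lowFaces T, x + u • (y - x) ∉ cell r := by
    intro u hu r hr hmem
    refine hyg r hr ?_
    have h1 : x + u • (y - x) ∈ affineSpan ℝ (insert x (r : Set (Pt d))) :=
      affineSpan_mono ℝ (subset_insert _ _) (cell_subset_affineSpan r hmem)
    have h2 : x ∈ affineSpan ℝ (insert x (r : Set (Pt d))) :=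
      subset_affineSpan ℝ _ (mem_insert _ _)
    have h3 := AffineSubspace.smul_vsub_vadd_mem _ u⁻¹ h1 h2 h2
    convert h3 using 1
    simp only [vsub_eq_sub, vadd_eq_add, add_sub_cancel_left, smul_smul, inv_mul_cancel₀ hu]
    module
  let R' := R.filter fun w => (faceGraph R).Reachable s w
  let P : Set ℝ := (fun u : ℝ => x + u • (y - x)) ⁻¹' ⋃ w ∈ R', cell w
  have hcont : Continuous fun u : ℝ => x + u • (y - x) := by fun_prop
  -- Continuous induction: the parameters at which the segment lies in a reachable simplex form a
  -- closed set, and this set contains a right neighbourhood of each of its points below one.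
  have hP : Icc (0 : ℝ) 1 ⊆ P := by
    refine IsClosed.Icc_subset_of_forall_mem_nhdsWithin
      (((isClosed_biUnion_cell R').preimage hcont).inter isClosed_Icc) ?_ ?_
    · refine mem_iUnion₂.2 ⟨s, Finset.mem_filter.2 ⟨hR s hs hsV, SimpleGraph.Reachable.refl _⟩, ?_⟩
      simpa using interior_subset hxs
    · rintro u ⟨huP, hu⟩
      obtain ⟨w, hw, hwu⟩ := mem_iUnion₂.1 huP
      have hwu : x + u • (y - x) ∈ cell w := hwu
      obtain ⟨hwR, hsw⟩ := Finset.mem_filter.1 hw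
      have hshift : ∀ a : ℝ, x + u • (y - x) + a • (y - x) = x + (u + a) • (y - x) := fun a => by
        module
      obtain ⟨m, hm, t₁, ht₁, hseg⟩ := exists_cell_of_segment (S := T) (x := x + u • (y - x))
        (w := y - x) (by
          refine Eventually.frequently ?_
          have h1 : ∀ᶠ a in 𝓝[>] (0 : ℝ), a < 1 - u :=
            nhdsWithin_le_nhds (eventually_lt_nhds (by linarith [hu.2]))
          filter_upwards [h1, self_mem_nhdsWithin] with a ha ha0
          have ha0 : 0 < a := ha0
          rw [hshift]
          exact hVT (hγV _ ⟨by linarith [hu.1], by linarith⟩))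
      have huV : x + u • (y - x) ∈ V := hγV u ⟨hu.1, hu.2.le⟩
      have hum : x + u • (y - x) ∈ cell m := by simpa using hseg 0 ⟨le_rfl, ht₁.le⟩
      have hmR : m ∈ R := hR m hm ⟨_, hum, huV⟩
      have hsm : (faceGraph R).Reachable s m := by
        by_cases hwm : w = m
        · exact hwm ▸ hsw
        -- At the start no change of simplex is possible, because `x` is interior to `s`.
        · have hu0 : u ≠ 0 := by
            rintro rfl
            rw [zero_smul, add_zero] at hwu hum
            exact hwm ((hT.eq_of_mem_interior hs (hRT hwR) hxs hwu).symm.trans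
              (hT.eq_of_mem_interior hs hm hxs hum))
          refine hsw.trans (SimpleGraph.Adj.reachable ⟨hwR, hmR, hwm, ?_⟩)
          convert hT.card_inter_eq (hRT hwR) hm hwm hwu hum (hgen u hu0)
      have h2 : ∀ᶠ a in 𝓝[>] u, a < u + t₁ :=
        nhdsWithin_le_nhds (eventually_lt_nhds (by linarith))
      filter_upwards [h2, self_mem_nhdsWithin] with a ha hau
      have hau : u < a := hau
      refine mem_iUnion₂.2 ⟨m, Finset.mem_filter.2 ⟨hmR, hsm⟩, ?_⟩
      have := hseg (a - u) ⟨by linarith, by linarith⟩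
      rwa [hshift, add_sub_cancel] at this
  obtain ⟨w, hw, hwy⟩ := mem_iUnion₂.1 (hP ⟨zero_le_one, le_rfl⟩)
  have hwy : x + (1 : ℝ) • (y - x) ∈ cell w := hwy
  obtain ⟨hwR, hsw⟩ := Finset.mem_filter.1 hw
  rw [one_smul, add_sub_cancel] at hwy
  rwa [hT.eq_of_mem_interior ht (hRT hwR) hyt hwy]

open Filter Topology in
/-- A ray that leaves the domain in general position does so through a boundary facet. -/
theorem exists_boundary_facet (hT : IsTriangulation Ω T) (hΩ : IsOpen Ω)
    (hreg : interior (closure Ω) ⊆ Ω) {A : Set (Pt d)} (hA : IsOpen A) (hAΩ : A ⊆ Ω)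
    {z w : Pt d} {η a Λ : ℝ} {γ : Pt d → ℝ} (hγc : Continuous γ)
    (hγ : ∀ x ∈ Metric.ball z η, x ∈ Ω ↔ 0 < γ x)
    (hγw : ∀ x, ∀ t : ℝ, 0 ≤ t → γ (x + t • w) ≤ γ x - t / 2) (hw : ‖w‖ ≤ 2)
    (hΛ : ∀ x, γ x ≤ Λ * dist x z) (hΛ0 : 0 ≤ Λ)
    (hAw : ∀ y ∈ A ∩ Metric.ball z η, ∀ t : ℝ, 0 ≤ t → y + t • w ∈ Metric.ball z η →
      y + t • w ∈ Ω → y + t • w ∈ A)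
    (ha : (1 + 4 * Λ) * a < η) (hne : (A ∩ Metric.ball z a).Nonempty) :
    ∃ (s : Finset (Pt d)) (hs : s ∈ T) (q : Pt d) (r : Finset (Pt d)), q ∈ cell s ∧
      q ∈ closure A ∧ dist q z ≤ (1 + 4 * Λ) * a ∧ r ⊆ s ∧ r.card = d ∧
      ∀ x ∈ cell r, (∀ y ∈ r, 0 < (hT.isSimplex hs).coord y x) → x ∈ frontier Ω := by
  classical
  -- A vertex of `r` translated by `w` adds the direction `w` to the affine hull of `r`. Avoiding
  -- these hulls means that the line through `y` in direction `w` misses all low dimensional faces.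
  obtain ⟨y, ⟨hyA, hya⟩, hyg⟩ := exists_notMem_affineSpan (hA.inter Metric.isOpen_ball) hne
    (lowFaces T) (fun r hr => card_lt_of_mem_lowFaces hr)
    fun r => if h : r.Nonempty then h.choose + w else 0
  have hya : dist y z < a := hya
  have ha0 : 0 < a := dist_nonneg.trans_lt hya
  have hyη : y ∈ Metric.ball z η := by
    rw [Metric.mem_ball]; nlinarith
  have hγy : 0 < γ y := (hγ y hyη).1 (hAΩ hyA)
  have hγy' : γ y ≤ Λ * a := (hΛ y).trans (by gcongr)
  have hball : ∀ t ∈ Icc (0 : ℝ) (2 * γ y), dist (y + t • w) z ≤ (1 + 4 * Λ) * a := by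
    intro t ht
    have h1 : dist (y + t • w) y ≤ t * 2 := by
      rw [dist_eq_norm, add_sub_cancel_left, norm_smul, Real.norm_of_nonneg ht.1]
      exact mul_le_mul_of_nonneg_left hw ht.1
    linarith [dist_triangle (y + t • w) y z, ht.2]
  have hballη : ∀ t ∈ Icc (0 : ℝ) (2 * γ y), y + t • w ∈ Metric.ball z η := fun t ht =>
    (hball t ht).trans_lt ha
  have hcont : Continuous fun t : ℝ => γ (y + t • w) := by fun_prop
  have hcomp : IsCompact (Icc (0 : ℝ) (2 * γ y) ∩ {t | γ (y + t • w) ≤ 0}) :=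
    isCompact_Icc.inter_right (isClosed_le hcont continuous_const)
  -- The first time at which `γ` is not positive; since `γ` decreases with slope at least one half,
  -- it comes no later than `2 * γ y`.
  obtain ⟨t, ⟨ht, hqγ⟩, hmin⟩ := hcomp.exists_isLeast
    ⟨2 * γ y, ⟨by linarith, le_rfl⟩, by
      have := hγw y (2 * γ y) (by linarith)
      simp only [mem_ofPred_eq]
      linarith⟩
  have hqγ : γ (y + t • w) ≤ 0 := hqγ
  have ht0 : 0 < t := by
    refine lt_of_le_of_ne ht.1 fun h => ?_
    rw [← h, zero_smul, add_zero] at hqγ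
    exact absurd hqγ (not_le.2 hγy)
  set q := y + t • w with hq
  have hqΩ : q ∉ Ω := fun h => absurd ((hγ q (hballη t ht)).1 h) (not_lt.2 hqγ)
  have hqA : q ∈ closure A := by
    have htend : Tendsto (fun u : ℝ => y + u • w) (𝓝[<] t) (𝓝 q) := by
      have : Continuous fun u : ℝ => y + u • w := by fun_prop
      exact (this.tendsto t).mono_left nhdsWithin_le_nhds
    refine mem_closure_of_tendsto htend ?_
    have h1 : ∀ᶠ u in 𝓝[<] t, 0 < u := nhdsWithin_le_nhds (eventually_gt_nhds ht0)
    filter_upwards [h1, self_mem_nhdsWithin] with u hu hut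
    have hut : u < t := hut
    have hu' : u ∈ Icc (0 : ℝ) (2 * γ y) := ⟨hu.le, hut.le.trans ht.2⟩
    refine hAw y ⟨hyA, hyη⟩ u hu.le (hballη u hu') ((hγ _ (hballη u hu')).2 ?_)
    by_contra! h
    exact absurd (hmin ⟨hu', h⟩) (not_le.2 hut)
  have hqc : q ∈ ⋃ s ∈ T, cell s := by
    rw [hT.cover]; exact closure_mono hAΩ hqA
  obtain ⟨s, hs, hqs⟩ := mem_iUnion₂.1 hqc
  have hqg : ∀ r ∈ lowFaces T, q ∉ cell r := by
    intro r hr hqr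
    have hne : r.Nonempty := by
      rw [Finset.nonempty_iff_ne_empty]
      rintro rfl
      simp [cell] at hqr
    refine hyg r hr ?_
    rw [dif_pos hne]
    have h1 : q ∈ affineSpan ℝ (insert (hne.choose + w) (r : Set (Pt d))) :=
      affineSpan_mono ℝ (subset_insert _ _) (cell_subset_affineSpan r hqr)
    have h2 : hne.choose + w ∈ affineSpan ℝ (insert (hne.choose + w) (r : Set (Pt d))) :=
      subset_affineSpan ℝ _ (mem_insert _ _)
    have h3 : hne.choose ∈ affineSpan ℝ (insert (hne.choose + w) (r : Set (Pt d))) :=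
      subset_affineSpan ℝ _ (mem_insert_of_mem _ hne.choose_spec)
    have h4 := AffineSubspace.smul_vsub_vadd_mem _ (-t) h2 h3 h1
    convert h4 using 1
    simp only [vsub_eq_sub, vadd_eq_add, add_sub_cancel_left, hq]
    module
  have H := hT.isSimplex hs
  -- The carrier face of `q`. It has at least `d` vertices by general position, and not all `d + 1`,
  -- since otherwise `q` would be an interior point of the simplex and hence lie in `Ω`.
  set r := s.filter fun y => 0 < H.coord y q with hr
  have hrs : r ⊆ s := Finset.filter_subset _ _
  have hrpos : ∀ y ∈ r, 0 < H.coord y q := fun y hy => (Finset.mem_filter.1 hy).2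
  have hqr : q ∈ cell r := (H.mem_face_iff hrs).2 ⟨hqs, fun y hy hyr =>
    le_antisymm (not_lt.1 fun h => hyr (Finset.mem_filter.2 ⟨hy, h⟩)) (H.coord_nonneg hqs y)⟩
  have hsub : ∀ u ∈ T, cell u ⊆ closure Ω := fun u hu => by
    rw [← hT.cover]; exact subset_biUnion_of_mem (u := fun s => cell s) hu
  have hrc : r.card = d := by
    have h1 : d ≤ r.card := by
      by_contra! h
      exact hqg r (mem_lowFaces hs hrs h) hqr
    have h2 : r.card < s.card := by
      refine Finset.card_lt_card (Finset.ssubset_iff_subset_ne.2 ⟨hrs, fun he => hqΩ ?_⟩)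
      refine hreg (interior_mono (hsub s hs) (H.mem_interior_cell_iff.2 fun y hy => ?_))
      exact hrpos y (he ▸ hy)
    rw [hT.card_eq s hs] at h2
    omega
  -- A second simplex at `q` would share the facet and lie on its other side. The two would cover a
  -- neighbourhood of `q`, which would put `q` into `Ω`.
  have huniq : ∀ u ∈ T, q ∈ cell u → u = s := by
    intro u hu hqu
    by_contra hus
    have Hu := hT.isSimplex hu
    have hc : (s ∩ u).card = d := hT.card_inter_eq hs hu (Ne.symm hus) hqs hqu hqg
    have hre : r = s ∩ u := Finset.eq_of_subset_of_card_le
      (Finset.subset_inter hrs (hT.subset_of_coord_pos hs hu hrs hqs hqu hrpos)) (by rw [hc, hrc])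
    rw [hre] at hrpos hqr
    obtain ⟨o, ho, hso⟩ := H.exists_eq_insert Finset.inter_subset_left hc
    obtain ⟨o', ho', huo⟩ := Hu.exists_eq_insert Finset.inter_subset_right hc
    obtain ⟨c, hcneg, hlin⟩ := H.exists_coord_eq_neg_mul Hu
      (fun x hx => hT.mem_cell_inter hs hu hx.1 hx.2) ho hso ho' huo hqr hrpos
    have hev : ∀ᶠ x in 𝓝 q, (∀ y ∈ s ∩ u, 0 < H.coord y x) ∧ ∀ y ∈ s ∩ u, 0 < Hu.coord y x := by
      refine Filter.Eventually.and ?_ ?_ <;>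
        refine (Filter.eventually_all_finset _).2 fun y hy => ?_
      · exact ((H.continuous_coord y).tendsto q).eventually_const_lt (hrpos y hy)
      · refine ((Hu.continuous_coord y).tendsto q).eventually_const_lt ?_
        rw [← H.coord_eq_coord Hu Finset.inter_subset_left Finset.inter_subset_right hqr hy]
        exact hrpos y hy
    refine hqΩ (hreg (mem_interior_iff_mem_nhds.2 (hev.mono fun x hx => ?_)))
    rcases le_total 0 (H.coord o x) with h0 | h0
    · exact hsub s hs (H.mem_cell_of_insert hso h0 fun y hy => (hx.1 y hy).le)
    · refine hsub u hu (Hu.mem_cell_of_insert huo ?_ fun y hy => (hx.2 y hy).le)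
      rw [hlin]; exact mul_nonneg_of_nonpos_of_nonpos hcneg.le h0
  refine ⟨s, hs, q, r, hqs, hqA, hball t ht, hrs, hrc, fun x hxr hxpos => ?_⟩
  have hxs := ((H.mem_face_iff hrs).1 hxr)
  rw [hΩ.frontier_eq]
  refine ⟨hsub s hs hxs.1, fun hxΩ => ?_⟩
  obtain ⟨o, ho, hso⟩ := H.exists_eq_insert hrs hrc
  have hos : o ∈ s := hso ▸ Finset.mem_insert_self _ _
  -- If `x` were in `Ω`, a short move away from the opposite vertex `o` would stay in a simplex that
  -- contains `x`, hence `r`, hence `q`. This simplex is `s`, but the coordinate of `o` becomes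
  -- negative.
  obtain ⟨u, hu, t₁, ht₁, hseg⟩ := exists_cell_of_segment (S := T) (x := x) (w := x - o) (by
    refine Eventually.frequently ?_
    have hc : Continuous fun a : ℝ => x + a • (x - o) := by fun_prop
    have h1 : ∀ᶠ a in 𝓝 (0 : ℝ), x + a • (x - o) ∈ Ω :=
      (hc.tendsto 0).eventually (hΩ.mem_nhds (by simpa using hxΩ))
    filter_upwards [nhdsWithin_le_nhds h1] with a ha
    rw [hT.cover]; exact subset_closure ha)
  have hxu : x ∈ cell u := by simpa using hseg 0 ⟨le_rfl, ht₁.le⟩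
  have hru : r ⊆ u := hT.subset_of_coord_pos hs hu hrs hxs.1 hxu hxpos
  have hqu : q ∈ cell u := convexHull_mono (by exact_mod_cast hru) hqr
  have hus := huniq u hu hqu
  subst hus
  have h1 := H.coord_nonneg (hseg t₁ ⟨ht₁.le, le_rfl⟩) o
  rw [H.coord_add, inner_smul_right, ← H.coord_sub, H.coord_vertex hos hos, hxs.2 o hos ho] at h1
  simp at h1
  linarith

end IsTriangulation

/-! ### Cones of directions and chains of simplices. -/

/-- Near `B`, the set `A` is invariant under translations in all directions `ε`-close to `m`. -/
def ConeInvariant {d : ℕ} (A B : Set (Pt d)) (m : Pt d) (ε : ℝ) : Prop :=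
  ∀ y ∈ A ∩ B, ∀ b : Pt d, ‖b - m‖ ≤ ε → ∀ t : ℝ, 0 ≤ t → y + t • b ∈ B → y + t • b ∈ A

theorem ConeInvariant.mono {d : ℕ} {A B B' : Set (Pt d)} {m : Pt d} {ε ε' : ℝ}
    (h : ConeInvariant A B m ε) (hB : B' ⊆ B) (hε : ε' ≤ ε) : ConeInvariant A B' m ε' :=
  fun y hy b hb t ht hyt => h y ⟨hy.1, hB hy.2⟩ b (hb.trans hε) t ht (hB hyt)

/-- The open truncated cone with vertex `p`, axis `m`, opening `ε` and height `ℓ`. -/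
def truncatedCone {d : ℕ} (p m : Pt d) (ε ℓ : ℝ) : Set (Pt d) :=
  {y | ∃ t ∈ Ioo 0 ℓ, ‖y - p - t • m‖ < ε * t}

theorem isOpen_truncatedCone {d : ℕ} (p m : Pt d) (ε ℓ : ℝ) :
    IsOpen (truncatedCone p m ε ℓ) := by
  have : truncatedCone p m ε ℓ = ⋃ t ∈ Ioo 0 ℓ, {y | ‖y - p - t • m‖ < ε * t} := by
    ext y; simp [truncatedCone]
  rw [this]
  exact isOpen_biUnion fun t _ => isOpen_lt (by fun_prop) continuous_const

theorem convex_truncatedCone {d : ℕ} (p m : Pt d) (ε ℓ : ℝ) :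
    Convex ℝ (truncatedCone p m ε ℓ) := by
  rintro y ⟨t, ht, hy⟩ y' ⟨t', ht', hy'⟩ a b ha hb hab
  refine ⟨a * t + b * t', (convex_Ioo 0 ℓ) ht ht' ha hb hab, ?_⟩
  have h1 : a • y + b • y' - p - (a * t + b * t') • m =
      a • (y - p - t • m) + b • (y' - p - t' • m) := by
    have : p = a • p + b • p := by rw [← add_smul, hab, one_smul]
    nth_rw 1 [this]
    module
  rw [h1]
  refine (norm_add_le _ _).trans_lt ?_
  rw [norm_smul, norm_smul, Real.norm_of_nonneg ha, Real.norm_of_nonneg hb]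
  rcases ha.eq_or_lt with rfl | ha'
  · obtain rfl : b = 1 := by linarith
    simpa using hy'
  · nlinarith [mul_lt_mul_of_pos_left hy ha', mul_le_mul_of_nonneg_left hy'.le hb]

namespace ConeInvariant

variable {d : ℕ} {A : Set (Pt d)} {z m : Pt d} {η ε δ ℓ : ℝ}

/-- A nearly closest point of `A` is translated along with `x`; so the `δ`-neighbourhood inherits
the invariance. -/
theorem infDist_le (hA : ConeInvariant A (Metric.ball z η) m ε) (hne : A.Nonempty)
    {x b : Pt d} {t : ℝ} (hx : Metric.infDist x A ≤ δ) (hb : ‖b - m‖ ≤ ε) (ht : 0 ≤ t)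
    (hfit : dist x z + δ + t * ‖b‖ < η) : Metric.infDist (x + t • b) A ≤ δ := by
  refine le_of_forall_pos_lt_add fun μ hμ => ?_
  set μ' := min μ ((η - (dist x z + δ + t * ‖b‖)) / 2)
  have h1 : μ' ≤ μ := min_le_left _ _
  have h2 : μ' ≤ (η - (dist x z + δ + t * ‖b‖)) / 2 := min_le_right _ _
  have h3 : 0 < μ' := lt_min hμ (by linarith)
  obtain ⟨y, hyA, hy⟩ := (Metric.infDist_lt_iff hne (r := δ + μ')).1 (by linarith)
  have h4 : dist y z < dist x z + δ + μ' := by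
    linarith [dist_triangle y x z, dist_comm x y]
  have h5 : dist (y + t • b) y = t * ‖b‖ := by
    rw [dist_eq_norm, add_sub_cancel_left, norm_smul, Real.norm_of_nonneg ht]
  have h6 : 0 ≤ t * ‖b‖ := by positivity
  refine (Metric.infDist_le_dist_of_mem (hA y ⟨hyA, ?_⟩ b hb t ht ?_)).trans_lt ?_
  · rw [Metric.mem_ball]; linarith
  · rw [Metric.mem_ball]; linarith [dist_triangle (y + t • b) y z]
  · rw [dist_add_right]; linarith

variable {Ω : Set (Pt d)} {T : Finset (Finset (Pt d))}

open Filter Topology in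
-- The point `x` may lie on the boundary of `Ω`, so the vertex `p` of the cone is moved into the
-- interior of `s`, which lies in `Ω`. Simplices that meet the cone near its vertex contain `x` and
-- are active for that reason. Farther out, points of the cone are reached from `x` in directions `2
-- * ε`-close to `m`, because the shift from `x` to `p` is shorter than `ε * t₀`; this is the use of
-- the doubled opening.
theorem exists_truncatedCone (hT : IsTriangulation Ω T) (hreg : interior (closure Ω) ⊆ Ω)
    (hΩ : ConeInvariant Ω (Metric.ball z η) m (2 * ε))
    (hA : ConeInvariant A (Metric.ball z η) m (2 * ε)) (hne : A.Nonempty)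
    (hm : ‖m‖ ≤ 2) (hε : 0 < ε) (hε1 : ε ≤ 1) (hδ : 0 ≤ δ) {s : Finset (Pt d)} (hs : s ∈ T)
    {x : Pt d}
    (hx : x ∈ cell s) (hxA : Metric.infDist x A ≤ δ) (hℓ : 0 < ℓ)
    (hfit : dist x z + δ + 4 * ℓ < η) {μ : ℝ} (hμ : 0 < μ) :
    ∃ p ∈ interior (cell s), dist p x < μ ∧ truncatedCone p m ε ℓ ⊆ Ω ∧
      ∀ t ∈ T, (cell t ∩ truncatedCone p m ε ℓ).Nonempty →
        t ∈ activeCells T A δ ∧ ∃ q ∈ cell t, dist q x ≤ 4 * ℓ := by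
  classical
  -- Sufficiently close to `x` there are only simplices that contain `x`.
  have hnhds : ∀ᶠ y in 𝓝 x, y ∉ ⋃ t ∈ T.filter fun t => x ∉ cell t, cell t := by
    refine (isClosed_biUnion_cell _).isOpen_compl.mem_nhds ?_
    simp +contextual
  obtain ⟨r, hr, hball⟩ := Metric.eventually_nhds_iff.1 hnhds
  set t₀ := min (r / 4) (min (μ / 2) (ℓ / 2))
  have ht₀ : 0 < t₀ := by positivity
  have htr : t₀ ≤ r / 4 := min_le_left _ _
  have htμ : t₀ ≤ μ / 2 := (min_le_right _ _).trans (min_le_left _ _)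
  have htℓ : t₀ ≤ ℓ / 2 := (min_le_right _ _).trans (min_le_right _ _)
  have hεt : ε * t₀ ≤ t₀ := by nlinarith
  have hcl : x ∈ closure (interior (cell s)) := by
    rwa [(hT.isSimplex hs).closure_interior]
  obtain ⟨p, hp, hpx⟩ := Metric.mem_closure_iff.1 hcl (ε * t₀) (by positivity)
  rw [dist_comm] at hpx
  have hpΩ : p ∈ Ω := hreg (interior_mono (by
    rw [← hT.cover]; exact subset_biUnion_of_mem (u := fun s => cell s) hs) hp)
  have hb : ∀ b : Pt d, ‖b - m‖ ≤ 2 * ε → ‖b‖ ≤ 4 := fun b hb => by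
    linarith [norm_le_norm_add_norm_sub' b m, norm_le_norm_add_norm_sub m b]
  have hpz : dist p z < dist x z + ℓ / 2 := by linarith [dist_triangle p x z]
  refine ⟨p, hp, by linarith, ?_, ?_⟩
  · rintro y ⟨t, ht, hy⟩
    have ht0 : 0 < t := ht.1
    have hyb : y = p + t • (t⁻¹ • (y - p)) := by
      rw [smul_inv_smul₀ ht0.ne', add_sub_cancel]
    have hyp : ‖y - p‖ ≤ 3 * ℓ := by
      have h1 : ‖y - p‖ ≤ ‖y - p - t • m‖ + ‖t • m‖ := by
        simpa using norm_add_le (y - p - t • m) (t • m)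
      rw [norm_smul, Real.norm_of_nonneg ht0.le] at h1
      nlinarith [ht.2, mul_le_mul_of_nonneg_left hm ht0.le]
    rw [hyb]
    refine hΩ p ⟨hpΩ, ?_⟩ _ ?_ t ht0.le ?_
    · rw [Metric.mem_ball]; linarith
    · have h1 : t⁻¹ • (y - p) - m = t⁻¹ • (y - p - t • m) := by
        rw [smul_sub _ (y - p), inv_smul_smul₀ ht0.ne']
      rw [h1, norm_smul, norm_inv, Real.norm_of_nonneg ht0.le, inv_mul_le_iff₀ ht0]
      nlinarith
    · rw [← hyb, Metric.mem_ball]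
      rw [← dist_eq_norm] at hyp
      linarith [dist_triangle y p z]
  · rintro t ht ⟨y, hyt, u, hu, hy⟩
    have hu0 : 0 < u := hu.1
    rcases lt_or_ge u t₀ with h | h
    · have hyx : dist y x < r := by
        have h1 : ‖y - p‖ ≤ ‖y - p - u • m‖ + ‖u • m‖ := by
          simpa using norm_add_le (y - p - u • m) (u • m)
        rw [norm_smul, Real.norm_of_nonneg hu0.le, ← dist_eq_norm] at h1
        nlinarith [dist_triangle y p x, mul_le_mul_of_nonneg_left hm hu0.le]
      have hxt : x ∈ cell t := by
        by_contra hxt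
        exact hball hyx (mem_iUnion₂.2 ⟨t, Finset.mem_filter.2 ⟨ht, hxt⟩, hyt⟩)
      exact ⟨Finset.mem_filter.2 ⟨ht, x, hxt, hxA⟩, x, hxt, by rw [dist_self]; positivity⟩
    · set b := u⁻¹ • (y - x) with hbdef
      have hyb : y = x + u • b := by rw [hbdef, smul_inv_smul₀ hu0.ne', add_sub_cancel]
      have hbm : ‖b - m‖ ≤ 2 * ε := by
        have h1 : b - m = u⁻¹ • ((y - p - u • m) + (p - x)) := by
          rw [hbdef, show y - p - u • m + (p - x) = (y - x) - u • m by abel, smul_sub _ (y - x),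
            inv_smul_smul₀ hu0.ne']
        rw [h1, norm_smul, norm_inv, Real.norm_of_nonneg hu0.le, inv_mul_le_iff₀ hu0]
        rw [dist_eq_norm] at hpx
        nlinarith [norm_add_le (y - p - u • m) (p - x)]
      have hub : u * ‖b‖ ≤ 4 * ℓ := by nlinarith [hb b hbm, hu.2, norm_nonneg b]
      refine ⟨Finset.mem_filter.2 ⟨ht, y, hyt, ?_⟩, y, hyt, ?_⟩
      · rw [hyb]
        exact hA.infDist_le hne hxA hbm hu0.le (by linarith)
      · rwa [hyb, dist_eq_norm, add_sub_cancel_left, norm_smul, Real.norm_of_nonneg hu0.le]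

open Filter Topology in
/-- Two simplices that meet the neighbourhood of `A` in nearby points are joined by a chain of
simplices that share facets and meet the neighbourhood of `A`. -/
theorem reachable (hT : IsTriangulation Ω T) (hreg : interior (closure Ω) ⊆ Ω)
    (hΩ : ConeInvariant Ω (Metric.ball z η) m (2 * ε))
    (hA : ConeInvariant A (Metric.ball z η) m (2 * ε)) (hne : A.Nonempty)
    (hm : ‖m‖ ≤ 2) (hε : 0 < ε) (hε1 : ε ≤ 1) (hδ : 0 ≤ δ) {s s' : Finset (Pt d)} (hs : s ∈ T)
    (hs' : s' ∈ T) {x x' : Pt d} (hx : x ∈ cell s) (hx' : x' ∈ cell s')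
    (hxA : Metric.infDist x A ≤ δ) (hxA' : Metric.infDist x' A ≤ δ) (hxx : dist x x' < ε * ℓ)
    (hfit : dist x z + δ + 5 * ℓ < η) {R : Finset (Finset (Pt d))} (hRT : R ⊆ T)
    (hR : ∀ t ∈ activeCells T A δ, (∃ q ∈ cell t, dist q x ≤ 5 * ℓ) → t ∈ R) :
    (faceGraph R).Reachable s s' := by
  have hℓ : 0 < ℓ := by
    by_contra! h
    have := dist_nonneg.trans_lt hxx
    nlinarith
  have hxl : dist x x' < ℓ := by nlinarith
  have hμ : 0 < (ε * ℓ - dist x x') / 2 := by linarith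
  obtain ⟨p, hp, hpx, hpΩ, hpR⟩ := exists_truncatedCone hT hreg hΩ hA hne hm hε hε1 hδ hs hx hxA
    hℓ (by linarith) hμ
  obtain ⟨p', hp', hpx', hpΩ', hpR'⟩ := exists_truncatedCone hT hreg hΩ hA hne hm hε hε1 hδ hs'
    hx' hxA' hℓ (by linarith [dist_triangle x' x z, dist_comm x' x]) hμ
  have hmeet : ∀ {p : Pt d} {s : Finset (Pt d)}, p ∈ interior (cell s) →
      (cell s ∩ truncatedCone p m ε ℓ).Nonempty := by
    intro p s hp
    have hc : Continuous fun u : ℝ => p + u • m := by fun_prop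
    have h1 : ∀ᶠ u in 𝓝[>] (0 : ℝ), p + u • m ∈ interior (cell s) :=
      nhdsWithin_le_nhds <| (hc.tendsto 0).eventually (isOpen_interior.mem_nhds (by simpa using hp))
    have h2 : ∀ᶠ u in 𝓝[>] (0 : ℝ), u < ℓ := nhdsWithin_le_nhds (eventually_lt_nhds hℓ)
    obtain ⟨u, hu1, hu2, hu0⟩ :=
      (h1.and (h2.and self_mem_nhdsWithin)).exists
    have hu0 : 0 < u := hu0
    exact ⟨p + u • m, interior_subset hu1, u, ⟨hu0, hu2⟩, by simpa using by positivity⟩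
  have hpp : dist p p' < ε * ℓ := by
    linarith [dist_triangle p x p', dist_triangle x x' p', dist_comm p' x']
  -- Cones of the same axis and opening whose vertices are closer than `ε * ℓ` share the point `p +
  -- u • m`. A simplex that contains this point links the two chains.
  obtain ⟨u, hu, huℓ⟩ := exists_between ((div_lt_iff₀' hε).2 hpp)
  have hu0 : 0 < u := lt_of_le_of_lt (by positivity) hu
  have hy : p + u • m ∈ truncatedCone p m ε ℓ := ⟨u, ⟨hu0, huℓ⟩, by simpa using by positivity⟩
  have hy' : p + u • m ∈ truncatedCone p' m ε ℓ := ⟨u, ⟨hu0, huℓ⟩, by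
    rw [show p + u • m - p' - u • m = p - p' by abel, ← dist_eq_norm]
    rwa [div_lt_iff₀' hε] at hu⟩
  have hcov : Ω ⊆ ⋃ s ∈ T, cell s := by rw [hT.cover]; exact subset_closure
  obtain ⟨t, ht, hyt⟩ := mem_iUnion₂.1 (hcov (hpΩ hy))
  refine (hT.reachable_of_convex (convex_truncatedCone p m ε ℓ) (isOpen_truncatedCone p m ε ℓ)
    (hpΩ.trans hcov) hRT (fun t ht h => ?_) hs ht (hmeet hp) ⟨_, hyt, hy⟩).trans
    (hT.reachable_of_convex (convex_truncatedCone p' m ε ℓ) (isOpen_truncatedCone p' m ε ℓ)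
    (hpΩ'.trans hcov) hRT (fun t ht h => ?_) ht hs' ⟨_, hyt, hy'⟩ (hmeet hp'))
  · obtain ⟨h1, q, hq, hqx⟩ := hpR t ht h
    exact hR t h1 ⟨q, hq, by linarith⟩
  · obtain ⟨h1, q, hq, hqx⟩ := hpR' t ht h
    exact hR t h1 ⟨q, hq, by linarith [dist_triangle q x' x, dist_comm x x']⟩

end ConeInvariant

/-! ### Cones for Lipschitz graphs and for smooth level sets. -/

/-- Near `B`, the set `Ω` is the superlevel set of a function with slope one in the direction `e`
and Lipschitz constant `Λ`. -/
structure IsGraphFunction {d : ℕ} (Ω B : Set (Pt d)) (e : Pt d) (Λ : ℝ) (γ : Pt d → ℝ) :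
    Prop where
  norm_eq : ‖e‖ = 1
  lipschitz : ∀ x y, |γ x - γ y| ≤ Λ * dist x y
  add_smul : ∀ x, ∀ t : ℝ, γ (x + t • e) = γ x + t
  mem_iff : ∀ x ∈ B, x ∈ Ω ↔ 0 < γ x

theorem IsLipschitzGraphNear.exists_isGraphFunction {d : ℕ} {Ω : Set (Pt d)} {z e : Pt d}
    {L : ℝ≥0} (h : IsLipschitzGraphNear Ω z e L) :
    ∃ r > 0, ∃ γ, IsGraphFunction Ω (Metric.ball z r) e (1 + 2 * L) γ := by
  obtain ⟨he, r, hr, g, hg, hmem⟩ := h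
  refine ⟨r, hr, fun x => inner ℝ e x - g (x - (inner ℝ e x : ℝ) • e), he, fun x y => ?_,
    fun x t => ?_, fun x hx => (hmem x hx).trans sub_pos.symm⟩
  · have h1 : |inner ℝ e x - inner ℝ e y| ≤ dist x y := by
      rw [← inner_sub_right, dist_eq_norm]
      simpa [he] using abs_real_inner_le_norm e (x - y)
    have h2 := hg.dist_le_mul (x - (inner ℝ e x : ℝ) • e) (y - (inner ℝ e y : ℝ) • e)
    have h3 : dist (x - (inner ℝ e x : ℝ) • e) (y - (inner ℝ e y : ℝ) • e) ≤ 2 * dist x y := by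
      rw [dist_eq_norm, show x - (inner ℝ e x : ℝ) • e - (y - (inner ℝ e y : ℝ) • e) =
        (x - y) - ((inner ℝ e x : ℝ) - inner ℝ e y) • e by module]
      refine (norm_sub_le _ _).trans ?_
      rw [norm_smul, he, mul_one, Real.norm_eq_abs, ← dist_eq_norm]
      linarith
    rw [Real.dist_eq] at h2
    have h4 := mul_le_mul_of_nonneg_left h3 L.coe_nonneg
    calc _ = |(inner ℝ e x - inner ℝ e y) -
          (g (x - (inner ℝ e x : ℝ) • e) - g (y - (inner ℝ e y : ℝ) • e))| := by
          congr 1; ring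
      _ ≤ _ := (abs_sub _ _).trans (by linarith)
  · have h1 : (inner ℝ e (x + t • e) : ℝ) = inner ℝ e x + t := by
      rw [inner_add_right, inner_smul_right, real_inner_self_eq_norm_sq, he]; ring
    simp only [h1]
    rw [show x + t • e - (inner ℝ e x + t) • e = x - (inner ℝ e x : ℝ) • e by module]
    ring

namespace IsGraphFunction

variable {d : ℕ} {Ω B : Set (Pt d)} {e z : Pt d} {Λ r : ℝ} {γ : Pt d → ℝ}

theorem mono {B' : Set (Pt d)} (h : IsGraphFunction Ω B e Λ γ) (hB : B' ⊆ B) :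
    IsGraphFunction Ω B' e Λ γ :=
  ⟨h.norm_eq, h.lipschitz, h.add_smul, fun x hx => h.mem_iff x (hB hx)⟩

theorem continuous (h : IsGraphFunction Ω B e Λ γ) : Continuous γ := by
  refine (LipschitzWith.of_dist_le_mul (K := Λ.toNNReal) fun x y => ?_).continuous
  rw [Real.dist_eq]
  exact (h.lipschitz x y).trans (by gcongr; exact Real.le_coe_toNNReal Λ)

/-- In directions `b` close to `e` the function still grows with slope between `1 / 2` and `3 / 2`.
-/
theorem abs_add_smul_sub_le (h : IsGraphFunction Ω B e Λ γ) {b : Pt d}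
    (hb : ‖b - e‖ * Λ ≤ 1 / 2) (x : Pt d) {t : ℝ} (ht : 0 ≤ t) :
    |γ (x + t • b) - (γ x + t)| ≤ t / 2 := by
  rw [← h.add_smul]
  refine (h.lipschitz _ _).trans ?_
  rw [dist_eq_norm, add_sub_add_left_eq_sub, ← smul_sub, norm_smul, Real.norm_of_nonneg ht]
  nlinarith [mul_le_mul_of_nonneg_left hb ht]

theorem abs_sub_smul_sub_le (h : IsGraphFunction Ω B e Λ γ) {b : Pt d}
    (hb : ‖b - e‖ * Λ ≤ 1 / 2) (x : Pt d) {t : ℝ} (ht : 0 ≤ t) :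
    |γ (x - t • b) - (γ x - t)| ≤ t / 2 := by
  have h1 : γ x - t = γ (x - t • e) := by
    have := h.add_smul (x - t • e) t
    rw [sub_add_cancel] at this
    linarith
  rw [h1]
  refine (h.lipschitz _ _).trans ?_
  rw [dist_eq_norm, show x - t • b - (x - t • e) = (-t) • (b - e) by module, norm_smul, norm_neg,
    Real.norm_of_nonneg ht]
  nlinarith [mul_le_mul_of_nonneg_left hb ht]

theorem coneInvariant (h : IsGraphFunction Ω B e Λ γ) {m : Pt d} {ε : ℝ}
    (hm : ∀ b : Pt d, ‖b - m‖ ≤ ε → ‖b - e‖ * Λ ≤ 1 / 2) : ConeInvariant Ω B m ε := by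
  rintro y ⟨hyΩ, hyB⟩ b hb t ht hyt
  have h1 := (h.mem_iff y hyB).1 hyΩ
  have h2 := abs_le.1 (h.abs_add_smul_sub_le (hm b hb) y ht)
  exact (h.mem_iff _ hyt).2 (by linarith)

theorem apply_eq_zero (h : IsGraphFunction Ω B e Λ γ) (hΩ : IsOpen Ω) (hB : IsOpen B)
    (hz : z ∈ frontier Ω) (hzB : z ∈ B) : γ z = 0 := by
  rw [hΩ.frontier_eq] at hz
  refine le_antisymm (not_lt.1 fun h0 => hz.2 ((h.mem_iff z hzB).2 h0)) ?_
  by_contra! h0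
  obtain ⟨y, ⟨hy0, hyB⟩, hyΩ⟩ := mem_closure_iff.1 hz.1 ({y | γ y < 0} ∩ B)
    ((isOpen_lt h.continuous continuous_const).inter hB) ⟨h0, hzB⟩
  exact absurd ((h.mem_iff y hyB).1 hyΩ) (not_lt.2 (le_of_lt hy0))

end IsGraphFunction

open Filter Topology in
-- Below the graph, arbitrarily close to a boundary point, there are points outside the closure of
-- `Ω`. Hence the interior of any union of simplices is contained in `Ω`.
theorem IsBoundedLipschitzDomain.interior_closure_subset {d : ℕ} {Ω : Set (Pt d)}
    (hΩ : IsBoundedLipschitzDomain Ω) : interior (closure Ω) ⊆ Ω := by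
  intro x hx
  by_contra hxΩ
  have hxf : x ∈ frontier Ω := by
    rw [hΩ.isOpen.frontier_eq]; exact ⟨interior_subset hx, hxΩ⟩
  obtain ⟨e, L, hL⟩ := hΩ.lipschitz x hxf
  obtain ⟨r, hr, γ, hγ⟩ := hL.exists_isGraphFunction
  have h0 := hγ.apply_eq_zero hΩ.isOpen Metric.isOpen_ball hxf (Metric.mem_ball_self hr)
  have hc : Continuous fun t : ℝ => x + t • e := by fun_prop
  have h1 : ∀ᶠ t in 𝓝[<] (0 : ℝ), x + t • e ∈ interior (closure Ω) ∩ Metric.ball x r :=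
    nhdsWithin_le_nhds <| (hc.tendsto 0).eventually <|
      (isOpen_interior.inter Metric.isOpen_ball).mem_nhds (by simpa using ⟨hx, hr⟩)
  obtain ⟨t, ⟨ht1, ht2⟩, ht⟩ := (h1.and self_mem_nhdsWithin).exists
  have ht : t < 0 := ht
  obtain ⟨y, ⟨hy0, hyB⟩, hyΩ⟩ := mem_closure_iff.1 (interior_subset ht1)
    ({y | γ y < 0} ∩ Metric.ball x r)
    ((isOpen_lt hγ.continuous continuous_const).inter Metric.isOpen_ball)
    ⟨by simpa only [mem_ofPred_eq, hγ.add_smul, h0, zero_add] using ht, ht2⟩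
  exact absurd ((hγ.mem_iff y hyB).1 hyΩ) (not_lt.2 (le_of_lt hy0))

/-- In `B`, the sets `Ω` and `A` contain cones of opening `ε`, and near the boundary of `Ω` there
is a direction in which one leaves `Ω` without leaving `A` before. -/
structure IsConical {d : ℕ} (Ω A B : Set (Pt d)) (ε Λ : ℝ) : Prop where
  cone : ∃ m : Pt d, ‖m‖ ≤ 2 ∧ ConeInvariant Ω B m (2 * ε) ∧ ConeInvariant A B m (2 * ε)
  exit : (frontier Ω ∩ B).Nonempty → ∃ (w : Pt d) (γ : Pt d → ℝ), ‖w‖ ≤ 2 ∧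
    (∀ x y, |γ x - γ y| ≤ Λ * dist x y) ∧ (∀ x ∈ B, x ∈ Ω ↔ 0 < γ x) ∧
    (∀ x, ∀ t : ℝ, 0 ≤ t → γ (x + t • w) ≤ γ x - t / 2) ∧
    ∀ y ∈ A ∩ B, ∀ t : ℝ, 0 ≤ t → y + t • w ∈ B → y + t • w ∈ Ω → y + t • w ∈ A

theorem IsConical.mono {d : ℕ} {Ω A B B' : Set (Pt d)} {ε Λ : ℝ} (h : IsConical Ω A B ε Λ)
    (hB : B' ⊆ B) : IsConical Ω A B' ε Λ where
  cone := by
    obtain ⟨m, hm, h1, h2⟩ := h.cone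
    exact ⟨m, hm, h1.mono hB le_rfl, h2.mono hB le_rfl⟩
  exit := fun hne => by
    obtain ⟨w, γ, hw, h1, h2, h3, h4⟩ := h.exit (hne.mono (by gcongr))
    exact ⟨w, γ, hw, h1, fun x hx => h2 x (hB hx), h3,
      fun y hy t ht hyt => h4 y ⟨hy.1, hB hy.2⟩ t ht (hB hyt)⟩

theorem IsConical.congr {d : ℕ} {Ω A A' B : Set (Pt d)} {ε Λ : ℝ} (h : IsConical Ω A B ε Λ)
    (hA : ∀ x ∈ B, x ∈ A ↔ x ∈ A') : IsConical Ω A' B ε Λ where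
  cone := by
    obtain ⟨m, hm, h1, h2⟩ := h.cone
    exact ⟨m, hm, h1, fun y hy b hb t ht hyt =>
      (hA _ hyt).1 (h2 y ⟨(hA y hy.2).2 hy.1, hy.2⟩ b hb t ht hyt)⟩
  exit := fun hne => by
    obtain ⟨w, γ, hw, h1, h2, h3, h4⟩ := h.exit hne
    exact ⟨w, γ, hw, h1, h2, h3, fun y hy t ht hyt hytΩ =>
      (hA _ hyt).1 (h4 y ⟨(hA y hy.2).2 hy.1, hy.2⟩ t ht hyt hytΩ)⟩

/-- Inside `Ω` the cone conditions are empty, so that even the axis zero is admissible. -/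
theorem isConical_of_subset {d : ℕ} {Ω B : Set (Pt d)} (hΩ : IsOpen Ω) (hB : B ⊆ Ω) (ε Λ : ℝ) :
    IsConical Ω Ω B ε Λ where
  cone := ⟨0, by simp, fun _ _ _ _ _ _ hy => hB hy, fun _ _ _ _ _ _ hy => hB hy⟩
  exit := by
    rintro ⟨x, hx, hxB⟩
    rw [hΩ.frontier_eq] at hx
    exact absurd (hB hxB) hx.2

theorem IsGraphFunction.isConical {d : ℕ} {Ω B : Set (Pt d)} {e : Pt d} {Λ : ℝ} {γ : Pt d → ℝ}
    (h : IsGraphFunction Ω B e Λ γ) (hΛ : 0 < Λ) : IsConical Ω Ω B (1 / (4 * Λ)) Λ where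
  cone := by
    have : ConeInvariant Ω B e (2 * (1 / (4 * Λ))) := h.coneInvariant fun b hb => by
      calc ‖b - e‖ * Λ ≤ 2 * (1 / (4 * Λ)) * Λ := by gcongr
        _ = 1 / 2 := by field_simp; norm_num
    exact ⟨e, by rw [h.norm_eq]; norm_num, this, this⟩
  exit := fun _ => by
    refine ⟨-e, γ, by rw [norm_neg, h.norm_eq]; norm_num, h.lipschitz, h.mem_iff,
      fun x t ht => ?_, fun y _ t _ _ hyt => hyt⟩
    have h1 := abs_le.1 (h.abs_sub_smul_sub_le (b := e) (by simp) x ht)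
    rw [smul_neg, ← sub_eq_add_neg]
    linarith

open Filter Topology in
-- Strict differentiability makes the increment estimate uniform in the base point. The radius
-- absorbs the shape of the interface.
theorem exists_linear_approx {d : ℕ} {ψ : Pt d → ℝ} {f : Pt d →L[ℝ] ℝ} {z : Pt d}
    (h : HasStrictFDerivAt ψ f z) {c : ℝ} (hc : 0 < c) :
    ∃ r > 0, ∀ x ∈ Metric.ball z r, ∀ b : Pt d, ∀ t : ℝ, 0 ≤ t → x + t • b ∈ Metric.ball z r →
      ψ x + t * (f b - c * ‖b‖) ≤ ψ (x + t • b) := by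
  have h1 := h.isLittleO.def hc
  obtain ⟨r, hr, hball⟩ := Metric.eventually_nhds_iff.1 h1
  refine ⟨r, hr, fun x hx b t ht hxt => ?_⟩
  have h2 := hball (y := (x + t • b, x)) (by
    rw [Prod.dist_eq]; exact max_lt hxt hx)
  simp only [add_sub_cancel_left, map_smul, smul_eq_mul, norm_smul, Real.norm_of_nonneg ht,
    Real.norm_eq_abs] at h2
  have := (abs_le.1 h2).1
  linarith

theorem exists_unit_normal {d : ℕ} {f : Pt d →L[ℝ] ℝ} (hf : f ≠ 0) :
    ∃ n : Pt d, ‖n‖ = 1 ∧ ∀ v, f v = ‖f‖ * inner ℝ n v := by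
  set G := (InnerProductSpace.toDual ℝ (Pt d)).symm f with hG
  have h1 : ‖G‖ = ‖f‖ := LinearIsometryEquiv.norm_map _ _
  have h2 : ‖f‖ ≠ 0 := norm_ne_zero_iff.2 hf
  refine ⟨‖f‖⁻¹ • G, ?_, fun v => ?_⟩
  · rw [norm_smul, norm_inv, norm_norm, h1, inv_mul_cancel₀ h2]
  · rw [inner_smul_left, hG, InnerProductSpace.toDual_symm_apply]
    simp [mul_inv_cancel_left₀ h2]

/-- The axis is the unit normal. Directions within `1 / 6` of it increase the linear part at rate at
least `5 / 6` of the norm of `f`, while the error takes at most a quarter. -/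
theorem IsConical.of_levelSet_interior {d : ℕ} {Ω A : Set (Pt d)} {z : Pt d} {R ε : ℝ}
    (hΩ : IsOpen Ω) (hR : 0 < R) (hB : Metric.ball z R ⊆ Ω) {ψ : Pt d → ℝ} {f : Pt d →L[ℝ] ℝ}
    (hψ : HasStrictFDerivAt ψ f z) (hf : f ≠ 0)
    (hA : ∀ x ∈ Ω ∩ Metric.ball z R, x ∈ A ↔ 0 < ψ x) (hε : ε ≤ 1 / 12) (Λ : ℝ) :
    ∃ r > 0, IsConical Ω A (Metric.ball z r) ε Λ := by
  obtain ⟨n, hn, hfn⟩ := exists_unit_normal hf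
  have hf0 : 0 < ‖f‖ := norm_pos_iff.2 hf
  obtain ⟨r, hr, hlin⟩ := exists_linear_approx hψ (c := ‖f‖ / 8) (by positivity)
  have hsub : Metric.ball z (min r R) ⊆ Ω :=
    (Metric.ball_subset_ball (min_le_right _ _)).trans hB
  have hsr : Metric.ball z (min r R) ⊆ Metric.ball z r := Metric.ball_subset_ball (min_le_left _ _)
  have hsR : Metric.ball z (min r R) ⊆ Metric.ball z R :=
    Metric.ball_subset_ball (min_le_right _ _)
  refine ⟨min r R, lt_min hr hR, ⟨n, by rw [hn]; norm_num, fun y hy b hb t ht hyt => hsub hyt,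
    fun y hy b hb t ht hyt => ?_⟩, fun hne => ((isConical_of_subset hΩ hsub ε Λ).exit hne).elim
      fun _ ⟨_, h⟩ => ?_⟩
  · refine (hA _ ⟨hsub hyt, hsR hyt⟩).2 ?_
    have h1 := (hA y ⟨hsub hy.2, hsR hy.2⟩).1 hy.1
    have h2 := hlin y (hsr hy.2) b t ht (hsr hyt)
    have h3 : ‖b‖ ≤ 2 := by linarith [norm_le_norm_add_norm_sub' b n]
    have h4 : (inner ℝ n b : ℝ) = 1 + inner ℝ n (b - n) := by
      rw [inner_sub_right, real_inner_self_eq_norm_sq, hn]; ring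
    have h5 := abs_le.1 (((abs_real_inner_le_norm n (b - n)).trans_eq
      (by rw [hn, one_mul])).trans hb)
    rw [hfn, h4] at h2
    have h6 : 0 ≤ ‖f‖ * (1 + inner ℝ n (b - n)) - ‖f‖ / 8 * ‖b‖ := by nlinarith
    nlinarith [mul_nonneg ht h6]
  · obtain ⟨x, hx, hxB⟩ := hne
    rw [hΩ.frontier_eq] at hx
    exact absurd (hsub hxB) hx.2

/-- Transversality makes `e` and the normal `n` orthogonal, so the two requirements decouple. The
axis `e + a • n` enters `Ω` through `e` and `A` through `n`; the exit direction `-e + a • n` leaves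
`Ω` and still increases the level set function. -/
theorem IsConical.of_levelSet_boundary {d : ℕ} {Ω A : Set (Pt d)} {z e : Pt d} {R Λ : ℝ}
    (hR : 0 < R) {γ : Pt d → ℝ} (hγ : IsGraphFunction Ω (Metric.ball z R) e Λ γ) (hΛ : 1 ≤ Λ)
    {ψ : Pt d → ℝ} {f : Pt d →L[ℝ] ℝ} (hψ : HasStrictFDerivAt ψ f z) (hf : f ≠ 0)
    (hfe : f e = 0) (hAΩ : A ⊆ Ω) (hA : ∀ x ∈ Ω ∩ Metric.ball z R, x ∈ A ↔ 0 < ψ x) :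
    ∃ r > 0, IsConical Ω A (Metric.ball z r) (1 / (12 * Λ)) Λ := by
  obtain ⟨n, hn, hfn⟩ := exists_unit_normal hf
  have hf0 : 0 < ‖f‖ := norm_pos_iff.2 hf
  have hΛ0 : 0 < Λ := by linarith
  -- Directions within `a / 2` of the axis deviate from `e` by at most `3 / 2 * a`, and `3 / 2 * a *
  -- Λ` is exactly the admissible `1 / 2`.
  set a := 1 / (3 * Λ) with ha
  have ha0 : 0 < a := by positivity
  have haΛ : a * Λ = 1 / 3 := by rw [ha]; field_simp
  have ha1 : a ≤ 1 / 3 := by nlinarith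
  have hε : 2 * (1 / (12 * Λ)) = a / 2 := by rw [ha]; field_simp; norm_num
  obtain ⟨r, hr, hlin⟩ := exists_linear_approx hψ (c := ‖f‖ * a / 12) (by positivity)
  have hsr : Metric.ball z (min r R) ⊆ Metric.ball z r := Metric.ball_subset_ball (min_le_left _ _)
  have hsR : Metric.ball z (min r R) ⊆ Metric.ball z R :=
    Metric.ball_subset_ball (min_le_right _ _)
  have hγ' := hγ.mono hsR
  have hne : (inner ℝ n e : ℝ) = 0 := by
    rw [hfn] at hfe; exact (mul_eq_zero.1 hfe).resolve_left hf0.ne'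
  have hinc : ∀ b : Pt d, ‖b‖ ≤ 3 → a / 2 ≤ inner ℝ n b → ∀ y ∈ A ∩ Metric.ball z (min r R),
      ∀ t : ℝ, 0 ≤ t → y + t • b ∈ Metric.ball z (min r R) → y + t • b ∈ Ω → y + t • b ∈ A := by
    intro b hb hnb y hy t ht hyt hytΩ
    refine (hA _ ⟨hytΩ, hsR hyt⟩).2 ?_
    have h1 := (hA y ⟨hAΩ hy.1, hsR hy.2⟩).1 hy.1
    have h2 := hlin y (hsr hy.2) b t ht (hsr hyt)
    rw [hfn] at h2
    have h3 : ‖f‖ * a / 12 * ‖b‖ ≤ ‖f‖ * a / 12 * 3 := by gcongr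
    have h4 : ‖f‖ * (a / 2) ≤ ‖f‖ * inner ℝ n b := by gcongr
    have h5 : 0 < ‖f‖ * a := by positivity
    have h6 : 0 ≤ ‖f‖ * inner ℝ n b - ‖f‖ * a / 12 * ‖b‖ := by nlinarith
    nlinarith [mul_nonneg ht h6]
  refine ⟨min r R, lt_min hr hR, ⟨e + a • n, ?_, ?_, ?_⟩, fun _ => ⟨-(e - a • n), γ, ?_,
    hγ'.lipschitz, hγ'.mem_iff, fun x t ht => ?_, hinc _ ?_ ?_⟩⟩
  · refine (norm_add_le _ _).trans ?_
    rw [norm_smul, hn, hγ.norm_eq, Real.norm_of_nonneg ha0.le]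
    linarith
  · refine hγ'.coneInvariant fun b hb => ?_
    rw [hε] at hb
    have : ‖b - e‖ ≤ 3 / 2 * a := by
      calc ‖b - e‖ = ‖(b - (e + a • n)) + a • n‖ := by congr 1; abel
        _ ≤ a / 2 + a := (norm_add_le _ _).trans (by
          rw [norm_smul, hn, Real.norm_of_nonneg ha0.le]; linarith)
        _ = _ := by ring
    nlinarith [mul_le_mul_of_nonneg_right this hΛ0.le]
  · intro y hy b hb t ht hyt
    rw [hε] at hb
    have hbe : ‖b - e‖ ≤ 3 / 2 * a := by
      calc ‖b - e‖ = ‖(b - (e + a • n)) + a • n‖ := by congr 1; abel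
        _ ≤ a / 2 + a := (norm_add_le _ _).trans (by
          rw [norm_smul, hn, Real.norm_of_nonneg ha0.le]; linarith)
        _ = _ := by ring
    refine hinc b ?_ ?_ y hy t ht hyt ?_
    · have := norm_le_norm_add_norm_sub' b e
      rw [hγ.norm_eq] at this
      linarith
    · have h1 : (inner ℝ n b : ℝ) = a + inner ℝ n (b - (e + a • n)) := by
        rw [inner_sub_right, inner_add_right, inner_smul_right, hne, real_inner_self_eq_norm_sq,
          hn]; ring
      have h2 := abs_le.1 (((abs_real_inner_le_norm n (b - (e + a • n))).trans_eq
        (by rw [hn, one_mul])).trans hb)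
      linarith
    · refine hγ'.coneInvariant (m := e) (ε := 3 / 2 * a) (fun b hb => ?_) y ⟨hAΩ hy.1, hy.2⟩ b hbe
        t ht hyt
      nlinarith [mul_le_mul_of_nonneg_right hb hΛ0.le]
  · rw [norm_neg]
    refine (norm_sub_le _ _).trans ?_
    rw [norm_smul, hn, hγ.norm_eq, Real.norm_of_nonneg ha0.le]
    linarith
  · have h1 := abs_le.1 (hγ.abs_sub_smul_sub_le (b := e - a • n) (by
      rw [sub_sub_cancel_left, norm_neg, norm_smul, hn, Real.norm_of_nonneg ha0.le]
      linarith) x ht)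
    rw [smul_neg, ← sub_eq_add_neg]
    linarith
  · rw [norm_neg]
    refine (norm_sub_le _ _).trans ?_
    rw [norm_smul, hn, hγ.norm_eq, Real.norm_of_nonneg ha0.le]
    linarith
  · rw [inner_neg_right, inner_sub_right, inner_smul_right, hne, real_inner_self_eq_norm_sq, hn]
    linarith

/-! ### Local geometry of the divided domain. -/

namespace IsSmoothInterface

variable {d : ℕ} {L : ℝ≥0} {Ω Γ : Set (Pt d)} {Ωs : Fin 2 → Set (Pt d)}

theorem subset (hΓ : IsSmoothInterface L Ω Γ Ωs) (k : Fin 2) : Ωs k ⊆ Ω := by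
  rw [← hΓ.union_eq]
  fin_cases k
  · exact subset_union_left.trans subset_union_left
  · exact subset_union_right.trans subset_union_left

theorem disjoint_of_ne (hΓ : IsSmoothInterface L Ω Γ Ωs) {j k : Fin 2} (h : j ≠ k) :
    Disjoint (Ωs j) (Ωs k) := by
  fin_cases j <;> fin_cases k
  · exact absurd rfl h
  · exact hΓ.disjoint_subdomains
  · exact hΓ.disjoint_subdomains.symm
  · exact absurd rfl h

theorem subset_of_isPreconnected (hΓ : IsSmoothInterface L Ω Γ Ωs) {s : Set (Pt d)}
    (hs : IsPreconnected s) (hsΩ : s ⊆ Ω) (hsΓ : ∀ x ∈ s, x ∉ Γ) {j : Fin 2}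
    (hj : (s ∩ Ωs j).Nonempty) : s ⊆ Ωs j := by
  have hun : s ⊆ Ωs 0 ∪ Ωs 1 := fun x hx => by
    have := hsΩ hx
    rw [← hΓ.union_eq] at this
    exact this.resolve_right (hsΓ x hx)
  fin_cases j
  · exact hs.subset_left_of_subset_union (hΓ.isOpen 0) (hΓ.isOpen 1) hΓ.disjoint_subdomains hun hj
  · exact hs.subset_right_of_subset_union (hΓ.isOpen 0) (hΓ.isOpen 1) hΓ.disjoint_subdomains hun hj

/-- Near a boundary point off the closure of the interface, every point of `Ω` is joined to one
fixed point above the graph by a segment in `Ω` that avoids `Γ`; hence only one subdomain is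
present. The opening found here is not controlled by `L`. -/
theorem exists_subset_of_notMem (hΓ : IsSmoothInterface L Ω Γ Ωs)
    (hΩ : IsBoundedLipschitzDomain Ω) {z : Pt d} (hz : z ∈ closure Ω) (hzΓ : z ∉ closure Γ) :
    ∃ r > 0, ∃ j, Ω ∩ Metric.ball z r ⊆ Ωs j ∧ ∃ ε Λ : ℝ, 0 < ε ∧ ε ≤ 1 ∧ 0 ≤ Λ ∧
      IsConical Ω Ω (Metric.ball z r) ε Λ := by
  have hmem : ∀ x ∈ Ω, x ∉ Γ → ∃ j, x ∈ Ωs j := fun x hx hxΓ => by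
    rw [← hΓ.union_eq] at hx
    rcases hx with (h | h) | h
    · exact ⟨0, h⟩
    · exact ⟨1, h⟩
    · exact absurd h hxΓ
  by_cases hzΩ : z ∈ Ω
  · obtain ⟨j, hj⟩ := hmem z hzΩ fun h => hzΓ (subset_closure h)
    obtain ⟨r, hr, hball⟩ := Metric.isOpen_iff.1 (hΓ.isOpen j) z hj
    exact ⟨r, hr, j, inter_subset_right.trans hball, 1, 0, one_pos, le_rfl, le_rfl,
      isConical_of_subset hΩ.isOpen (hball.trans (hΓ.subset j)) 1 0⟩
  · have hzf : z ∈ frontier Ω := by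
      rw [hΩ.isOpen.frontier_eq]; exact ⟨hz, hzΩ⟩
    obtain ⟨e, L', hL'⟩ := hΩ.lipschitz z hzf
    obtain ⟨r₁, hr₁, γ, hγ⟩ := hL'.exists_isGraphFunction
    obtain ⟨r₂, hr₂, hball⟩ := Metric.isOpen_iff.1 isClosed_closure.isOpen_compl z hzΓ
    set R := min r₁ r₂
    have hR : 0 < R := lt_min hr₁ hr₂
    have hγR := hγ.mono (Metric.ball_subset_ball (min_le_left r₁ r₂))
    set Λ : ℝ := 1 + 2 * L' with hΛ
    have hΛ1 : 1 ≤ Λ := by rw [hΛ]; linarith [L'.coe_nonneg]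
    have hγz := hγR.apply_eq_zero hΩ.isOpen Metric.isOpen_ball hzf (Metric.mem_ball_self hR)
    set c := z + (R / 4) • e
    have hcB : c ∈ Metric.ball z R := by
      rw [Metric.mem_ball, dist_eq_norm, add_sub_cancel_left, norm_smul, hγ.norm_eq,
        Real.norm_of_nonneg (by positivity)]
      linarith
    have hcΩ : c ∈ Ω := (hγR.mem_iff c hcB).2 (by rw [hγ.add_smul, hγz]; positivity)
    have hoff : ∀ x ∈ Metric.ball z R, x ∉ Γ := fun x hx hxΓ =>
      hball (Metric.ball_subset_ball (min_le_right _ _) hx) (subset_closure hxΓ)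
    obtain ⟨j, hj⟩ := hmem c hcΩ (hoff c hcB)
    -- From points this close to `z`, the direction to `c`, rescaled by `4 / R`, deviates from `e`
    -- by at most `1 / (2 * Λ)`, so the segment rises from the graph.
    have hrR : R / (8 * Λ) ≤ R := div_le_self hR.le (by linarith)
    refine ⟨R / (8 * Λ), by positivity, j, ?_, 1 / (4 * Λ), Λ, by positivity, ?_, by linarith,
      (hγR.mono (Metric.ball_subset_ball hrR)).isConical (by linarith)⟩
    · rintro y ⟨hyΩ, hy⟩
      have hyB := Metric.ball_subset_ball hrR hy
      have hseg : segment ℝ y c ⊆ Metric.ball z R := (convex_ball z R).segment_subset hyB hcB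
      have hγy := (hγR.mem_iff y hyB).1 hyΩ
      refine hΓ.subset_of_isPreconnected (convex_segment y c).isPreconnected (fun x hx => ?_)
        (fun x hx => hoff x (hseg hx)) ⟨c, right_mem_segment ℝ y c, hj⟩ (left_mem_segment ℝ y c)
      refine (hγR.mem_iff x (hseg hx)).2 ?_
      rw [segment_eq_image'] at hx
      obtain ⟨u, hu, rfl⟩ := hx
      have hb : ‖e + (4 / R) • (z - y) - e‖ * Λ ≤ 1 / 2 := by
        rw [add_sub_cancel_left, norm_smul, Real.norm_of_nonneg (by positivity), ← dist_eq_norm,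
          dist_comm]
        have : dist y z ≤ R / (8 * Λ) := le_of_lt hy
        calc 4 / R * dist y z * Λ ≤ 4 / R * (R / (8 * Λ)) * Λ := by gcongr
          _ = 1 / 2 := by field_simp; norm_num
      have h1 := abs_le.1 (hγR.abs_add_smul_sub_le hb y (t := u * (R / 4))
        (mul_nonneg hu.1 (by positivity)))
      have h2 : (u * (R / 4)) • (e + (4 / R) • (z - y)) = u • (c - y) := by
        rw [smul_add, smul_smul, show u * (R / 4) * (4 / R) = u by field_simp]
        simp only [c]
        module
      rw [h2] at h1
      have h3 : 0 ≤ u * (R / 4) := mul_nonneg hu.1 (by positivity)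
      simp only
      linarith
    · rw [div_le_one (by positivity)]; linarith

theorem exists_isConical_of_mem (hΓ : IsSmoothInterface L Ω Γ Ωs)
    (hΩ : IsBoundedLipschitzDomain Ω) {z : Pt d} (hz : z ∈ closure Ω) (hzΓ : z ∈ closure Γ)
    (k : Fin 2) :
    ∃ r > 0, IsConical Ω (Ωs k) (Metric.ball z r) (1 / (12 * (1 + 2 * L))) (1 + 2 * L) := by
  obtain ⟨r₁, hr₁, φ, hφ, hφ0, hmem, hbd⟩ := hΓ.levelSet z hzΓ
  have hstrict : HasStrictFDerivAt φ (fderiv ℝ φ z) z :=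
    (hφ.contDiffAt (Metric.ball_mem_nhds z hr₁)).hasStrictFDerivAt (by simp)
  have hΛ1 : (1 : ℝ) ≤ 1 + 2 * L := by linarith [L.coe_nonneg]
  -- The sign of the level set function is chosen so that the subdomain at hand is where it is
  -- positive.
  obtain ⟨ψ, f, hψ, hf, hker, hA⟩ : ∃ (ψ : Pt d → ℝ) (f : Pt d →L[ℝ] ℝ), HasStrictFDerivAt ψ f z ∧
      f ≠ 0 ∧ (∀ e, fderiv ℝ φ z e = 0 → f e = 0) ∧
      ∀ x ∈ Ω ∩ Metric.ball z r₁, x ∈ Ωs k ↔ 0 < ψ x := by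
    fin_cases k
    · exact ⟨φ, _, hstrict, hφ0, fun e he => he, fun x hx => (hmem x hx).1⟩
    · refine ⟨-φ, _, hstrict.neg, neg_ne_zero.2 hφ0, fun e he => by simp [he], fun x hx => ?_⟩
      simpa using (hmem x hx).2
  by_cases hzΩ : z ∈ Ω
  · obtain ⟨r₂, hr₂, hball⟩ := Metric.isOpen_iff.1 hΩ.isOpen z hzΩ
    refine IsConical.of_levelSet_interior hΩ.isOpen (lt_min hr₁ hr₂)
      ((Metric.ball_subset_ball (min_le_right _ _)).trans hball) hψ hf
      (fun x hx => hA x ⟨hx.1, Metric.ball_subset_ball (min_le_left _ _) hx.2⟩) ?_ _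
    rw [div_le_div_iff₀ (by positivity) (by norm_num)]
    linarith
  · have hzf : z ∈ frontier Ω := by
      rw [hΩ.isOpen.frontier_eq]; exact ⟨hz, hzΩ⟩
    obtain ⟨e, he, hfe⟩ := hbd hzf
    obtain ⟨r₂, hr₂, γ, hγ⟩ := he.exists_isGraphFunction
    exact IsConical.of_levelSet_boundary (lt_min hr₁ hr₂)
      (hγ.mono (Metric.ball_subset_ball (min_le_right _ _))) hΛ1 hψ hf (hker e hfe) (hΓ.subset k)
      (fun x hx => hA x ⟨hx.1, Metric.ball_subset_ball (min_le_left _ _) hx.2⟩)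

/-- At a uniform scale, either the opening of the cones is controlled by `L`, or the ball does not
see the interface. -/
theorem exists_uniform_isConical (hΓ : IsSmoothInterface L Ω Γ Ωs)
    (hΩ : IsBoundedLipschitzDomain Ω) (k : Fin 2) :
    ∃ η > 0, ∀ z ∈ closure Ω,
      IsConical Ω (Ωs k) (Metric.ball z η) (1 / (12 * (1 + 2 * L))) (1 + 2 * L) ∨
      ((∃ ε Λ : ℝ, 0 < ε ∧ ε ≤ 1 ∧ 0 ≤ Λ ∧ IsConical Ω Ω (Metric.ball z η) ε Λ) ∧
        (Ω ∩ Metric.ball z η ⊆ Ωs k ∨ Disjoint (Ωs k) (Metric.ball z η))) := by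
  have hloc : ∀ z ∈ closure Ω, ∃ r > 0,
      IsConical Ω (Ωs k) (Metric.ball z r) (1 / (12 * (1 + 2 * L))) (1 + 2 * L) ∨
      ((∃ ε Λ : ℝ, 0 < ε ∧ ε ≤ 1 ∧ 0 ≤ Λ ∧ IsConical Ω Ω (Metric.ball z r) ε Λ) ∧
        (Ω ∩ Metric.ball z r ⊆ Ωs k ∨ Disjoint (Ωs k) (Metric.ball z r))) := by
    intro z hz
    by_cases hzΓ : z ∈ closure Γ
    · obtain ⟨r, hr, h⟩ := hΓ.exists_isConical_of_mem hΩ hz hzΓ k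
      exact ⟨r, hr, Or.inl h⟩
    · obtain ⟨r, hr, j, hj, h⟩ := hΓ.exists_subset_of_notMem hΩ hz hzΓ
      refine ⟨r, hr, Or.inr ⟨h, ?_⟩⟩
      by_cases hjk : j = k
      · exact Or.inl (hjk ▸ hj)
      · refine Or.inr (disjoint_left.2 fun x hx hxB => ?_)
        exact disjoint_left.1 (hΓ.disjoint_of_ne hjk) (hj ⟨hΓ.subset k hx, hxB⟩) hx
  choose! r hr hgood using hloc
  have hcomp : IsCompact (closure Ω) := hΩ.isBounded.isCompact_closure
  -- The Lebesgue number of the cover of the compact closure gives a scale that does not depend on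
  -- the point.
  obtain ⟨η, hη, hleb⟩ := lebesgue_number_lemma_of_metric (ι := closure Ω)
    (c := fun i => Metric.ball (i : Pt d) (r i)) hcomp (fun i => Metric.isOpen_ball)
    fun z hz => mem_iUnion.2 ⟨⟨z, hz⟩, Metric.mem_ball_self (hr z hz)⟩
  refine ⟨η, hη, fun z hz => ?_⟩
  obtain ⟨i, hi⟩ := hleb z hz
  rcases hgood i i.2 with h | ⟨⟨ε, Λ, h1, h2, h3, h4⟩, h5 | h5⟩
  · exact Or.inl (h.mono hi)
  · exact Or.inr ⟨⟨ε, Λ, h1, h2, h3, h4.mono hi⟩, Or.inl ((inter_subset_inter_right Ω hi).trans h5)⟩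
  · exact Or.inr ⟨⟨ε, Λ, h1, h2, h3, h4.mono hi⟩, Or.inr (h5.mono_right hi)⟩

end IsSmoothInterface

/-! ### Connectedness of the active mesh near a node. -/

/-- Near the node `z`, the mesh is connected through facets, and if `z` lies on the boundary of
`Ω`, then the mesh has a boundary facet near `z`. -/
def NodeConnected {d : ℕ} (Ω : Set (Pt d)) (S : Finset (Finset (Pt d))) (z : Pt d) (ρ : ℝ) :
    Prop :=
  ∃ R ⊆ S, (∀ s ∈ R, cell s ⊆ Metric.closedBall z ρ) ∧
    (∀ s ∈ S, ∀ s' ∈ S, z ∈ s → z ∈ s' → (faceGraph R).Reachable s s') ∧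
    (∀ s ∈ S, z ∈ s → s ∈ R) ∧
    (z ∈ frontier Ω → ∃ (M : Finset (Pt d)) (H : IsSimplex M) (r : Finset (Pt d)), M ∈ R ∧ r ⊆ M ∧
      r.card = d ∧ (∀ x ∈ cell r, (∀ y ∈ r, 0 < H.coord y x) → x ∈ outerBoundary Ω S) ∧
      ∀ s ∈ S, z ∈ s → (faceGraph R).Reachable s M)

theorem IsTriangulation.cell_subset_closure {d : ℕ} {Ω : Set (Pt d)} {T : Finset (Finset (Pt d))}
    (hT : IsTriangulation Ω T) {s : Finset (Pt d)} (hs : s ∈ T) : cell s ⊆ closure Ω := by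
  rw [← hT.cover]; exact subset_biUnion_of_mem (u := fun s => cell s) hs

theorem IsTriangulation.mem_outerBoundary {d : ℕ} {Ω : Set (Pt d)} {T S : Finset (Finset (Pt d))}
    (hT : IsTriangulation Ω T) (hΩ : IsOpen Ω) (hreg : interior (closure Ω) ⊆ Ω) (hST : S ⊆ T)
    {s : Finset (Pt d)} (hs : s ∈ S) {x : Pt d} (hx : x ∈ cell s) (hxΩ : x ∈ frontier Ω) :
    x ∈ outerBoundary Ω S := by
  refine ⟨hxΩ, ?_⟩
  rw [(isOpen_meshDomain S).frontier_eq]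
  refine ⟨closure_mono (interior_cell_subset_meshDomain hs) ?_, fun hxU => ?_⟩
  · rwa [(hT.isSimplex (hST hs)).closure_interior]
  · rw [hΩ.frontier_eq] at hxΩ
    refine hxΩ.2 (hreg (interior_mono (iUnion₂_subset fun t ht => ?_) hxU))
    exact hT.cell_subset_closure (hST ht)

/-- The node need not be `δ`-close to `A`, but each active simplex at the node has such a point
within `β`. Two of these points, or one of them and the point where a ray exits, are closer than `ε
* ℓ`, the distance that chains of cones of height `ℓ` can bridge. The exit point lies in the closure
of `A`, so the simplex with the boundary facet is active. -/
theorem IsConical.nodeConnected {d : ℕ} {Ω A : Set (Pt d)} {T : Finset (Finset (Pt d))}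
    {θ h δ η ε Λ β a ℓ : ℝ} {z : Pt d} (hM : IsRegularMesh Ω T θ h) (hΩ : IsOpen Ω)
    (hreg : interior (closure Ω) ⊆ Ω) (hA : IsOpen A) (hAΩ : A ⊆ Ω)
    (hcon : IsConical Ω A (Metric.ball z η) ε Λ) (hε : 0 < ε) (hε1 : ε ≤ 1) (hΛ : 0 ≤ Λ)
    (hδ : 0 ≤ δ) (hβ : 0 ≤ β)
    (hx : ∀ s ∈ activeCells T A δ, z ∈ s → ∃ x ∈ cell s, Metric.infDist x A ≤ δ ∧ dist x z ≤ β)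
    (hAz : (A ∩ Metric.ball z a).Nonempty) (hℓ : 2 * β + (1 + 4 * Λ) * a < ε * ℓ)
    (hfit : β + δ + 5 * ℓ < η) :
    NodeConnected Ω (activeCells T A δ) z (β + 5 * ℓ + h) := by
  classical
  have hT := hM.tri
  have hne : A.Nonempty := hAz.mono inter_subset_left
  have ha : 0 < a := by
    obtain ⟨y, -, hy⟩ := hAz
    exact dist_nonneg.trans_lt hy
  have hΛa : 0 ≤ Λ * a := by positivity
  have hℓ0 : 0 < ℓ := by
    by_contra! h0
    nlinarith
  have hεℓ : ε * ℓ ≤ ℓ := by nlinarith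
  have hη : 0 < η := by linarith
  obtain ⟨m, hm, hmΩ, hmA⟩ := hcon.cone
  set S := activeCells T A δ with hS
  have hST : S ⊆ T := Finset.filter_subset _ _
  set R := S.filter fun s => cell s ⊆ Metric.closedBall z (β + 5 * ℓ + h) with hR
  have hRS : R ⊆ S := Finset.filter_subset _ _
  have hfar : ∀ t ∈ S, ∀ x q : Pt d, q ∈ cell t → dist x z ≤ β → dist q x ≤ 5 * ℓ → t ∈ R := by
    intro t ht x q hq hxz hqx
    refine Finset.mem_filter.2 ⟨ht, fun y hy => ?_⟩
    rw [Metric.mem_closedBall]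
    linarith [dist_triangle y q z, dist_triangle q x z, hM.dist_le t (hST ht) y hy q hq]
  have hreach : ∀ s ∈ S, ∀ s' ∈ S, ∀ x ∈ cell s, ∀ x' ∈ cell s', Metric.infDist x A ≤ δ →
      Metric.infDist x' A ≤ δ → dist x z ≤ β → dist x x' < ε * ℓ →
      (faceGraph R).Reachable s s' := by
    intro s hs s' hs' x hxs x' hxs' hxA hxA' hxz hxx
    refine ConeInvariant.reachable hT hreg hmΩ hmA hne hm hε hε1 hδ (hST hs) (hST hs') hxs hxs' hxA
      hxA' hxx (by linarith) (hRS.trans hST) ?_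
    rintro t ht ⟨q, hq, hqx⟩
    exact hfar t ht x q hq hxz hqx
  refine ⟨R, hRS, fun s hs => (Finset.mem_filter.1 hs).2, ?_, ?_, fun hzΩ => ?_⟩
  · intro s hs s' hs' hzs hzs'
    obtain ⟨x, hxs, hxA, hxz⟩ := hx s hs hzs
    obtain ⟨x', hxs', hxA', hxz'⟩ := hx s' hs' hzs'
    refine hreach s hs s' hs' x hxs x' hxs' hxA hxA' hxz ?_
    linarith [dist_triangle_right x x' z]
  · intro s hs hzs
    obtain ⟨x, hxs, hxA, hxz⟩ := hx s hs hzs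
    exact hfar s hs x x hxs hxz (by rw [dist_self]; positivity)
  · obtain ⟨w, γ, hw, hlip, hγ, hγw, hAw⟩ := hcon.exit ⟨z, hzΩ, Metric.mem_ball_self hη⟩
    have hzn : z ∉ Ω := by rw [hΩ.frontier_eq] at hzΩ; exact hzΩ.2
    have hγz : γ z ≤ 0 := not_lt.1 fun h0 => hzn ((hγ z (Metric.mem_ball_self hη)).2 h0)
    have hγc : Continuous γ := by
      refine (LipschitzWith.of_dist_le_mul (K := Λ.toNNReal) fun x y => ?_).continuous
      rw [Real.dist_eq]
      exact (hlip x y).trans (by gcongr; exact Real.le_coe_toNNReal Λ)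
    obtain ⟨M, hMT, q, r, hqM, hqA, hqz, hrM, hrc, hrf⟩ := hT.exists_boundary_facet hΩ hreg hA hAΩ
      hγc hγ hγw hw (fun x => by linarith [(abs_le.1 (hlip x z)).2]) hΛ hAw
      (by linarith : (1 + 4 * Λ) * a < η) hAz
    have hqA' : Metric.infDist q A ≤ δ := by
      rwa [Metric.infDist_zero_of_mem_closure hqA]
    have hMS : M ∈ S := Finset.mem_filter.2 ⟨hMT, q, hqM, hqA'⟩
    have hMR : M ∈ R := by
      refine Finset.mem_filter.2 ⟨hMS, fun y hy => ?_⟩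
      rw [Metric.mem_closedBall]
      linarith [dist_triangle y q z, hM.dist_le M hMT y hy q hqM]
    refine ⟨M, hT.isSimplex hMT, r, hMR, hrM, hrc, fun x hxr hx0 => ?_, fun s hs hzs => ?_⟩
    · exact hT.mem_outerBoundary hΩ hreg hST hMS
        (((hT.isSimplex hMT).mem_face_iff hrM).1 hxr).1 (hrf x hxr hx0)
    · obtain ⟨x, hxs, hxA, hxz⟩ := hx s hs hzs
      refine hreach s hs M hMS x hxs q hqM hxA hqA' hxz ?_
      linarith [dist_triangle_right x q z]

/-- The radius of the patches, in multiples of the mesh size. -/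
noncomputable def patchRadius (κ : ℝ) (L : ℝ≥0) : ℝ :=
  60 * (1 + 2 * L) * ((5 + 8 * L) * (κ + 2) + 3) + 2

/-- The patch radius must not depend on the domain, although the cones at its boundary may. Where
the interface is seen, the opening is controlled by `L` and the cones have height proportional to
`h`. Where it is not seen, the node lies in the closure of the subdomain, and cones of negligible
height suffice. -/
theorem IsSmoothInterface.exists_nodeConnected {d : ℕ} {L : ℝ≥0} {Ω Γ : Set (Pt d)}
    {Ωs : Fin 2 → Set (Pt d)} (hΓ : IsSmoothInterface L Ω Γ Ωs) (hΩ : IsBoundedLipschitzDomain Ω)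
    (κ : ℝ) :
    ∃ h₀ > 0, ∀ (k : Fin 2) (T : Finset (Finset (Pt d))) (θ h δ : ℝ), IsRegularMesh Ω T θ h →
      0 ≤ δ → δ ≤ κ * h → h ≤ h₀ → ∀ z ∈ gridNodes (activeCells T (Ωs k) δ),
        NodeConnected Ω (activeCells T (Ωs k) δ) z (patchRadius κ L * h) := by
  classical
  have hreg := hΩ.interior_closure_subset
  choose η hη hcon using fun k => hΓ.exists_uniform_isConical hΩ k
  have hρ : 0 < patchRadius |κ| L := by unfold patchRadius; positivity
  -- The absolute value makes `h₀` positive for any `κ`; once a mesh exists, `κ` is nonnegative.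
  refine ⟨min (η 0) (η 1) / (patchRadius |κ| L + |κ|), by
    have := lt_min (hη 0) (hη 1); positivity, fun k T θ h δ hM hδ hδκ hh z hz => ?_⟩
  have hh0 := hM.h_pos
  have hκ : 0 ≤ κ := by
    by_contra! h0
    nlinarith
  rw [abs_of_nonneg hκ] at hh hρ
  have hhη : (patchRadius κ L + κ) * h ≤ η k := by
    rw [le_div_iff₀' (by positivity)] at hh
    refine hh.trans ?_
    fin_cases k
    · exact min_le_left _ _
    · exact min_le_right _ _
  have hL := L.coe_nonneg
  set S := activeCells T (Ωs k) δ with hS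
  obtain ⟨s₀, hs₀, hzs₀⟩ : ∃ s ∈ S, z ∈ s := by simpa [gridNodes] using hz
  obtain ⟨hs₀T, x₀, hx₀, hx₀A⟩ := Finset.mem_filter.1 hs₀
  have hzΩ : z ∈ closure Ω := hM.tri.cell_subset_closure hs₀T (mem_cell_of_mem hzs₀)
  have hdist : ∀ s ∈ S, z ∈ s → ∀ x ∈ cell s, dist x z ≤ h := fun s hs hzs x hx =>
    hM.dist_le s (Finset.mem_filter.1 hs).1 x hx z (mem_cell_of_mem hzs)
  have hnear : (Ωs k ∩ Metric.ball z ((κ + 2) * h)).Nonempty := by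
    obtain ⟨y, hyA, hy⟩ := (Metric.infDist_lt_iff (hΓ.nonempty k) (r := δ + h)).1
      (by linarith : Metric.infDist x₀ (Ωs k) < δ + h)
    refine ⟨y, hyA, ?_⟩
    rw [Metric.mem_ball]
    linarith [dist_triangle y x₀ z, dist_comm x₀ y, hdist s₀ hs₀ hzs₀ x₀ hx₀]
  set K : ℝ := (5 + 8 * L) * (κ + 2) + 3 with hK
  have hK1 : 13 ≤ K := by rw [hK]; nlinarith
  have hρK : patchRadius κ L = 60 * (1 + 2 * L) * K + 2 := rfl
  have hKL : K ≤ (1 + 2 * L) * K := by nlinarith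
  rcases hcon k z hzΩ with hc | ⟨⟨ε, Λ, hε, hε1, hΛ, hc⟩, hsub | hdisj⟩
  -- Here `β = h` and `a = (κ + 2) * h`, so the distance to be bridged is below `K * h`, and
  -- dividing by the opening gives the height `12 * (1 + 2 * L) * (K * h)`.
  · have hε1 : 1 / (12 * (1 + 2 * (L : ℝ))) ≤ 1 := by
      rw [div_le_one (by positivity)]; linarith
    have hεℓ : 1 / (12 * (1 + 2 * (L : ℝ))) * (12 * (1 + 2 * L) * (K * h)) = K * h := by
      field_simp
    have := hc.nodeConnected hM hΩ.isOpen hreg (hΓ.isOpen k) (hΓ.subset k) (by positivity) hε1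
      (by positivity) hδ hh0.le (fun s hs hzs => by
        obtain ⟨-, x, hx, hxA⟩ := Finset.mem_filter.1 hs
        exact ⟨x, hx, hxA, hdist s hs hzs x hx⟩) hnear (ℓ := 12 * (1 + 2 * L) * (K * h))
      (by rw [hεℓ, hK]; nlinarith) (by rw [hρK] at hhη; nlinarith)
    convert this using 1
    rw [hρK]; ring
  · have hη0 := hη k
    have hc' : IsConical Ω (Ωs k) (Metric.ball z (η k)) ε Λ :=
      hc.congr fun x hx => ⟨fun h => hsub ⟨h, hx⟩, fun h => hΓ.subset k h⟩
    have hzA : z ∈ closure (Ωs k) := by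
      refine closure_mono hsub (Metric.isOpen_ball.closure_inter ⟨hzΩ, Metric.mem_ball_self hη0⟩)
    -- Now `β = 0`, and `a` can be taken so small that the thin cones are wide enough: the resulting
    -- radius is at most `2 * h`, whatever `ε` and `Λ`.
    set ℓ := min (h / 5) ((η k - δ) / 10)
    have hδη : δ < η k := by nlinarith
    have hℓ : 0 < ℓ := lt_min (by positivity) (by linarith)
    have hℓ1 : ℓ ≤ h / 5 := min_le_left _ _
    have hℓ2 : ℓ ≤ (η k - δ) / 10 := min_le_right _ _
    obtain ⟨y, hyA, hy⟩ := Metric.mem_closure_iff.1 hzA (ε * ℓ / (2 * (1 + 4 * Λ))) (by positivity)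
    obtain ⟨R, h1, h2, h3⟩ := hc'.nodeConnected hM hΩ.isOpen hreg (hΓ.isOpen k) (hΓ.subset k) hε hε1
      hΛ hδ le_rfl (fun s hs hzs => ⟨z, mem_cell_of_mem hzs, by
        rwa [Metric.infDist_zero_of_mem_closure hzA], by rw [dist_self]⟩)
      (a := ε * ℓ / (2 * (1 + 4 * Λ))) ⟨y, hyA, by rwa [Metric.mem_ball, dist_comm]⟩ (ℓ := ℓ) (by
        rw [show (1 + 4 * Λ) * (ε * ℓ / (2 * (1 + 4 * Λ))) = ε * ℓ / 2 by field_simp]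
        nlinarith [mul_pos hε hℓ]) (by linarith)
    refine ⟨R, h1, fun s hs => (h2 s hs).trans (Metric.closedBall_subset_closedBall ?_), h3⟩
    rw [hρK]; nlinarith
  -- A node of the active mesh has points of the subdomain within `(κ + 2) * h`, so the last
  -- alternative does not occur.
  · obtain ⟨y, hyA, hy⟩ := hnear
    refine absurd (Metric.ball_subset_ball ?_ hy) (disjoint_left.1 hdisj hyA)
    refine le_trans ?_ hhη
    rw [hρK]; nlinarith

/-! ### Functions that vanish near the boundary -/

/-- The weak gradient of a function vanishes wherever the function does. -/
theorem MemH1.ae_grad_eq_zero {d : ℕ} {V : Set (Pt d)} (hV : IsOpen V) {w : Pt d → ℝ}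
    {F : Pt d → Pt d} (h : MemH1 V w F) (hw : ∀ x ∈ V, w x = 0) :
    ∀ᵐ x : Pt d, x ∈ V → F x = 0 := by
  have hi : ∀ i : Fin d, ∀ᵐ x : Pt d, x ∈ V → F x i = 0 := by
    intro i
    have hF : MemLp (fun x => F x i) 2 (volume.restrict V) :=
      h.memLp_grad.of_le
        ((EuclideanSpace.proj (𝕜 := ℝ) i).continuous.comp_aestronglyMeasurable
          h.memLp_grad.aestronglyMeasurable)
        (ae_of_all _ fun x => PiLp.norm_apply_le (F x) i)
    have hloc : LocallyIntegrableOn (fun x => F x i) V volume :=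
      locallyIntegrableOn_of_locallyIntegrable_restrict (hF.locallyIntegrable (by norm_num))
    refine hV.ae_eq_zero_of_integral_contDiff_smul_eq_zero hloc fun g h1 h2 h3 => ?_
    have h4 := h.weakGrad g h1 h2 h3 i
    rw [setIntegral_congr_fun (g := fun _ => (0 : ℝ)) hV.measurableSet fun x hx => by
      simp [hw x hx], integral_zero, zero_eq_neg] at h4
    rw [← h4, setIntegral_eq_integral_of_forall_compl_eq_zero]
    · exact integral_congr_ae (ae_of_all _ fun x => by simp [mul_comm])
    · intro x hx
      rw [image_eq_zero_of_notMem_tsupport fun hx' => hx (h3 hx'), mul_zero]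
  filter_upwards [ae_all_iff.2 hi] with x hx hxV
  ext i
  exact hx i hxV

open Filter Topology in
/-- Extension by zero across a hypersurface near which the function vanishes. -/
theorem MemH1.indicator_pos {d : ℕ} {U B O : Set (Pt d)} (hU : IsOpen U)
    (hB : IsOpen B) (hO : IsOpen O) {w : Pt d → ℝ} {F : Pt d → Pt d} (h : MemH1 U w F)
    (hw : ∀ x ∈ O ∩ U, w x = 0) {f : Pt d → ℝ} (hf : ContDiff ℝ ∞ f)
    (hpos : ∀ x ∈ B, 0 < f x → x ∈ U) (hzero : ∀ x ∈ B, f x = 0 → x ∈ O) :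
    MemH1 B ((B ∩ {x | 0 < f x}).indicator w) ((B ∩ {x | 0 < f x}).indicator F) := by
  set P := B ∩ {x | 0 < f x} with hP
  have hPo : IsOpen P := hB.inter (isOpen_lt continuous_const hf.continuous)
  have hPB : P ⊆ B := inter_subset_left
  have hPU : P ⊆ U := fun x hx => hpos x hx.1 hx.2
  have hr : (volume.restrict B).restrict P = (volume : Measure (Pt d)).restrict P := by
    rw [Measure.restrict_restrict hPo.measurableSet, inter_eq_self_of_subset_left hPB]
  have hF0 := (h.mono (inter_subset_right : O ∩ U ⊆ U)).ae_grad_eq_zero (hO.inter hU) hw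
  refine ⟨(memLp_indicator_iff_restrict hPo.measurableSet).2 (hr ▸ (h.mono hPU).memLp),
    (memLp_indicator_iff_restrict hPo.measurableSet).2 (hr ▸ (h.mono hPU).memLp_grad), ?_⟩
  intro ψ h1 h2 h3 i
  -- By compactness of the support of `ψ`, its points with small nonnegative `f` all lie in `O`,
  -- where the function vanishes.
  obtain ⟨ε, hε, hεO⟩ : ∃ ε > 0, ∀ x ∈ tsupport ψ, 0 ≤ f x → f x ≤ ε → x ∈ O := by
    have hK : IsCompact (tsupport ψ ∩ ({x | 0 ≤ f x} ∩ Oᶜ)) := h2.isCompact.inter_right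
      ((isClosed_le continuous_const hf.continuous).inter hO.isClosed_compl)
    rcases (tsupport ψ ∩ ({x | 0 ≤ f x} ∩ Oᶜ)).eq_empty_or_nonempty with he | hne
    · refine ⟨1, one_pos, fun x hx h0 _ => ?_⟩
      by_contra hxO
      exact notMem_empty x (he ▸ ⟨hx, h0, hxO⟩)
    · obtain ⟨x₀, ⟨hx₀, h0, hx₀O⟩, hmin⟩ := hK.exists_isMinOn hne hf.continuous.continuousOn
      have hfx : 0 < f x₀ := lt_of_le_of_ne h0 fun he => hx₀O (hzero x₀ (h3 hx₀) he.symm)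
      refine ⟨f x₀ / 2, by positivity, fun x hx hx0 hxε => ?_⟩
      by_contra hxO
      have h4 : f x₀ ≤ f x := hmin ⟨hx, hx0, hxO⟩
      linarith
  -- The cut-off moves the support of the test function into `P`. It changes `ψ` only where `w`
  -- vanishes and the weak gradient vanishes almost everywhere.
  set χ : Pt d → ℝ := fun x => Real.smoothTransition ((2 * f x - ε) / ε) with hχ
  have hχc : ContDiff ℝ ∞ χ := Real.smoothTransition.contDiff.comp (by fun_prop)
  have hχ0 : ∀ x, f x ≤ ε / 2 → χ x = 0 := fun x hx =>
    Real.smoothTransition.zero_of_nonpos (div_nonpos_of_nonpos_of_nonneg (by linarith) hε.le)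
  have hχ1 : ∀ x, ε ≤ f x → χ x = 1 := fun x hx =>
    Real.smoothTransition.one_of_one_le (by rw [le_div_iff₀ hε]; linarith)
  have hsupp : tsupport (fun x => ψ x * χ x) ⊆ P := by
    have h4 : tsupport (fun x => ψ x * χ x) ⊆ tsupport ψ ∩ {x | ε / 2 ≤ f x} := by
      refine closure_minimal (fun x hx => ?_)
        ((isClosed_tsupport ψ).inter (isClosed_le continuous_const hf.continuous))
      have hx' : ψ x * χ x ≠ 0 := hx
      refine ⟨subset_tsupport ψ (left_ne_zero_of_mul hx'), ?_⟩
      by_contra hlt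
      exact right_ne_zero_of_mul hx' (hχ0 x (not_le.1 hlt).le)
    intro x hx
    have hx' : ε / 2 ≤ f x := (h4 hx).2
    exact ⟨h3 (h4 hx).1, show 0 < f x by linarith⟩
  have key := (h.mono hPU).weakGrad (fun x => ψ x * χ x) (h1.mul hχc) h2.mul_right hsupp i
  have hcut : ∀ x ∈ P, x ∉ O → ∀ᶠ y in 𝓝 x, ψ y * χ y = ψ y := by
    intro x hx hxO
    by_cases hxψ : x ∈ tsupport ψ
    · have hxε : ε < f x := by
        by_contra! hle
        exact hxO (hεO x hxψ (le_of_lt hx.2) hle)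
      filter_upwards [(hf.continuous.tendsto x).eventually_const_lt hxε] with y hy
      rw [hχ1 y hy.le, mul_one]
    · filter_upwards [(isClosed_tsupport ψ).isOpen_compl.mem_nhds hxψ] with y hy
      rw [image_eq_zero_of_notMem_tsupport hy, zero_mul]
  have e1 : ∫ x in B, P.indicator w x * fderiv ℝ ψ x (EuclideanSpace.single i 1) =
      ∫ x in P, w x * fderiv ℝ (fun x => ψ x * χ x) x (EuclideanSpace.single i 1) := by
    rw [← hr, ← integral_indicator hPo.measurableSet]
    refine integral_congr_ae (ae_of_all _ fun x => ?_)
    by_cases hx : x ∈ P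
    · simp only [indicator_of_mem hx]
      by_cases hxO : x ∈ O
      · rw [hw x ⟨hxO, hPU hx⟩, zero_mul, zero_mul]
      · have : (fun x => ψ x * χ x) =ᶠ[𝓝 x] ψ := hcut x hx hxO
        rw [this.fderiv_eq]
    · simp [hx]
  have e2 : ∫ x in B, (P.indicator F x) i * ψ x = ∫ x in P, F x i * (ψ x * χ x) := by
    rw [← hr, ← integral_indicator hPo.measurableSet]
    refine integral_congr_ae ?_
    filter_upwards [ae_restrict_of_ae hF0] with x hx0
    by_cases hx : x ∈ P
    · simp only [indicator_of_mem hx]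
      by_cases hxO : x ∈ O
      · rw [hx0 ⟨hxO, hPU hx⟩]; simp
      · rw [(hcut x hx hxO).self_of_nhds]
    · simp [hx]
  rw [e1, e2]
  exact key

/-- Friedrichs' inequality for a function that is supported in a part of a ball. -/
theorem MemH1.friedrichs {d : ℕ} {b : Pt d} {r : ℝ} {P : Set (Pt d)} {w : Pt d → ℝ}
    {F : Pt d → Pt d} (hP : IsOpen P) (hPB : P ⊆ Metric.ball b r)
    (h : MemH1 (Metric.ball b r) (P.indicator w) (P.indicator F)) {Z : Set (Pt d)}
    (hZ : Z ⊆ Metric.ball b r) (hPZ : Disjoint P Z) (hZm : MeasurableSet Z) :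
    volume Z * ∫⁻ x in P, ‖w x‖ₑ ^ 2 ≤
      2 ^ d * ENNReal.ofReal (2 * r) ^ 2 * volume (Metric.ball b r) * ∫⁻ x in P, ‖F x‖ₑ ^ 2 := by
  have h1 := h.poincare (convex_ball b r) Metric.isOpen_ball (D := ENNReal.ofReal (2 * r))
    fun x hx y hy => by
      rw [edist_dist]
      apply ENNReal.ofReal_le_ofReal
      rw [Metric.mem_ball] at hx hy
      linarith [dist_triangle_right x y b]
  have hr : (volume.restrict (Metric.ball b r)).restrict P =
      (volume : Measure (Pt d)).restrict P := by
    rw [Measure.restrict_restrict hP.measurableSet, inter_eq_self_of_subset_left hPB]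
  have h2 : ∫⁻ x in Metric.ball b r, ‖P.indicator F x‖ₑ ^ 2 = ∫⁻ x in P, ‖F x‖ₑ ^ 2 := by
    rw [← hr, ← lintegral_indicator hP.measurableSet]
    refine lintegral_congr fun x => ?_
    by_cases hx : x ∈ P <;> simp [hx]
  rw [h2] at h1
  refine le_trans ?_ h1
  calc volume Z * ∫⁻ x in P, ‖w x‖ₑ ^ 2 ≤ ∫⁻ x in P, volume Z * ‖w x‖ₑ ^ 2 :=
        lintegral_const_mul_le _ _
    -- On `Z` the extended function is zero, so the difference is the value at `x` alone.
    _ = ∫⁻ x in P, ∫⁻ y in Z, ‖P.indicator w x - P.indicator w y‖ₑ ^ 2 := by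
        refine setLIntegral_congr_fun hP.measurableSet fun x hx => ?_
        rw [setLIntegral_congr_fun (g := fun _ => ‖w x‖ₑ ^ 2) hZm fun y hy => by
          rw [indicator_of_mem hx, indicator_of_notMem fun hy' => disjoint_left.1 hPZ hy' hy,
            sub_zero], setLIntegral_const, mul_comm]
    _ ≤ ∫⁻ x in Metric.ball b r, ∫⁻ y in Metric.ball b r,
          ‖P.indicator w x - P.indicator w y‖ₑ ^ 2 := energy_mono _ hPB hZ

namespace IsRegularMesh

variable {d : ℕ} {Ω : Set (Pt d)} {T S : Finset (Finset (Pt d))} {θ h : ℝ}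

theorem radius_le (hM : IsRegularMesh Ω T θ h) (hd : 0 < d) {s : Finset (Pt d)} (hs : s ∈ T) :
    θ * h ≤ h := by
  obtain ⟨c, hc⟩ := hM.ball s hs
  have h0 := hM.radius_pos
  have h1 : c + (θ * h) • EuclideanSpace.single (⟨0, hd⟩ : Fin d) (1 : ℝ) ∈ cell s := hc (by
    rw [Metric.mem_closedBall, dist_eq_norm, add_sub_cancel_left, norm_smul,
      Real.norm_of_nonneg h0.le]
    simp)
  have h2 := hM.dist_le s hs _ h1 c (hc (Metric.mem_closedBall_self h0.le))
  rw [dist_eq_norm, add_sub_cancel_left, norm_smul, Real.norm_of_nonneg h0.le] at h2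
  simpa using h2

/-- The constant in Friedrichs' inequality near a boundary facet. -/
noncomputable def facetConst (d : ℕ) (θ : ℝ) : ℝ≥0∞ := 2 ^ d * 4 * volRatio d θ

/-- On a part of a simplex near a boundary facet, a function that vanishes near that facet is
controlled by its gradient. -/
theorem exists_facet_friedrichs (hM : IsRegularMesh Ω T θ h) (hd : 0 < d) (hST : S ⊆ T)
    {M r : Finset (Pt d)} (H : IsSimplex M) (hMS : M ∈ S) (hr : r ⊆ M) (hrc : r.card = d)
    {D : Set (Pt d)}
    (hD : ∀ x ∈ cell r, (∀ y ∈ r, 0 < H.coord y x) → x ∈ D) :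
    ∃ P ⊆ interior (cell M), MeasurableSet P ∧ ballVol d h ≤ volRatio d θ * volume P ∧
      ∀ (w : Pt d → ℝ) (F : Pt d → Pt d), MemH1 (meshDomain S) w F →
        (∃ O : Set (Pt d), IsOpen O ∧ D ⊆ O ∧ ∀ x ∈ O ∩ meshDomain S, w x = 0) →
        ∫⁻ x in P, ‖w x‖ₑ ^ 2 ≤
          facetConst d θ * ENNReal.ofReal h ^ 2 * ∫⁻ x in interior (cell M), ‖F x‖ₑ ^ 2 := by
  have hd0 : (0 : ℝ) < d := by exact_mod_cast hd
  have hMT := hST hMS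
  obtain ⟨o, ho, hso⟩ := H.exists_eq_insert hr hrc
  have hoM : o ∈ M := hso ▸ Finset.mem_insert_self _ _
  obtain ⟨b, hb, hbc⟩ := H.exists_face_centroid hd hr hrc
  have hbo : H.coord o b = 0 := ((H.mem_face_iff hr).1 hb).2 o hoM ho
  set B := Metric.ball b (θ * h / d) with hB
  have hnear : ∀ y ∈ r, ∀ x ∈ B, 0 < H.coord y x := by
    intro y hy x hx
    obtain ⟨c, hc⟩ := hM.ball M hMT
    have h1 := H.abs_coord_sub_le hM.radius_pos hc y x b
    have h2 : dist x b / (θ * h) < 1 / d := by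
      rw [div_lt_iff₀ hM.radius_pos]
      calc dist x b < θ * h / d := hx
        _ = _ := by ring
    have h3 := (abs_le.1 h1).1
    rw [hbc y hy] at h3
    linarith
  set P := B ∩ {x | 0 < H.coord o x} with hP
  have hfc : ContDiff ℝ ∞ (H.coord o) := by
    have : (H.coord o : Pt d → ℝ) = fun x => H.coord o 0 + inner ℝ (H.grad o) x := by
      funext x
      have := H.coord_sub o x 0
      rw [sub_zero] at this
      linarith
    rw [this]
    exact contDiff_const.add (contDiff_const.inner ℝ contDiff_id)
  have hPo : IsOpen P := Metric.isOpen_ball.inter (isOpen_lt continuous_const (H.continuous_coord o))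
  have hPM : P ⊆ interior (cell M) := fun x hx => H.mem_interior_cell_iff.2 fun y hy => by
    have hy' : y ∈ insert o r := by rw [hso]; exact hy
    rcases Finset.mem_insert.1 hy' with rfl | hy'
    · exact hx.2
    · exact hnear y hy' x hx.1
  have hball : ballVol d (θ * h / d) ≤ 2 * volume P := by
    refine (ballVol_le_two_mul (H.coord o) hbo _).trans (mul_le_mul' le_rfl ?_)
    calc volume (B ∩ {x | 0 ≤ H.coord o x}) ≤ volume (B ∩ cell M) :=
          measure_mono fun x hx => ⟨hx.1, H.mem_cell_of_insert hso hx.2 fun y hy =>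
            (hnear y hy x hx.1).le⟩
      _ = volume (B ∩ interior (cell M)) :=
          (measure_congr ((ae_eq_refl B).inter (interior_ae_eq_cell M))).symm
      _ ≤ volume P := measure_mono fun x hx => ⟨hx.1, H.mem_interior_cell_iff.1 hx.2 o hoM⟩
  refine ⟨P, hPM, hPo.measurableSet, hM.ballVol_le_volRatio_mul hd hball, ?_⟩
  rintro w F hw ⟨O, hO, hDO, hw0⟩
  -- The half ball on the other side of the facet, of comparable volume. The extension is zero there
  -- even if other simplices should be present.
  set Z := B ∩ {x | 0 ≤ (-H.coord o) x} with hZ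
  have hZm : MeasurableSet Z := measurableSet_ball.inter
    (isClosed_le continuous_const (H.continuous_coord o).neg).measurableSet
  have hZv : ballVol d h ≤ volRatio d θ * volume Z :=
    hM.ballVol_le_volRatio_mul hd (ballVol_le_two_mul (-H.coord o) (by simp [hbo]) _)
  have hZ0 : volume Z ≠ 0 := fun h0 => by
    rw [h0, mul_zero] at hZv
    exact (ballVol_pos (d := d) hM.h_pos).ne' (le_antisymm hZv zero_le)
  have hZt : volume Z ≠ ⊤ :=
    ((measure_mono inter_subset_left).trans_lt measure_ball_lt_top).ne
  have hrad : θ * h / d ≤ h :=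
    (div_le_self hM.radius_pos.le (by exact_mod_cast hd)).trans (hM.radius_le hd hMT)
  have hBv : volume B ≤ ballVol d h := by
    rw [hB, volume_ball_eq]
    exact measure_mono (Metric.ball_subset_ball hrad)
  -- Within `B` the zero set of the coordinate of `o` consists of relatively interior points of the
  -- facet, which lie in `D` and hence in `O`.
  have hext := hw.indicator_pos (isOpen_meshDomain S) (B := B) Metric.isOpen_ball hO hw0 hfc
    (fun x hx h0 => interior_cell_subset_meshDomain hMS (hPM ⟨hx, h0⟩)) fun x hx h0 => by
      refine hDO (hD x ((H.mem_face_iff hr).2 ⟨H.mem_cell_of_insert hso h0.ge fun y hy =>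
        (hnear y hy x hx).le, fun y hy hyr => ?_⟩) fun y hy => hnear y hy x hx)
      have hy' : y ∈ insert o r := by rw [hso]; exact hy
      rcases Finset.mem_insert.1 hy' with rfl | hy'
      · exact h0
      · exact absurd hy' hyr
  have hfr := hext.friedrichs hPo inter_subset_left (Z := Z) inter_subset_left
    (disjoint_left.2 fun x hx hxZ => by
      have h1 : 0 < H.coord o x := hx.2
      have h2 : 0 ≤ -H.coord o x := hxZ.2
      linarith) hZm
  refine (ENNReal.mul_le_mul_iff_right hZ0 hZt).1 (hfr.trans ?_)
  have e : ENNReal.ofReal (2 * (θ * h / d)) ^ 2 ≤ 4 * ENNReal.ofReal h ^ 2 := by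
    calc _ ≤ ENNReal.ofReal (2 * h) ^ 2 := by gcongr
      _ = _ := by
        rw [ENNReal.ofReal_mul zero_le_two, mul_pow, ENNReal.ofReal_ofNat]; norm_num
  calc _ ≤ 2 ^ d * (4 * ENNReal.ofReal h ^ 2) * (volRatio d θ * volume Z) *
        ∫⁻ x in interior (cell M), ‖F x‖ₑ ^ 2 := by
        gcongr
        exact hBv.trans hZv
    _ = _ := by unfold facetConst; ring

/-- The constant in the node estimate for functions that vanish on the outer boundary. -/
noncomputable def traceConst (d : ℕ) (θ ρ : ℝ) : ℝ≥0∞ :=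
  2 * volRatio d θ * (patchConst d θ ρ + facetConst d θ)

theorem traceConst_ne_top (d : ℕ) (θ ρ : ℝ) : traceConst d θ ρ ≠ ⊤ := by
  have h1 := volRatio_ne_top d θ
  have h2 := patchConst_ne_top d θ ρ
  unfold traceConst facetConst
  finiteness

/-- The chain of simplices compares `s` with the part `P` at the boundary facet, where Friedrichs'
inequality bounds the function itself; averaging `|w x|² ≤ 2 (|w x - w y|² + |w y|²)` over `y ∈ P`
combines the two. -/
theorem lintegral_cell_le_of_vanishing (hM : IsRegularMesh Ω T θ h) (hd : 0 < d) (hST : S ⊆ T)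
    {z : Pt d} {ρ : ℝ} (hρ : 0 < ρ) (hz : NodeConnected Ω S z (ρ * h)) (hzΩ : z ∈ frontier Ω)
    {s : Finset (Pt d)} (hs : s ∈ S) (hzs : z ∈ s) {w : Pt d → ℝ} {F : Pt d → Pt d}
    (hw : MemH1 (meshDomain S) w F)
    (hw0 : ∃ O : Set (Pt d), IsOpen O ∧ outerBoundary Ω S ⊆ O ∧
      ∀ x ∈ O ∩ meshDomain S, w x = 0) :
    ∫⁻ x in cell s, ‖w x‖ₑ ^ 2 ≤ traceConst d θ ρ * ENNReal.ofReal h ^ 2 *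
      ∫⁻ x in Metric.closedBall z (ρ * h) ∩ meshDomain S, ‖F x‖ₑ ^ 2 := by
  obtain ⟨R, hRS, hRz, -, hR, hb⟩ := hz
  obtain ⟨M, H, r, hMR, hr, hrc, hrD, hreach⟩ := hb hzΩ
  have hMS := hRS hMR
  obtain ⟨P, hPM, hPm, hPv, hP⟩ := hM.exists_facet_friedrichs hd hST H hMS hr hrc hrD
  set X := ∫⁻ x in Metric.closedBall z (ρ * h) ∩ meshDomain S, ‖F x‖ₑ ^ 2 with hX
  have h1 : ∫⁻ x in P, ‖w x‖ₑ ^ 2 ≤ facetConst d θ * ENNReal.ofReal h ^ 2 * X := by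
    refine (hP w F hw hw0).trans (mul_le_mul' le_rfl (lintegral_mono_set fun x hx => ?_))
    exact ⟨hRz M hMR (interior_subset hx), interior_cell_subset_meshDomain hMS hx⟩
  have h2 : energy w (cell s) P ≤ patchConst d θ ρ * ENNReal.ofReal h ^ 2 * ballVol d h * X := by
    refine (energy_mono w le_rfl (hPM.trans interior_subset)).trans ?_
    exact hM.energy_reachable_le hd hw hST hRS hρ hRz (hR s hs hzs) (hreach s hs hzs).symm
  have hwm := aemeasurable_restrict_cell hw hs
  have hPm' : AEMeasurable w (volume.restrict P) :=
    (aemeasurable_restrict_cell hw hMS).mono_measure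
      (Measure.restrict_mono (hPM.trans interior_subset) le_rfl)
  have h3 : volume P * ∫⁻ x in cell s, ‖w x‖ₑ ^ 2 ≤
      2 * (energy w (cell s) P + volume (cell s) * ∫⁻ x in P, ‖w x‖ₑ ^ 2) := by
    have hp : ∀ x, volume P * ‖w x‖ₑ ^ 2 ≤
        2 * ((∫⁻ y in P, ‖w x - w y‖ₑ ^ 2) + ∫⁻ y in P, ‖w y‖ₑ ^ 2) := fun x => by
      calc volume P * ‖w x‖ₑ ^ 2 = ∫⁻ y in P, ‖w x‖ₑ ^ 2 := by rw [setLIntegral_const, mul_comm]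
        _ ≤ ∫⁻ y in P, 2 * (‖w x - w y‖ₑ ^ 2 + ‖w y‖ₑ ^ 2) := lintegral_mono fun y => by
            have := enorm_sub_sq_le_two_mul (w x) 0 (w y)
            simpa using this
        _ = _ := by
            rw [lintegral_const_mul' _ _ (by simp),
              lintegral_add_right' _ (hPm'.enorm.pow_const 2)]
    calc _ ≤ ∫⁻ x in cell s, volume P * ‖w x‖ₑ ^ 2 := lintegral_const_mul_le _ _
      _ ≤ ∫⁻ x in cell s, 2 * ((∫⁻ y in P, ‖w x - w y‖ₑ ^ 2) + ∫⁻ y in P, ‖w y‖ₑ ^ 2) :=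
          lintegral_mono fun x => hp x
      _ = _ := by
          rw [lintegral_const_mul' _ _ (by simp), lintegral_add_right _ measurable_const,
            setLIntegral_const, energy, mul_comm (volume (cell s))]
  have hV0 := (ballVol_pos (d := d) hM.h_pos).ne'
  refine (ENNReal.mul_le_mul_iff_right hV0 ballVol_ne_top).1 ?_
  calc ballVol d h * ∫⁻ x in cell s, ‖w x‖ₑ ^ 2
      ≤ volRatio d θ * volume P * ∫⁻ x in cell s, ‖w x‖ₑ ^ 2 := by gcongr
    _ = volRatio d θ * (volume P * ∫⁻ x in cell s, ‖w x‖ₑ ^ 2) := by ring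
    _ ≤ volRatio d θ * (2 * (energy w (cell s) P + volume (cell s) * ∫⁻ x in P, ‖w x‖ₑ ^ 2)) := by
        gcongr
    _ ≤ volRatio d θ * (2 * (patchConst d θ ρ * ENNReal.ofReal h ^ 2 * ballVol d h * X +
          ballVol d h * (facetConst d θ * ENNReal.ofReal h ^ 2 * X))) := by
        gcongr
        exact hM.volume_cell_le (hST hs)
    _ = _ := by unfold traceConst; ring

end IsRegularMesh

/-! ### Stability and approximation of the lumped-mass projection -/

theorem normL2_sq {d : ℕ} {F : Type} [NormedAddCommGroup F] (U : Set (Pt d)) (f : Pt d → F) :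
    normL2 U f ^ 2 = ∫⁻ x in U, ‖f x‖ₑ ^ 2 := by
  have := eLpNorm_nnreal_pow_eq_lintegral (μ := volume.restrict U) (f := f) (p := 2) (by norm_num)
  simpa [normL2] using this

theorem normL2_le_of_lintegral_le {d : ℕ} {F F' : Type} [NormedAddCommGroup F]
    [NormedAddCommGroup F'] {U : Set (Pt d)} {f : Pt d → F} {g : Pt d → F'} {c : ℝ≥0∞}
    (h : ∫⁻ x in U, ‖f x‖ₑ ^ 2 ≤ c ^ 2 * ∫⁻ x in U, ‖g x‖ₑ ^ 2) :
    normL2 U f ≤ c * normL2 U g := by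
  rw [← normL2_sq, ← normL2_sq, ← mul_pow] at h
  exact (ENNReal.pow_le_pow_left_iff two_ne_zero).1 h

/-- For `C ≥ 1` one has `a ≤ C ≤ C²`, so that bounds for squared norms need no square roots of
constants. -/
theorem le_ofReal_sq {a : ℝ≥0∞} (ha : a ≠ ⊤) {C : ℝ} (h1 : 1 ≤ C) (hC : a.toReal ≤ C) :
    a ≤ ENNReal.ofReal C ^ 2 := by
  rw [← ENNReal.ofReal_toReal ha, ← ENNReal.ofReal_pow (by linarith)]
  exact ENNReal.ofReal_le_ofReal (by nlinarith)

open Filter Topology in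
theorem ENNReal.le_of_forall_le_add_mul_sq {a b c : ℝ≥0∞} (hc : c ≠ ⊤)
    (h : ∀ ε : ℝ, 0 < ε → a ≤ b + c * ENNReal.ofReal ε ^ 2) : a ≤ b := by
  have h1 : Tendsto (fun ε : ℝ => b + c * ENNReal.ofReal ε ^ 2) (𝓝[>] 0) (𝓝 (b + c * 0)) := by
    refine Tendsto.mono_left ?_ nhdsWithin_le_nhds
    refine tendsto_const_nhds.add (ENNReal.Tendsto.const_mul ?_ (Or.inr hc))
    have : Continuous fun ε : ℝ => ENNReal.ofReal ε ^ 2 :=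
      (ENNReal.continuous_pow 2).comp ENNReal.continuous_ofReal
    simpa using this.tendsto 0
  rw [mul_zero, add_zero] at h1
  refine ge_of_tendsto h1 ?_
  filter_upwards [self_mem_nhdsWithin] with ε hε
  exact h ε hε

theorem lintegral_enorm_sq_le_two_mul {α E : Type*} [MeasurableSpace α] [NormedAddCommGroup E]
    {μ : Measure α} {f g : α → E} (hg : AEMeasurable (fun x => ‖g x‖ₑ) μ) :
    ∫⁻ x, ‖f x‖ₑ ^ 2 ∂μ ≤ 2 * ((∫⁻ x, ‖f x - g x‖ₑ ^ 2 ∂μ) + ∫⁻ x, ‖g x‖ₑ ^ 2 ∂μ) := by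
  rw [← lintegral_add_right' _ (hg.pow_const 2), ← lintegral_const_mul' _ _ (by simp)]
  refine lintegral_mono fun x => ?_
  have h : ‖f x‖ₑ ≤ ‖f x - g x‖ₑ + ‖g x‖ₑ := by
    simpa using enorm_add_le (f x - g x) (g x)
  have h3 := ENNReal.rpow_add_le_mul_rpow_add_rpow ‖f x - g x‖ₑ ‖g x‖ₑ (p := 2) (by norm_num)
  norm_num at h3
  exact (pow_le_pow_left' h 2).trans h3

/-- Since `h ≤ τ * diam ≤ τ * σ * ρ`, the inscribed radii are at least `h / (σ * τ)`. A nonempty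
domain has at least one simplex, which forces `σ`, `τ` and `h` to be positive. -/
theorem IsTriangulation.isRegularMesh {d : ℕ} (hd : 0 < d) {Ω : Set (Pt d)}
    {T : Finset (Finset (Pt d))} {σ τ h : ℝ} (hT : IsTriangulation Ω T) (hΩ : Ω.Nonempty)
    (hσ : IsShapeRegular σ T) (hτ : IsQuasiUniform τ h T) :
    IsRegularMesh Ω T (1 / (σ * τ)) h := by
  have hdiam : ∀ s, ∀ x ∈ cell s, ∀ y ∈ cell s, dist x y ≤ Metric.diam (cell (d := d) s) :=
    fun s x hx y hy => Metric.dist_le_diam_of_mem (isCompact_cell s).isBounded hx hy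
  obtain ⟨x, hx⟩ := hΩ
  have hxT : x ∈ ⋃ s ∈ T, cell s := by rw [hT.cover]; exact subset_closure hx
  obtain ⟨s, hs, -⟩ := mem_iUnion₂.1 hxT
  obtain ⟨c, ρ, hρ, hc, hsρ⟩ := hσ s hs
  have hpos : 0 < Metric.diam (cell s) := by
    have h1 := hdiam s (c + ρ • EuclideanSpace.single (⟨0, hd⟩ : Fin d) (1 : ℝ)) (hc (by
      rw [Metric.mem_closedBall, dist_eq_norm, add_sub_cancel_left, norm_smul,
        Real.norm_of_nonneg hρ.le]
      simp)) c (hc (Metric.mem_closedBall_self hρ.le))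
    rw [dist_eq_norm, add_sub_cancel_left, norm_smul, Real.norm_of_nonneg hρ.le] at h1
    simp only [PiLp.norm_single, norm_one, mul_one] at h1
    linarith
  have hh : 0 < h := hpos.trans_le (hτ s hs).1
  have hτ0 : 0 < τ := pos_of_mul_pos_left (hh.trans_le (hτ s hs).2) hpos.le
  have hσ0 : 0 < σ := pos_of_mul_pos_left (hpos.trans_le hsρ) hρ.le
  refine ⟨hT, by positivity, hh, fun t ht => ?_, fun t ht x hx y hy =>
    (hdiam t x hx y hy).trans (hτ t ht).1⟩
  obtain ⟨c, ρ, hρ, hc, htρ⟩ := hσ t ht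
  refine ⟨c, (Metric.closedBall_subset_closedBall ?_).trans hc⟩
  rw [div_mul_eq_mul_div, one_mul, div_le_iff₀ (by positivity)]
  calc h ≤ τ * Metric.diam (cell t) := (hτ t ht).2
    _ ≤ τ * (σ * ρ) := by gcongr
    _ = ρ * (σ * τ) := by ring

namespace IsRegularMesh

variable {d : ℕ} {Ω : Set (Pt d)} {T S : Finset (Finset (Pt d))} {θ h : ℝ}

theorem lintegral_cell_le_of_vanishesOn (hM : IsRegularMesh Ω T θ h) (hd : 0 < d) (hST : S ⊆ T)
    {z : Pt d} {ρ : ℝ} (hρ : 0 < ρ) (hz : NodeConnected Ω S z (ρ * h)) (hzΩ : z ∈ frontier Ω)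
    {s : Finset (Pt d)} (hs : s ∈ S) (hzs : z ∈ s) {v : Pt d → ℝ} {G : Pt d → Pt d}
    (hv : MemH1 (meshDomain S) v G) (hv0 : VanishesOn (meshDomain S) (outerBoundary Ω S) v G) :
    ∫⁻ x in cell s, ‖v x‖ₑ ^ 2 ≤ 4 * traceConst d θ ρ * ENNReal.ofReal h ^ 2 *
      ∫⁻ x in Metric.closedBall z (ρ * h) ∩ meshDomain S, ‖G x‖ₑ ^ 2 := by
  set U := meshDomain S
  set W := Metric.closedBall z (ρ * h) ∩ U
  set c := traceConst d θ ρ * ENNReal.ofReal h ^ 2 with hcdef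
  have hc : c ≠ ⊤ := ENNReal.mul_ne_top (traceConst_ne_top d θ ρ) (by finiteness)
  -- An `ε`-approximation that vanishes near the boundary costs `2 (ε² + 2 c (ε² + X))`, with `X`
  -- the gradient term of `v`. The coefficient of `ε²` is `2 + 4 * c`, and the rest is the claim.
  refine ENNReal.le_of_forall_le_add_mul_sq (c := 2 + 4 * c) (by finiteness) fun ε hε => ?_
  obtain ⟨w, F, hw, hO, hvw, hGF⟩ := hv0 ε hε
  have h1 : ∫⁻ x in cell s, ‖v x - w x‖ₑ ^ 2 ≤ ENNReal.ofReal ε ^ 2 := by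
    rw [← Measure.restrict_congr_set (interior_ae_eq_cell s)]
    refine (lintegral_mono_set (interior_cell_subset_meshDomain hs)).trans ?_
    rw [← normL2_sq]
    exact pow_le_pow_left' hvw 2
  have h2 : ∫⁻ x in W, ‖F x - G x‖ₑ ^ 2 ≤ ENNReal.ofReal ε ^ 2 := by
    refine (lintegral_mono_set inter_subset_right).trans ?_
    have h3 := pow_le_pow_left' hGF 2
    rw [show eLpNorm (fun x => G x - F x) 2 (volume.restrict U) = normL2 U _ from rfl,
      normL2_sq] at h3
    refine le_trans (le_of_eq (lintegral_congr fun x => ?_)) h3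
    rw [← enorm_neg, neg_sub]
  have h3 := hM.lintegral_cell_le_of_vanishing hd hST hρ hz hzΩ hs hzs hw hO
  have h4 : ∫⁻ x in W, ‖F x‖ₑ ^ 2 ≤
      2 * ((∫⁻ x in W, ‖F x - G x‖ₑ ^ 2) + ∫⁻ x in W, ‖G x‖ₑ ^ 2) :=
    lintegral_enorm_sq_le_two_mul (hv.memLp_grad.aestronglyMeasurable.enorm.mono_measure
      (Measure.restrict_mono inter_subset_right le_rfl))
  calc ∫⁻ x in cell s, ‖v x‖ₑ ^ 2
      ≤ 2 * ((∫⁻ x in cell s, ‖v x - w x‖ₑ ^ 2) + ∫⁻ x in cell s, ‖w x‖ₑ ^ 2) :=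
        lintegral_enorm_sq_le_two_mul (aemeasurable_restrict_cell hw hs).enorm
    _ ≤ 2 * (ENNReal.ofReal ε ^ 2 +
          c * (2 * (ENNReal.ofReal ε ^ 2 + ∫⁻ x in W, ‖G x‖ₑ ^ 2))) := by
        gcongr
        refine h3.trans (mul_le_mul' le_rfl (h4.trans ?_))
        gcongr
    _ = _ := by rw [hcdef]; ring

theorem overlapConst_ne_top (d : ℕ) (θ ρ : ℝ) : overlapConst d θ ρ ≠ ⊤ := by
  unfold overlapConst; finiteness

/-- The constant in the node estimate for the lumped-mass projection. -/
noncomputable def nodeConst (d : ℕ) (θ ρ : ℝ) : ℝ≥0∞ :=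
  meanConst d θ * patchConst d θ ρ + 4 * traceConst d θ ρ

theorem nodeConst_ne_top (d : ℕ) (θ ρ : ℝ) : nodeConst d θ ρ ≠ ⊤ := by
  have h1 := patchConst_ne_top d θ ρ
  have h2 := traceConst_ne_top d θ ρ
  unfold nodeConst meanConst
  finiteness

/-- The constant in the lemma on the stability of the lumped-mass projection. -/
noncomputable def stabilityConst (d : ℕ) (θ ρ : ℝ) : ℝ :=
  1 + ((d + 1 : ℕ) * ENNReal.ofReal (1 / θ) ^ 2 *
    (nodeConst d θ ρ * overlapConst d θ ρ)).toReal +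
    (nodeConst d θ ρ * overlapConst d θ ρ).toReal

theorem one_le_stabilityConst (d : ℕ) (θ ρ : ℝ) : 1 ≤ stabilityConst d θ ρ := by
  unfold stabilityConst
  have h1 := ENNReal.toReal_nonneg (a := (d + 1 : ℕ) * ENNReal.ofReal (1 / θ) ^ 2 *
    (nodeConst d θ ρ * overlapConst d θ ρ))
  have h2 := ENNReal.toReal_nonneg (a := nodeConst d θ ρ * overlapConst d θ ρ)
  linarith

theorem stableAndApproximating (hM : IsRegularMesh Ω T θ h) (hST : S ⊆ T)
    {v : Pt d → ℝ} {G : Pt d → Pt d} (hv : MemH1 (meshDomain S) v G) (c : Pt d → ℝ) {ρ : ℝ}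
    (hρ : 0 < ρ) {P : (Pt d → ℝ) → Pt d → ℝ}
    (hP : ∀ x, P v x = ∑ z ∈ gridNodes S, c z * hat S z x)
    (hc : ∀ s ∈ S, ∀ z ∈ s, ∫⁻ x in cell s, ‖v x - c z‖ₑ ^ 2 ≤
      nodeConst d θ ρ * ENNReal.ofReal h ^ 2 *
        ∫⁻ x in Metric.closedBall z (ρ * h) ∩ meshDomain S, ‖G x‖ₑ ^ 2) :
    StableAndApproximating (stabilityConst d θ ρ) h (meshDomain S) P v G := by
  obtain ⟨⟨G', hG', h1⟩, h2⟩ := hM.interpolant_estimates hST hv c hρ hc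
  have hP' : P v = fun x => ∑ z ∈ gridNodes S, c z * hat S z x := funext hP
  have ht1 : nodeConst d θ ρ * overlapConst d θ ρ ≠ ⊤ :=
    ENNReal.mul_ne_top (nodeConst_ne_top d θ ρ) (overlapConst_ne_top d θ ρ)
  have ht2 : (d + 1 : ℕ) * ENNReal.ofReal (1 / θ) ^ 2 *
      (nodeConst d θ ρ * overlapConst d θ ρ) ≠ ⊤ := ENNReal.mul_ne_top (by finiteness) ht1
  have hn1 := ENNReal.toReal_nonneg (a := (d + 1 : ℕ) * ENNReal.ofReal (1 / θ) ^ 2 *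
    (nodeConst d θ ρ * overlapConst d θ ρ))
  have hn2 := ENNReal.toReal_nonneg (a := nodeConst d θ ρ * overlapConst d θ ρ)
  have hC := one_le_stabilityConst d θ ρ
  rw [StableAndApproximating, hP']
  refine ⟨⟨G', hG', normL2_le_of_lintegral_le (h1.trans ?_)⟩,
    normL2_le_of_lintegral_le (h2.trans ?_)⟩
  · gcongr
    exact le_ofReal_sq ht2 hC (by unfold stabilityConst; linarith)
  · rw [ENNReal.ofReal_mul (by linarith), mul_pow]
    gcongr
    exact le_ofReal_sq ht1 hC (by unfold stabilityConst; linarith)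

theorem lintegral_sub_nodalMean_le_nodeConst (hM : IsRegularMesh Ω T θ h) (hd : 0 < d)
    (hST : S ⊆ T) {ρ : ℝ} (hρ : 0 < ρ) {z : Pt d} (hz : NodeConnected Ω S z (ρ * h))
    {v : Pt d → ℝ} {G : Pt d → Pt d} (hv : MemH1 (meshDomain S) v G) {s : Finset (Pt d)}
    (hs : s ∈ S) (hzs : z ∈ s) :
    ∫⁻ x in cell s, ‖v x - nodalMean S v z‖ₑ ^ 2 ≤ nodeConst d θ ρ * ENNReal.ofReal h ^ 2 *
        ∫⁻ x in Metric.closedBall z (ρ * h) ∩ meshDomain S, ‖G x‖ₑ ^ 2 := by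
  obtain ⟨R, hRS, hRz, hreach, hR, -⟩ := hz
  refine (hM.lintegral_sub_nodalMean_le hST hv.memLp hs hzs
    (Y := patchConst d θ ρ * ENNReal.ofReal h ^ 2 *
        ∫⁻ x in Metric.closedBall z (ρ * h) ∩ meshDomain S, ‖G x‖ₑ ^ 2) fun t ht hzt => ?_).trans ?_
  · refine (hM.energy_reachable_le hd hv hST hRS hρ hRz (hR s hs hzs)
      (hreach t ht s hs hzt hzs)).trans (le_of_eq (by ring))
  · rw [← mul_assoc, ← mul_assoc]
    gcongr
    exact le_self_add

end IsRegularMesh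

theorem lemma4p3 (d : ℕ) (hd : d = 2 ∨ d = 3) (σ τ κ : ℝ) (L : ℝ≥0) :
    ∃ C : ℝ, 0 < C ∧
      ∀ (Ω Γ : Set (Pt d)) (Ωs : Fin 2 → Set (Pt d)),
        IsBoundedLipschitzDomain Ω → IsSmoothInterface L Ω Γ Ωs →
        ∃ h₀ : ℝ, 0 < h₀ ∧
          ∀ (T : Finset (Finset (Pt d))) (h δ : ℝ) (k : Fin 2) (S : Finset (Finset (Pt d)))
            (U : Set (Pt d)),
            IsTriangulation Ω T → IsShapeRegular σ T → IsQuasiUniform τ h T →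
            0 ≤ δ → δ ≤ κ * h →
            S = activeCells T (Ωs k) δ → U = meshDomain S →
            (∀ v : Pt d → ℝ, MemLp v 2 (volume.restrict U) →
              normL2 U (lumpedProj S (gridNodes S) v) ≤ ENNReal.ofReal C * normL2 U v ∧
              normL2 U (lumpedProj S (freeNodes Ω S) v) ≤ ENNReal.ofReal C * normL2 U v) ∧
            (h ≤ h₀ → ∀ (v : Pt d → ℝ) (G : Pt d → Pt d), MemH1 U v G →
              StableAndApproximating C h U (lumpedProj S (gridNodes S)) v G ∧
              (VanishesOn U (outerBoundary Ω S) v G →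
                StableAndApproximating C h U (lumpedProj S (freeNodes Ω S)) v G)) := by
  have hd0 : 0 < d := by omega
  set ρ := patchRadius κ L with hρdef
  set θ := 1 / (σ * τ) with hθ
  have hC := IsRegularMesh.one_le_stabilityConst d θ ρ
  refine ⟨IsRegularMesh.stabilityConst d θ ρ, by linarith, fun Ω Γ Ωs hΩ hΓ => ?_⟩
  obtain ⟨h₀, hh₀, hnode⟩ := hΓ.exists_nodeConnected hΩ κ
  refine ⟨h₀, hh₀, ?_⟩
  rintro T h δ k S U hT hσ hτ hδ hδκ rfl rfl
  have hM := hT.isRegularMesh hd0 hΩ.isConnected.nonempty hσ hτ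
  -- Forced by `0 ≤ δ ≤ κ * h` and the positivity of `h`.
  have hκ : 0 ≤ κ := by
    have := hM.h_pos
    by_contra! h0
    nlinarith
  have hρ : 0 < ρ := by rw [hρdef]; unfold patchRadius; positivity
  have hST : activeCells T (Ωs k) δ ⊆ T := by
    classical
    exact Finset.filter_subset _ _
  set S := activeCells T (Ωs k) δ
  have hfree : freeNodes Ω S ⊆ gridNodes S := by
    classical
    exact Finset.filter_subset _ _
  have hmem : ∀ s ∈ S, ∀ z ∈ s, z ∈ gridNodes S := fun s hs z hz => by
    classical
    exact Finset.mem_biUnion.2 ⟨s, hs, hz⟩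
  refine ⟨fun v hv => ?_, fun hh v G hv => ?_⟩
  · have hL2 : ∀ N ⊆ gridNodes S, normL2 (meshDomain S) (lumpedProj S N v) ≤
        ENNReal.ofReal (IsRegularMesh.stabilityConst d θ ρ) * normL2 (meshDomain S) v := by
      intro N hN
      refine normL2_le_of_lintegral_le ((hT.lintegral_lumpedProj_le hST hN hv).trans ?_)
      refine le_mul_of_one_le_left' (one_le_pow_of_one_le' ?_ 2)
      rwa [ENNReal.one_le_ofReal]
    exact ⟨hL2 _ subset_rfl, hL2 _ hfree⟩
  · have hz : ∀ z ∈ gridNodes S, NodeConnected Ω S z (ρ * h) :=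
      hnode k T θ h δ hM hδ hδκ hh
    refine ⟨hM.stableAndApproximating hST hv (nodalMean S v) hρ (fun x => rfl) fun s hs z hzs =>
      hM.lintegral_sub_nodalMean_le_nodeConst hd0 hST hρ (hz z (hmem s hs z hzs)) hv hs hzs,
      fun hv0 => ?_⟩
    classical
    -- The projection onto free nodes is read as a sum over all nodes with coefficient zero on the
    -- outer boundary. There the function itself has to be small near the node, which is where its
    -- boundary values enter.
    refine hM.stableAndApproximating hST hv
      (fun z => if z ∈ outerBoundary Ω S then 0 else nodalMean S v z) hρ (fun x => ?_)
      fun s hs z hzs => ?_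
    · rw [lumpedProj, freeNodes, Finset.sum_filter]
      refine Finset.sum_congr rfl fun z _ => ?_
      by_cases hzb : z ∈ outerBoundary Ω S <;> simp [hzb, nodalMean]
    · by_cases hzb : z ∈ outerBoundary Ω S
      · simp only [hzb, if_true, sub_zero]
        refine (hM.lintegral_cell_le_of_vanishesOn hd0 hST hρ (hz z (hmem s hs z hzs)) hzb.1 hs hzs
          hv hv0).trans ?_
        gcongr
        exact le_add_self
      · simp only [hzb, if_false]
        exact hM.lintegral_sub_nodalMean_le_nodeConst hd0 hST hρ (hz z (hmem s hs z hzs)) hv hs hzs
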